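/- Let $N\ge 1$ and let $B_1=\{x\in\mathbb R^N:\|x\|_2<1\}$. For $\lambda>0$ consider the steady-state problem $$\Delta w+\frac{\lambda}{(1-w)^2\Big(1+\int_{B_1}\frac{dx}{1-w}\Big)^2}=0\ \text{ in } B_1,\qquad w=0\ \text{ on }\partial B_1. \tag{P}$$ A classical solution of (P) is a function $w\in C^2(B_1)\cap C(\overline{B_1})$ with $0\le w<1$ on $\overline{B_1}$ that satisfies (P). A weak finite-energy solution of (P) is a function $w\in H^1_0(B_1)$ for which there is a sequence $w_j$, $j\ge 1$, of functions in $C^2(B_1)\cap C(\overline{B_1})$ vanishing on $\partial B_1$ such that, as $j\to\infty$, $$w_j\rightharpoonup w\ \text{ weakly in } H^1_0(B_1),\qquad w_j\to w\ \text{ a.e. in } B_1,$$ $$\frac1{(1-w_j)^2}\to\frac1{(1-w)^2}\ \text{ and }\ \frac1{1-w_j}\to\frac1{1-w}\ \text{ in } L^1(B_1),$$ $$\Delta w_j+\frac{\lambda}{(1-w_j)^2\Big(1+\int_{B_1}\frac{dx}{1-w_j}\Big)^2}\to 0\ \text{ in } L^2(B_1)$$ (where the reciprocals are required to be defined a.e.).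 Call a solution radially decreasing if it is a nonincreasing function of $\|x\|_2$ on $B_1$ (for weak solutions: if it has such a representative). Let $$\lambda^*=\sup\{\lambda>0:\ \text{(P) has a radially decreasing classical solution}\},$$ $$\widehat\lambda=\sup\{\lambda>0:\ \text{(P) has a radially decreasing weak finite-energy solution}\},$$ suprema being taken in the extended reals. Then $\lambda^*=\widehat\lambda$. -/

import Mathlib

open MeasureTheory Filter Topology
open scoped ContDiff InnerProductSpace Laplacian

noncomputable section

namespace MEMS

/-- Euclidean space `ℝ^N` with the norm `‖x‖₂`. -/
abbrev E (N : ℕ) : Type := EuclideanSpace ℝ (Fin N)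

/-- The open unit ball `B₁` of `ℝ^N`, centred at the origin. -/
def B (N : ℕ) : Set (E N) := Metric.ball 0 1

/-- Smooth test functions with compact support in `Ω`. -/
def IsTestFunction {N : ℕ} (Ω : Set (E N)) (φ : E N → ℝ) : Prop :=
  ContDiff ℝ ∞ φ ∧ HasCompactSupport φ ∧ tsupport φ ⊆ Ω

/-- `f j → g` in `L^p(Ω)`, all the functions involved being in `L^p(Ω)`. -/
def ConvergesLp {N : ℕ} {F : Type} [NormedAddCommGroup F] (Ω : Set (E N)) (p : ENNReal)
    (f : ℕ → E N → F) (g : E N → F) : Prop :=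
  (∀ j, MemLp (f j) p (volume.restrict Ω)) ∧ MemLp g p (volume.restrict Ω) ∧
    Tendsto (fun j => eLpNorm (f j - g) p (volume.restrict Ω)) atTop (𝓝 0)

/-- `w ∈ H¹₀(Ω)` with weak gradient `G`: the space `H¹₀(Ω)` is the closure of the test functions
in the `H¹` norm, and `G` is the `L²` limit of the gradients (unique up to null sets). -/
def HasH10Gradient {N : ℕ} (Ω : Set (E N)) (w : E N → ℝ) (G : E N → E N) : Prop :=
  ∃ φ : ℕ → E N → ℝ, (∀ k, IsTestFunction Ω (φ k)) ∧
    ConvergesLp Ω 2 φ w ∧ ConvergesLp Ω 2 (fun k => gradient (φ k)) G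

/-- Weak convergence `u j ⇀ w` in the Hilbert space `H¹₀(Ω)`, i.e. convergence of the `H¹` inner
products with every element of `H¹₀(Ω)`. It includes that all `u j` and `w` are in `H¹₀(Ω)`. -/
def WeaklyConvergesH10 {N : ℕ} (Ω : Set (E N)) (u : ℕ → E N → ℝ) (w : E N → ℝ) : Prop :=
  ∃ (G : ℕ → E N → E N) (Gw : E N → E N),
    (∀ j, HasH10Gradient Ω (u j) (G j)) ∧ HasH10Gradient Ω w Gw ∧
    ∀ (φ : E N → ℝ) (Φ : E N → E N), HasH10Gradient Ω φ Φ →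
      Tendsto (fun j => (∫ x in Ω, u j x * φ x) + ∫ x in Ω, ⟪G j x, Φ x⟫_ℝ) atTop
        (𝓝 ((∫ x in Ω, w x * φ x) + ∫ x in Ω, ⟪Gw x, Φ x⟫_ℝ))

/-- `w ∈ C²(Ω) ∩ C₀(Ω)`: twice continuously differentiable in the open set `Ω`, continuous on its
closure and zero on its boundary. -/
def IsC2C0 {N : ℕ} (Ω : Set (E N)) (w : E N → ℝ) : Prop :=
  ContDiffOn ℝ 2 w Ω ∧ ContinuousOn w (closure Ω) ∧ ∀ x ∈ frontier Ω, w x = 0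

/-- The nonlocal factor `1 + ∫_Ω dx / (1 - w)`. -/
def nonlocalFactor {N : ℕ} (Ω : Set (E N)) (w : E N → ℝ) : ℝ :=
  1 + ∫ x in Ω, 1 / (1 - w x)

/-- The left-hand side `Δw + lam / ((1 - w)² (1 + ∫_Ω dx / (1 - w))²)` of the steady-state
equation. -/
def residual {N : ℕ} (Ω : Set (E N)) (lam : ℝ) (w : E N → ℝ) (x : E N) : ℝ :=
  (Δ w) x + lam / ((1 - w x) ^ 2 * (nonlocalFactor Ω w) ^ 2)

/-- `w` is a classical solution of the steady-state problem; `0 ≤ w < 1` on the closure. -/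
def IsClassicalSolution {N : ℕ} (Ω : Set (E N)) (lam : ℝ) (w : E N → ℝ) : Prop :=
  IsC2C0 Ω w ∧ (∀ x ∈ closure Ω, 0 ≤ w x ∧ w x < 1) ∧ ∀ x ∈ Ω, residual Ω lam w x = 0

/-- `w` is a weak finite-energy solution of the steady-state problem. The conditions `≠ 1` almost
everywhere say that the reciprocals, whose `L¹` convergence is required, are defined almost
everywhere (division by zero has a default value here). -/
def IsWeakFiniteEnergySolution {N : ℕ} (Ω : Set (E N)) (lam : ℝ) (w : E N → ℝ) : Prop :=
  ∃ u : ℕ → E N → ℝ,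
    (∀ j, IsC2C0 Ω (u j)) ∧
    WeaklyConvergesH10 Ω u w ∧
    (∀ᵐ x ∂(volume.restrict Ω), Tendsto (fun j => u j x) atTop (𝓝 (w x))) ∧
    (∀ j, ∀ᵐ x ∂(volume.restrict Ω), u j x ≠ 1) ∧
    (∀ᵐ x ∂(volume.restrict Ω), w x ≠ 1) ∧
    ConvergesLp Ω 1 (fun j x => 1 / (1 - u j x) ^ 2) (fun x => 1 / (1 - w x) ^ 2) ∧
    ConvergesLp Ω 1 (fun j x => 1 / (1 - u j x)) (fun x => 1 / (1 - w x)) ∧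
    ConvergesLp Ω 2 (fun j => residual Ω lam (u j)) (fun _ => (0 : ℝ))

/-- `w` is a (nonincreasing) function of `r = ‖x‖` on `Ω`; in particular it is radial there. -/
def RadiallyDecreasingOn {N : ℕ} (Ω : Set (E N)) (w : E N → ℝ) : Prop :=
  ∀ x ∈ Ω, ∀ y ∈ Ω, ‖x‖ ≤ ‖y‖ → w y ≤ w x

/-- The `lam > 0` for which the problem on the unit ball has a radially decreasing classical
solution. -/
def classicalSpectrum (N : ℕ) : Set ℝ :=
  {lam | 0 < lam ∧ ∃ w : E N → ℝ, IsClassicalSolution (B N) lam w ∧ RadiallyDecreasingOn (B N) w}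

/-- The `lam > 0` for which the problem on the unit ball has a radially decreasing weak
finite-energy solution; weak solutions are identified when they agree almost everywhere, so the
monotonicity is that of a representative (being a solution does not depend on the
representative). -/
def weakSpectrum (N : ℕ) : Set ℝ :=
  {lam | 0 < lam ∧
    ∃ w : E N → ℝ, IsWeakFiniteEnergySolution (B N) lam w ∧ RadiallyDecreasingOn (B N) w}

/-- `λ*`, as a supremum of extended real numbers. -/
def lamStar (N : ℕ) : EReal := sSup ((fun l : ℝ => (l : EReal)) '' classicalSpectrum N)

/-- `λ̂`, as a supremum of extended real numbers. -/
def lamHat (N : ℕ) : EReal := sSup ((fun l : ℝ => (l : EReal)) '' weakSpectrum N)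

end MEMS

end

/-!
Classical solutions are weak finite-energy solutions: the approximating sequence can be taken
constant, once a classical solution is known to lie in `H¹₀`, which follows from truncation and
mollification (`IsClassicalSolution.isWeakFiniteEnergySolution`). This gives `λ* ≤ λ̂`.

For the converse, the limits in the definition of a weak solution `w` are taken in the equation
tested with smooth functions, which gives `-Δw = μ / (1 - w)²` with
`μ = λ / (1 + ∫ 1 / (1 - w))²` (`IsWeakFiniteEnergySolution.weak_equation`). For radial `w`, testing
with the radial solutions of Poisson's equation turns it into the integrated radial equation for the
gap `V = 1 - w`, a nondecreasing function of `r = ‖x‖` which is positive for `r > 0`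
(`IsWeakFiniteEnergySolution.exists_gap`). There are two cases.

If `V` stays away from zero, `w` is a classical solution (`mem_classicalSpectrum_of_gap_ge`), and so
`λ ≤ λ*`.

If `V → 0` at the origin, then `V` has order `r^{2/3}` there, from above and below; in dimension one
the integrability of `1 / V²` excludes this. In the Emden–Fowler variables `V = r^{2/3} v`,
`r = e^t`, the equation becomes `v'' + (N - 2/3) v' + (2/3)(N - 4/3) v = μ / v²`, an autonomous
damped oscillator with one equilibrium. It has a Lyapunov function that decays exponentially along
every solution (`antitoneOn_exp_mul_energy`), so that a solution with bounded energy as `t → -∞` is the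
equilibrium (`eq_of_energy_bounded`). Hence `w = 1 - ‖x‖^{2/3}` and `μ = (2/3)(N - 4/3)`
(`eq_rpow_of_tendsto_gap`): a single value of `λ`. It is the limit of values for which there are
classical solutions. Indeed, the global solution of `ΔV = 1 / V²`, `V(0) = 1`, which exists by the
contraction principle (`exists_regular_solution`), is asymptotic to a multiple of `r^{2/3}`, by the
same Lyapunov function (`tendsto_equilibrium`). Its rescalings `1 - V(β ‖x‖) / V(β)` are classical
solutions whose parameters tend to that value as `β → ∞`, by dominated convergence
(`le_lamStar_of_rpow`). So `λ ≤ λ*` in this case as well.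
-/

namespace MEMS

/-! ### Divergence and Green's formula -/

/-- The divergence `∑ ∂ᵢ Xᵢ` of a vector field on `ℝ^N`. -/
noncomputable def divergence {N : ℕ} (X : E N → E N) (x : E N) : ℝ :=
  ∑ i, (fderiv ℝ X x (EuclideanSpace.single i 1)) i

theorem sum_mul_single {N : ℕ} (L : E N →L[ℝ] ℝ) (v : E N) :
    ∑ i, L (EuclideanSpace.single i 1) * v i = L v := by
  have h : v = ∑ i, v i • (EuclideanSpace.single i (1 : ℝ) : E N) := by
    ext j
    simp [Pi.single_apply]
  conv_rhs => rw [h]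
  simp [mul_comm]

theorem continuousOn_divergence {N : ℕ} {X : E N → E N} {Ω : Set (E N)} (hΩ : IsOpen Ω)
    (hX : ContDiffOn ℝ 1 X Ω) : ContinuousOn (divergence X) Ω := by
  have h := hX.continuousOn_fderiv_of_isOpen hΩ le_rfl
  unfold divergence
  fun_prop

theorem continuous_divergence {N : ℕ} {X : E N → E N} (hX : ContDiff ℝ 1 X) :
    Continuous (divergence X) :=
  continuousOn_univ.1 (continuousOn_divergence isOpen_univ hX.contDiffOn)

theorem divergence_smul {N : ℕ} {φ : E N → ℝ} {X : E N → E N} {x : E N}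
    (hφ : DifferentiableAt ℝ φ x) (hX : DifferentiableAt ℝ X x) :
    divergence (fun y => φ y • X y) x = φ x * divergence X x + ⟪gradient φ x, X x⟫_ℝ := by
  unfold divergence
  rw [fderiv_fun_smul hφ hX, inner_gradient_left, ← sum_mul_single (fderiv ℝ φ x) (X x),
    Finset.mul_sum, ← Finset.sum_add_distrib]
  refine Finset.sum_congr rfl fun i _ => ?_
  simp

theorem integral_divergence_eq_zero {N : ℕ} {X : E N → E N} (hX : ContDiff ℝ 1 X)
    (hc : HasCompactSupport X) : ∫ x, divergence X x = 0 := by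
  have hd : Differentiable ℝ X := hX.differentiable one_ne_zero
  have hcomp : ∀ i x, (fderiv ℝ X x (EuclideanSpace.single i 1)) i
      = fderiv ℝ (fun y => X y i) x (EuclideanSpace.single i 1) := by
    intro i x
    have h := (EuclideanSpace.proj (𝕜 := ℝ) i : E N →L[ℝ] ℝ).hasFDerivAt.comp x
      (hd x).hasFDerivAt
    have h2 : fderiv ℝ (fun y => X y i) x = _ := h.fderiv
    rw [h2]; rfl
  have hCi : ∀ i, ContDiff ℝ 1 fun y => X y i := fun i => by fun_prop
  have hci : ∀ i, HasCompactSupport fun y => X y i := fun i =>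
    hc.comp_left (g := fun v : E N => v i) rfl
  have hint : ∀ i, Integrable
      (fun x => fderiv ℝ (fun y => X y i) x (EuclideanSpace.single i 1)) := fun i =>
    Continuous.integrable_of_hasCompactSupport
      (((hCi i).continuous_fderiv one_ne_zero).clm_apply continuous_const) ((hci i).fderiv_apply ℝ _)
  unfold divergence
  simp_rw [hcomp]
  rw [integral_finsetSum _ fun i _ => hint i]
  refine Finset.sum_eq_zero fun i _ => ?_
  have h := integral_mul_fderiv_eq_neg_fderiv_mul_of_integrable (μ := (volume : Measure (E N)))
    (f := fun _ : E N => (1 : ℝ)) (g := fun y => X y i) (v := EuclideanSpace.single i 1)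
    (by simp) (by simpa using hint i)
    (by simpa using (hCi i).continuous.integrable_of_hasCompactSupport (hci i))
    (fun x _ => by fun_prop) (fun x _ => (hCi i).differentiable one_ne_zero x)
  simpa using h

theorem gradient_eq_zero_of_notMem_tsupport {N : ℕ} {φ : E N → ℝ} {x : E N} (hx : x ∉ tsupport φ) :
    gradient φ x = 0 := by
  have h : φ =ᶠ[𝓝 x] fun _ => 0 := notMem_tsupport_iff_eventuallyEq.1 hx
  rw [h.gradient_eq, gradient_fun_const]

theorem contDiff_gradient {N : ℕ} {φ : E N → ℝ} {n m : WithTop ℕ∞} (h : ContDiff ℝ n φ)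
    (hmn : m + 1 ≤ n) : ContDiff ℝ m (gradient φ) :=
  ((InnerProductSpace.toDual ℝ (E N)).symm.contDiff).comp (h.fderiv_right hmn)

theorem contDiffOn_gradient {N : ℕ} {φ : E N → ℝ} {n m : WithTop ℕ∞} {Ω : Set (E N)}
    (hΩ : IsOpen Ω) (h : ContDiffOn ℝ n φ Ω)
    (hmn : m + 1 ≤ n) : ContDiffOn ℝ m (gradient φ) Ω :=
  ((InnerProductSpace.toDual ℝ (E N)).symm.contDiff).comp_contDiffOn (h.fderiv_of_isOpen hΩ hmn)

/-- Green's formula in an open set `Ω`, one of the two factors being supported in a compact subset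
`K` of `Ω`. -/
theorem setIntegral_mul_divergence {N : ℕ} {Ω K : Set (E N)} (hΩ : IsOpen Ω) (hK : IsCompact K)
    (hKΩ : K ⊆ Ω) {φ : E N → ℝ} {X : E N → E N} (hφ : ContDiffOn ℝ 1 φ Ω)
    (hX : ContDiffOn ℝ 1 X Ω) (h : (∀ x, x ∉ K → φ x = 0) ∨ (∀ x, x ∉ K → X x = 0)) :
    ∫ x in Ω, φ x * divergence X x = - ∫ x in Ω, ⟪gradient φ x, X x⟫_ℝ := by
  have hev : ∀ x, x ∉ K → ∀ᶠ y in 𝓝 x, y ∉ K := fun x hx => hK.isClosed.isOpen_compl.mem_nhds hx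
  have hprod : ∀ x, x ∉ K → φ x • X x = 0 := by
    intro x hx
    rcases h with h | h <;> simp [h x hx]
  have hz : ∀ x, x ∉ K → φ x * divergence X x = 0 := by
    intro x hx
    rcases h with h | h
    · simp [h x hx]
    · have h1 : X =ᶠ[𝓝 x] fun _ => 0 := (hev x hx).mono fun y hy => h y hy
      simp [divergence, h1.fderiv_eq]
  have hz' : ∀ x, x ∉ K → ⟪gradient φ x, X x⟫_ℝ = 0 := by
    intro x hx
    rcases h with h | h
    · have h1 : φ =ᶠ[𝓝 x] fun _ => 0 := (hev x hx).mono fun y hy => h y hy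
      rw [h1.gradient_eq, gradient_fun_const, inner_zero_left]
    · simp [h x hx]
  have hC : ContDiff ℝ 1 fun y => φ y • X y := by
    refine contDiff_iff_contDiffAt.2 fun x => ?_
    by_cases hx : x ∈ K
    · exact (hφ.contDiffAt (hΩ.mem_nhds (hKΩ hx))).smul (hX.contDiffAt (hΩ.mem_nhds (hKΩ hx)))
    · exact contDiffAt_const.congr_of_eventuallyEq ((hev x hx).mono fun y hy => hprod y hy)
  have h0 := integral_divergence_eq_zero hC (HasCompactSupport.intro hK hprod)
  have hdiv : ∀ x, divergence (fun y => φ y • X y) x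
      = φ x * divergence X x + ⟪gradient φ x, X x⟫_ℝ := by
    intro x
    by_cases hx : x ∈ K
    · exact divergence_smul
        ((hφ.contDiffAt (hΩ.mem_nhds (hKΩ hx))).differentiableAt one_ne_zero)
        ((hX.contDiffAt (hΩ.mem_nhds (hKΩ hx))).differentiableAt one_ne_zero)
    · have h1 : (fun y => φ y • X y) =ᶠ[𝓝 x] fun _ => 0 := (hev x hx).mono fun y hy => hprod y hy
      rw [hz x hx, hz' x hx]
      simp [divergence, h1.fderiv_eq]
  rw [setIntegral_eq_integral_of_forall_compl_eq_zero fun x hx => hz x fun h => hx (hKΩ h),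
    setIntegral_eq_integral_of_forall_compl_eq_zero fun x hx => hz' x fun h => hx (hKΩ h)]
  have hco : ∀ (F : E N → ℝ), ContinuousOn F Ω → (∀ x, x ∉ K → F x = 0) → Integrable F := by
    intro F hF hF0
    have hcont : Continuous F := by
      refine continuous_of_tsupport fun x hx => ?_
      have : x ∈ K := by
        refine closure_minimal (fun y hy => ?_) hK.isClosed hx
        by_contra hy'
        exact hy (hF0 y hy')
      exact hF.continuousAt (hΩ.mem_nhds (hKΩ this))
    exact hcont.integrable_of_hasCompactSupport (HasCompactSupport.intro hK hF0)
  have i1 : Integrable fun x => φ x * divergence X x :=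
    hco _ (hφ.continuousOn.mul (continuousOn_divergence hΩ hX)) hz
  have i2 : Integrable fun x => ⟪gradient φ x, X x⟫_ℝ :=
    hco _ ((contDiffOn_gradient (m := 0) hΩ hφ (by simp)).continuousOn.inner hX.continuousOn) hz'
  simp_rw [hdiv] at h0
  rw [integral_add i1 i2] at h0
  linarith

theorem laplacian_eq_divergence_gradient {N : ℕ} {w : E N → ℝ} {x : E N}
    (hw : ContDiffAt ℝ 2 w x) : (Δ w) x = divergence (gradient w) x := by
  rw [InnerProductSpace.laplacian_eq_iteratedFDeriv_orthonormalBasis w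
    (EuclideanSpace.basisFun (Fin N) ℝ)]
  unfold divergence
  refine Finset.sum_congr rfl fun i _ => ?_
  rw [iteratedFDeriv_two_apply]
  have hd : DifferentiableAt ℝ (fderiv ℝ w) x :=
    (hw.fderiv_right (m := 1) (by norm_num)).differentiableAt one_ne_zero
  have h := ((InnerProductSpace.toDual ℝ
    (E N)).symm.toContinuousLinearEquiv.toContinuousLinearMap).hasFDerivAt.comp x hd.hasFDerivAt
  have h2 : fderiv ℝ (gradient w) x = _ := h.fderiv
  rw [h2]
  set L := fderiv ℝ (fderiv ℝ w) x (EuclideanSpace.single i 1) with hL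
  have h3 : ⟪(InnerProductSpace.toDual ℝ (E N)).symm L, EuclideanSpace.single i (1 : ℝ)⟫_ℝ
      = L (EuclideanSpace.single i 1) := InnerProductSpace.toDual_symm_apply
  have h4 : ∀ u : E N, ⟪u, EuclideanSpace.single i (1 : ℝ)⟫_ℝ = u i := fun u => by
    simp [EuclideanSpace.inner_single_right]
  rw [h4] at h3
  simp only [EuclideanSpace.basisFun_apply, Matrix.cons_val_zero, Matrix.cons_val_one]
  rw [← hL, ← h3]; rfl

/-! ### The Hilbert space `H¹₀` and weak convergence -/

theorem IsTestFunction.contDiff_nat {N : ℕ} {Ω : Set (E N)} {φ : E N → ℝ} (h : IsTestFunction Ω φ)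
    (n : ℕ) : ContDiff ℝ n φ :=
  h.1.of_le (by exact_mod_cast le_top)

theorem IsTestFunction.continuous_gradient {N : ℕ} {Ω : Set (E N)} {φ : E N → ℝ}
    (h : IsTestFunction Ω φ) : Continuous (gradient φ) :=
  (contDiff_gradient (m := 0) (h.contDiff_nat 1) (by simp)).continuous

theorem hasCompactSupport_gradient {N : ℕ} {φ : E N → ℝ} (h : HasCompactSupport φ) :
    HasCompactSupport (gradient φ) :=
  HasCompactSupport.intro h fun _ hx => gradient_eq_zero_of_notMem_tsupport hx

theorem IsTestFunction.memLp {N : ℕ} {Ω : Set (E N)} {φ : E N → ℝ} (h : IsTestFunction Ω φ)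
    (p : ENNReal) : MemLp φ p (volume.restrict Ω) :=
  (h.1.continuous.memLp_of_hasCompactSupport h.2.1).restrict Ω

theorem IsTestFunction.memLp_gradient {N : ℕ} {Ω : Set (E N)} {φ : E N → ℝ}
    (h : IsTestFunction Ω φ) (p : ENNReal) : MemLp (gradient φ) p (volume.restrict Ω) :=
  (h.continuous_gradient.memLp_of_hasCompactSupport (hasCompactSupport_gradient h.2.1)).restrict Ω

theorem gradient_add {N : ℕ} {φ ψ : E N → ℝ} {x : E N} (hφ : DifferentiableAt ℝ φ x)
    (hψ : DifferentiableAt ℝ ψ x) : gradient (φ + ψ) x = gradient φ x + gradient ψ x := by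
  simp [gradient, fderiv_add hφ hψ]

theorem gradient_const_smul {N : ℕ} {φ : E N → ℝ} {x : E N} (c : ℝ) (hφ : DifferentiableAt ℝ φ x) :
    gradient (c • φ) x = c • gradient φ x := by
  simp [gradient, fderiv_const_smul hφ c]

/-- `∫ ⟪f j, h⟫ → ∫ ⟪g, h⟫` when `f j → g` in `L²`. -/
theorem ConvergesLp.tendsto_integral_inner {N : ℕ} {F : Type} [NormedAddCommGroup F]
    [InnerProductSpace ℝ F] {Ω : Set (E N)} {f : ℕ → E N → F} {g h : E N → F}
    (hf : ConvergesLp Ω 2 f g) (hh : MemLp h 2 (volume.restrict Ω)) :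
    Tendsto (fun j => ∫ x in Ω, ⟪f j x, h x⟫_ℝ) atTop (𝓝 (∫ x in Ω, ⟪g x, h x⟫_ℝ)) := by
  obtain ⟨h1, h2, h3⟩ := hf
  have key : ∀ {k : E N → F} (hk : MemLp k 2 (volume.restrict Ω)),
      ∫ x in Ω, ⟪k x, h x⟫_ℝ = ⟪hk.toLp k, hh.toLp h⟫_ℝ := by
    intro k hk
    rw [L2.inner_def]
    refine integral_congr_ae ?_
    filter_upwards [hk.coeFn_toLp, hh.coeFn_toLp] with x hx hx'
    rw [hx, hx']
  have h4 := (Lp.tendsto_Lp_iff_tendsto_eLpNorm'' f h1 g h2).2 h3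
  simp_rw [key h2, fun j => key (h1 j)]
  exact h4.inner tendsto_const_nhds

theorem ConvergesLp.tendsto_integral_mul {N : ℕ} {Ω : Set (E N)} {f : ℕ → E N → ℝ} {g h : E N → ℝ}
    (hf : ConvergesLp Ω 2 f g) (hh : MemLp h 2 (volume.restrict Ω)) :
    Tendsto (fun j => ∫ x in Ω, f j x * h x) atTop (𝓝 (∫ x in Ω, g x * h x)) := by
  have := hf.tendsto_integral_inner hh
  simpa [mul_comm] using this

/-- `∫ h * f j → ∫ h * g` when `f j → g` in `L¹` and `h` is bounded. -/
theorem ConvergesLp.tendsto_integral_mul_of_bounded {N : ℕ} {Ω : Set (E N)} {f : ℕ → E N → ℝ}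
    {g h : E N → ℝ} {C : ℝ} (hf : ConvergesLp Ω 1 f g)
    (hm : AEStronglyMeasurable h (volume.restrict Ω)) (hC : ∀ x, |h x| ≤ C) :
    Tendsto (fun j => ∫ x in Ω, h x * f j x) atTop (𝓝 (∫ x in Ω, h x * g x)) := by
  obtain ⟨h1, h2, h3⟩ := hf
  refine tendsto_integral_of_L1' _ (hm.mul h2.1) (Eventually.of_forall fun j => ?_) ?_
  · exact (memLp_one_iff_integrable.1 (h1 j)).bdd_mul hm (Eventually.of_forall hC)
  · have hle : ∀ j, eLpNorm ((fun x => h x * f j x) - fun x => h x * g x) 1 (volume.restrict Ω)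
        ≤ ENNReal.ofReal C * eLpNorm (f j - g) 1 (volume.restrict Ω) := by
      intro j
      refine eLpNorm_le_mul_eLpNorm_of_ae_le_mul (Eventually.of_forall fun x => ?_) 1
      simp only [Pi.sub_apply, ← mul_sub, norm_mul, Real.norm_eq_abs]
      exact mul_le_mul_of_nonneg_right (hC x) (abs_nonneg _)
    refine tendsto_of_tendsto_of_tendsto_of_le_of_le tendsto_const_nhds ?_ (fun _ => zero_le) hle
    simpa using ENNReal.Tendsto.const_mul h3 (Or.inr ENNReal.ofReal_ne_top)

/-- The defining integration by parts of the weak gradient. The field `X` need not vanish near the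
boundary, since elements of `H¹₀` do. -/
theorem HasH10Gradient.integral_inner {N : ℕ} {w : E N → ℝ} {G : E N → E N}
    (h : HasH10Gradient (B N) w G) {X : E N → E N} (hX : ContDiff ℝ 1 X) :
    ∫ x in B N, ⟪G x, X x⟫_ℝ = - ∫ x in B N, w x * divergence X x := by
  obtain ⟨φ, hφ, h1, h2⟩ := h
  have hmem : ∀ {F : Type} [NormedAddCommGroup F] {f : E N → F}, Continuous f →
      [SecondCountableTopologyEither (E N) F] → MemLp f 2 (volume.restrict (B N)) := by
    intro F _ f hf _
    obtain ⟨C, hC⟩ := ((isCompact_closedBall (0 : E N) 1).image hf).isBounded.exists_norm_le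
    have : IsFiniteMeasure (volume.restrict (B N)) :=
      ⟨by rw [Measure.restrict_apply_univ]; exact measure_ball_lt_top⟩
    refine MemLp.of_bound hf.aestronglyMeasurable C ?_
    refine (ae_restrict_iff' measurableSet_ball).2 (Eventually.of_forall fun x hx => ?_)
    exact hC _ ⟨x, Metric.ball_subset_closedBall hx, rfl⟩
  have l1 := h1.tendsto_integral_mul (hmem (continuous_divergence hX))
  have l2 := h2.tendsto_integral_inner (hmem hX.continuous)
  have e : ∀ k, ∫ x in B N, ⟪gradient (φ k) x, X x⟫_ℝ
      = - ∫ x in B N, φ k x * divergence X x := fun k => by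
    rw [setIntegral_mul_divergence (Ω := B N) (K := tsupport (φ k)) Metric.isOpen_ball (hφ k).2.1
      (hφ k).2.2
      ((hφ k).contDiff_nat 1).contDiffOn hX.contDiffOn
      (Or.inl fun x hx => image_eq_zero_of_notMem_tsupport hx), neg_neg]
  simp_rw [e] at l2
  exact tendsto_nhds_unique l2 l1.neg

/-- The Hilbert space `L²(Ω) × L²(Ω; ℝ^N)`, in which `H¹₀(Ω)` is the closure of the pairs
`(φ, ∇φ)`. -/
abbrev GraphSpace {N : ℕ} (Ω : Set (E N)) : Type :=
  WithLp 2 (Lp ℝ 2 (volume.restrict Ω) × Lp (E N) 2 (volume.restrict Ω))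

/-- The subspace of the pairs `(φ, ∇φ)` with a test function `φ`. -/
def testGraph {N : ℕ} (Ω : Set (E N)) : Submodule ℝ (GraphSpace Ω) where
  carrier := {p | ∃ φ, IsTestFunction Ω φ ∧ p.fst =ᵐ[volume.restrict Ω] φ ∧
    p.snd =ᵐ[volume.restrict Ω] gradient φ}
  zero_mem' := by
    refine ⟨0, ⟨contDiff_const, HasCompactSupport.zero, by simp⟩, Lp.coeFn_zero _ _ _, ?_⟩
    refine (Lp.coeFn_zero _ _ _).trans (Eventually.of_forall fun x => ?_)
    simp [gradient]
  add_mem' := by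
    rintro p q ⟨φ, hφ, h1, h2⟩ ⟨ψ, hψ, h3, h4⟩
    refine ⟨φ + ψ, ⟨hφ.1.add hψ.1, hφ.2.1.add hψ.2.1,
      (tsupport_add φ ψ).trans (Set.union_subset hφ.2.2 hψ.2.2)⟩, ?_, ?_⟩
    · exact (Lp.coeFn_add _ _).trans (h1.add h3)
    · refine (Lp.coeFn_add _ _).trans ((h2.add h4).trans (Eventually.of_forall fun x => ?_))
      exact (gradient_add ((hφ.contDiff_nat 1).differentiable one_ne_zero x)
        ((hψ.contDiff_nat 1).differentiable one_ne_zero x)).symm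
  smul_mem' := by
    rintro c p ⟨φ, hφ, h1, h2⟩
    refine ⟨c • φ, ⟨hφ.1.const_smul c, hφ.2.1.smul_left (f := fun _ => c),
      (closure_mono (Function.support_const_smul_subset c φ)).trans hφ.2.2⟩, ?_, ?_⟩
    · exact (Lp.coeFn_smul _ _).trans (h1.const_smul c)
    · refine (Lp.coeFn_smul _ _).trans ((h2.const_smul c).trans (Eventually.of_forall fun x => ?_))
      exact (gradient_const_smul c ((hφ.contDiff_nat 1).differentiable one_ne_zero x)).symm

theorem HasH10Gradient.mem_closure {N : ℕ} {Ω : Set (E N)} {w : E N → ℝ} {G : E N → E N}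
    (h : HasH10Gradient Ω w G) (hw : MemLp w 2 (volume.restrict Ω))
    (hG : MemLp G 2 (volume.restrict Ω)) :
    (WithLp.toLp 2 (hw.toLp w, hG.toLp G) : GraphSpace Ω) ∈ (testGraph Ω).topologicalClosure := by
  obtain ⟨φ, hφ, ⟨h1, -, h3⟩, ⟨h4, -, h6⟩⟩ := h
  have l1 := (Lp.tendsto_Lp_iff_tendsto_eLpNorm'' φ h1 w hw).2 h3
  have l2 := (Lp.tendsto_Lp_iff_tendsto_eLpNorm'' _ h4 G hG).2 h6
  have l3 := ((WithLp.prod_continuous_toLp 2 (Lp ℝ 2 (volume.restrict Ω))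
    (Lp (E N) 2 (volume.restrict Ω))).tendsto _).comp (l1.prodMk_nhds l2)
  refine mem_closure_of_tendsto l3 (Eventually.of_forall fun k => ?_)
  exact ⟨φ k, hφ k, (h1 k).coeFn_toLp, (h4 k).coeFn_toLp⟩

theorem hasH10Gradient_of_mem_closure {N : ℕ} {Ω : Set (E N)} {p : GraphSpace Ω}
    (hp : p ∈ (testGraph Ω).topologicalClosure) : HasH10Gradient Ω p.fst p.snd := by
  obtain ⟨q, hq, hlim⟩ := mem_closure_iff_seq_limit.1 hp
  choose φ hφ h1 h2 using hq
  have l := ((WithLp.prod_continuous_ofLp 2 (Lp ℝ 2 (volume.restrict Ω))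
    (Lp (E N) 2 (volume.restrict Ω))).tendsto _).comp hlim
  have l1 := (Lp.tendsto_Lp_iff_tendsto_eLpNorm' _ _).1 ((continuous_fst.tendsto _).comp l)
  have l2 := (Lp.tendsto_Lp_iff_tendsto_eLpNorm' _ _).1 ((continuous_snd.tendsto _).comp l)
  refine ⟨φ, hφ, ⟨fun k => (hφ k).memLp 2, Lp.memLp _, l1.congr fun k => ?_⟩,
    ⟨fun k => (hφ k).memLp_gradient 2, Lp.memLp _, l2.congr fun k => ?_⟩⟩
  · exact eLpNorm_congr_ae ((h1 k).sub (ae_eq_refl _))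
  · exact eLpNorm_congr_ae ((h2 k).sub (ae_eq_refl _))

theorem HasH10Gradient.memLp {N : ℕ} {Ω : Set (E N)} {w : E N → ℝ} {G : E N → E N}
    (h : HasH10Gradient Ω w G) :
    MemLp w 2 (volume.restrict Ω) ∧ MemLp G 2 (volume.restrict Ω) := by
  obtain ⟨φ, -, h1, h2⟩ := h
  exact ⟨h1.2.1, h2.2.1⟩

theorem inner_graph {N : ℕ} {Ω : Set (E N)} {w : E N → ℝ} {G : E N → E N}
    (hw : MemLp w 2 (volume.restrict Ω)) (hG : MemLp G 2 (volume.restrict Ω)) (p : GraphSpace Ω) :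
    ⟪p, (WithLp.toLp 2 (hw.toLp w, hG.toLp G) : GraphSpace Ω)⟫_ℝ
      = (∫ x in Ω, w x * p.fst x) + ∫ x in Ω, ⟪G x, p.snd x⟫_ℝ := by
  rw [WithLp.prod_inner_apply, L2.inner_def, L2.inner_def]
  congr 1
  · refine integral_congr_ae ?_
    filter_upwards [hw.coeFn_toLp] with x hx
    simp [hx]
  · refine integral_congr_ae ?_
    filter_upwards [hG.coeFn_toLp] with x hx
    simp [hx, real_inner_comm]

/-- The `L²` functional of `ψ` is represented in the Hilbert space `H¹₀(Ω)`: by the orthogonal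
projection of `(ψ, 0)` to the closure of the pairs `(φ, ∇φ)`. -/
theorem exists_h10_representative {N : ℕ} (Ω : Set (E N)) {ψ : E N → ℝ}
    (hψ : MemLp ψ 2 (volume.restrict Ω)) :
    ∃ (ζ : E N → ℝ) (Z : E N → E N), HasH10Gradient Ω ζ Z ∧ ∀ (w : E N → ℝ) (G : E N → E N),
      HasH10Gradient Ω w G →
        (∫ x in Ω, w x * ζ x) + ∫ x in Ω, ⟪G x, Z x⟫_ℝ = ∫ x in Ω, w x * ψ x := by
  set K := (testGraph Ω).topologicalClosure with hK
  have : CompleteSpace K := (testGraph Ω).isClosed_topologicalClosure.completeSpace_coe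
  set q : GraphSpace Ω := WithLp.toLp 2 (hψ.toLp ψ, 0) with hq
  set p := K.starProjection q with hp
  refine ⟨p.fst, p.snd, hasH10Gradient_of_mem_closure (Submodule.starProjection_apply_mem K q),
    fun w G h => ?_⟩
  obtain ⟨hw, hG⟩ := h.memLp
  have e := Submodule.starProjection_inner_eq_zero q _ (h.mem_closure hw hG)
  rw [inner_sub_left, sub_eq_zero, ← hp, inner_graph hw hG, inner_graph hw hG] at e
  rw [← e]
  have e1 : ∫ x in Ω, ⟪G x, q.snd x⟫_ℝ = 0 := by
    refine integral_eq_zero_of_ae ?_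
    filter_upwards [Lp.coeFn_zero (E N) 2 (volume.restrict Ω)] with x hx
    have : q.snd x = 0 := hx
    simp [this]
  rw [e1, add_zero]
  refine integral_congr_ae ?_
  filter_upwards [hψ.coeFn_toLp] with x hx
  have : q.fst x = ψ x := hx
  simp [this]

theorem WeaklyConvergesH10.tendsto_integral_mul {N : ℕ} {Ω : Set (E N)} {u : ℕ → E N → ℝ}
    {w : E N → ℝ} (h : WeaklyConvergesH10 Ω u w) {ψ : E N → ℝ}
    (hψ : MemLp ψ 2 (volume.restrict Ω)) :
    Tendsto (fun j => ∫ x in Ω, u j x * ψ x) atTop (𝓝 (∫ x in Ω, w x * ψ x)) := by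
  obtain ⟨ζ, Z, hζ, hrep⟩ := exists_h10_representative Ω hψ
  obtain ⟨G, Gw, h1, h2, h3⟩ := h
  have := h3 ζ Z hζ
  rw [hrep w Gw h2] at this
  exact this.congr fun j => hrep _ _ (h1 j)

/-! ### The equation satisfied by a weak solution -/

theorem isOpen_B (N : ℕ) : IsOpen (B N) := Metric.isOpen_ball

theorem measurableSet_B (N : ℕ) : MeasurableSet (B N) := measurableSet_ball

instance isFiniteMeasure_B (N : ℕ) : IsFiniteMeasure (volume.restrict (B N)) :=
  ⟨by rw [Measure.restrict_apply_univ]; exact measure_ball_lt_top⟩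

theorem ae_B {N : ℕ} {p : E N → Prop} (h : ∀ x ∈ B N, p x) : ∀ᵐ x ∂(volume.restrict (B N)), p x :=
  (ae_restrict_iff' (measurableSet_B N)).2 (Eventually.of_forall h)

theorem IsTestFunction.memLp_divergence_gradient {N : ℕ} {Ω : Set (E N)} {φ : E N → ℝ}
    (h : IsTestFunction Ω φ) (p : ENNReal) :
    MemLp (divergence (gradient φ)) p (volume.restrict Ω) := by
  have hc : Continuous (divergence (gradient φ)) :=
    continuous_divergence (contDiff_gradient (m := 1) (h.contDiff_nat 2) (by norm_num))
  refine (hc.memLp_of_hasCompactSupport (HasCompactSupport.intro h.2.1 fun x hx => ?_)).restrict Ω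
  have h1 : φ =ᶠ[𝓝 x] fun _ => 0 := notMem_tsupport_iff_eventuallyEq.1 hx
  have h2 : gradient φ =ᶠ[𝓝 x] fun _ => 0 := by
    refine h1.gradient.trans (Eventually.of_forall fun y => ?_)
    simp [gradient]
  simp [divergence, h2.fderiv_eq]

theorem IsTestFunction.integral_mul_laplacian {N : ℕ} {Ω : Set (E N)} (hΩ : IsOpen Ω)
    {φ u : E N → ℝ} (hφ : IsTestFunction Ω φ) (hu : ContDiffOn ℝ 2 u Ω) :
    ∫ x in Ω, φ x * (Δ u) x = ∫ x in Ω, u x * divergence (gradient φ) x := by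
  have h1 := setIntegral_mul_divergence hΩ hφ.2.1 hφ.2.2 (hφ.contDiff_nat 1).contDiffOn
    (contDiffOn_gradient (m := 1) hΩ hu (by norm_num))
    (Or.inl fun x hx => image_eq_zero_of_notMem_tsupport hx)
  have h2 := setIntegral_mul_divergence hΩ hφ.2.1 hφ.2.2 (hu.of_le (by norm_num))
    (contDiff_gradient (m := 1) (hφ.contDiff_nat 2) (by norm_num)).contDiffOn
    (Or.inr fun x hx => gradient_eq_zero_of_notMem_tsupport hx)
  have h3 : ∫ x in Ω, φ x * (Δ u) x = ∫ x in Ω, φ x * divergence (gradient u) x := by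
    refine setIntegral_congr_fun hΩ.measurableSet fun x hx => ?_
    simp only [laplacian_eq_divergence_gradient (hu.contDiffAt (hΩ.mem_nhds hx))]
  rw [h2, h3, h1]
  simp_rw [real_inner_comm]

theorem residual_eq {N : ℕ} (Ω : Set (E N)) (lam : ℝ) (w : E N → ℝ) (x : E N) :
    residual Ω lam w x = (Δ w) x + lam / nonlocalFactor Ω w ^ 2 * (1 / (1 - w x) ^ 2) := by
  rw [residual, div_mul_div_comm, mul_one, mul_comm ((1 - w x) ^ 2)]

theorem exists_isTestFunction_pos (N : ℕ) : ∃ φ : E N → ℝ, IsTestFunction (B N) φ ∧ (∀ x, 0 ≤ φ x) ∧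
    (∀ x, |φ x| ≤ 1) ∧ ∀ x ∈ Metric.ball (0 : E N) (1 / 2), 0 < φ x := by
  let b : ContDiffBump (0 : E N) := ⟨1 / 4, 1 / 2, by norm_num, by norm_num⟩
  refine ⟨b, ⟨b.contDiff, b.hasCompactSupport, ?_⟩, fun x => b.nonneg, fun x => ?_,
    fun x hx => b.pos_of_mem_ball hx⟩
  · rw [b.tsupport_eq]
    exact Metric.closedBall_subset_ball (by norm_num [b])
  · rw [abs_of_nonneg b.nonneg]
    exact b.le_one

/-- The equation satisfied by a weak solution. The coefficient `μ` is the limit of the coefficients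
of the approximating functions; only where the nonlocal factor of the limit does not vanish can it
be read off from that factor. -/
theorem IsWeakFiniteEnergySolution.weak_equation {N : ℕ} {lam : ℝ} {w : E N → ℝ} (hlam : 0 < lam)
    (h : IsWeakFiniteEnergySolution (B N) lam w) :
    ∃ (μ : ℝ) (G : E N → E N), 0 ≤ μ ∧ HasH10Gradient (B N) w G ∧
      (nonlocalFactor (B N) w ≠ 0 → μ = lam / nonlocalFactor (B N) w ^ 2) ∧
      ∀ φ, IsTestFunction (B N) φ →
        ∫ x in B N, ⟪G x, gradient φ x⟫_ℝ = μ * ∫ x in B N, φ x * (1 / (1 - w x) ^ 2) := by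
  obtain ⟨u, hu, hweak, -, -, hne, h2, h1, hres⟩ := h
  have hweak' := hweak
  obtain ⟨-, G, -, hG, -⟩ := hweak'
  set c : ℕ → ℝ := fun j => lam / nonlocalFactor (B N) (u j) ^ 2 with hc
  have hbdd : ∀ φ, IsTestFunction (B N) φ → ∃ C, ∀ x, |φ x| ≤ C := fun φ hφ => by
    simpa using hφ.1.continuous.bounded_above_of_compact_support hφ.2.1
  have hF : ∀ φ, IsTestFunction (B N) φ →
      Tendsto (fun j => ∫ x in B N, φ x * (1 / (1 - u j x) ^ 2)) atTop
        (𝓝 (∫ x in B N, φ x * (1 / (1 - w x) ^ 2))) := by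
    intro φ hφ
    obtain ⟨C, hC⟩ := hbdd φ hφ
    exact h2.tendsto_integral_mul_of_bounded (hφ.memLp 1).1 hC
  have hlim : ∀ φ, IsTestFunction (B N) φ →
      Tendsto (fun j => c j * ∫ x in B N, φ x * (1 / (1 - u j x) ^ 2)) atTop
        (𝓝 (∫ x in B N, ⟪G x, gradient φ x⟫_ℝ)) := by
    intro φ hφ
    obtain ⟨C, hC⟩ := hbdd φ hφ
    have l1 := hres.tendsto_integral_mul (hφ.memLp 2)
    have l2 := hweak.tendsto_integral_mul (hφ.memLp_divergence_gradient 2)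
    have l3 := l1.sub l2
    rw [hG.integral_inner (contDiff_gradient (m := 1) (hφ.contDiff_nat 2) (by norm_num))]
    simp only [zero_mul, integral_zero, zero_sub] at l3
    refine l3.congr fun j => ?_
    rw [← hφ.integral_mul_laplacian (isOpen_B N) (hu j).1]
    have i1 : Integrable (fun x => φ x * (1 / (1 - u j x) ^ 2)) (volume.restrict (B N)) :=
      (memLp_one_iff_integrable.1 (h2.1 j)).bdd_mul (hφ.memLp 1).1 (Eventually.of_forall hC)
    have i2 : Integrable (fun x => residual (B N) lam (u j) x * φ x) (volume.restrict (B N)) :=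
      (hres.1 j).integrable_mul (hφ.memLp 2)
    have e : ∀ x, φ x * (Δ (u j)) x
        = residual (B N) lam (u j) x * φ x - c j * (φ x * (1 / (1 - u j x) ^ 2)) := by
      intro x
      rw [residual_eq]
      ring
    simp_rw [e]
    rw [integral_sub i2 (i1.const_mul _), integral_const_mul]
    ring
  obtain ⟨φ₀, hφ₀, hnn, hle, hpos⟩ := exists_isTestFunction_pos N
  have ha : 0 < ∫ x in B N, φ₀ x * (1 / (1 - w x) ^ 2) := by
    have hi : Integrable (fun x => φ₀ x * (1 / (1 - w x) ^ 2)) (volume.restrict (B N)) :=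
      (memLp_one_iff_integrable.1 h2.2.1).bdd_mul (hφ₀.memLp 1).1 (Eventually.of_forall hle)
    rw [integral_pos_iff_support_of_nonneg (fun x => by have := hnn x; positivity) hi]
    refine lt_of_lt_of_le ?_ (measure_mono_ae (s := Metric.ball (0 : E N) (1 / 2)) ?_)
    · have hsub : Metric.ball (0 : E N) (1 / 2) ⊆ B N := Metric.ball_subset_ball (by norm_num)
      rw [Measure.restrict_eq_self _ hsub]
      exact Metric.measure_ball_pos _ _ (by norm_num)
    · filter_upwards [hne] with x hx hxb
      have : (1 - w x) ≠ 0 := fun h => hx (by linarith)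
      exact (mul_pos (hpos x hxb) (by positivity)).ne'
  set μ := (∫ x in B N, ⟪G x, gradient φ₀ x⟫_ℝ) / ∫ x in B N, φ₀ x * (1 / (1 - w x) ^ 2) with hμ
  have hcμ : Tendsto c atTop (𝓝 μ) := by
    refine ((hlim φ₀ hφ₀).div (hF φ₀ hφ₀) ha.ne').congr' ?_
    filter_upwards [(hF φ₀ hφ₀).eventually (lt_mem_nhds ha)] with j hj
    simp only [Pi.div_apply]
    rw [mul_div_cancel_right₀ _ hj.ne']
  refine ⟨μ, G, ge_of_tendsto' hcμ fun j => by positivity, hG, fun hK => ?_, fun φ hφ => ?_⟩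
  · have hKj : Tendsto (fun j => nonlocalFactor (B N) (u j)) atTop
        (𝓝 (nonlocalFactor (B N) w)) := by
      refine tendsto_const_nhds.add (tendsto_integral_of_L1' _ h1.2.1.1
        (Eventually.of_forall fun j => memLp_one_iff_integrable.1 (h1.1 j)) h1.2.2)
    exact tendsto_nhds_unique hcμ (tendsto_const_nhds.div (hKj.pow 2) (pow_ne_zero 2 hK))
  · exact tendsto_nhds_unique (hlim φ hφ) (hcμ.mul (hF φ hφ))

/-! ### Mollification and dominated convergence in `L²` -/

theorem norm_gradient_sub {N : ℕ} (φ ψ : E N → ℝ) (x : E N) :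
    ‖gradient φ x - gradient ψ x‖ = ‖fderiv ℝ φ x - fderiv ℝ ψ x‖ := by
  rw [← toDual_gradient (f := φ), ← toDual_gradient (f := ψ), ← map_sub]
  exact (LinearIsometryEquiv.norm_map _ _).symm

/-- Mollification: a `C¹` function supported in a compact subset of `Ω` is a limit of test functions
on `Ω`, uniformly together with the gradients. -/
theorem exists_isTestFunction_approx {N : ℕ} {Ω K : Set (E N)} (hΩ : IsOpen Ω) (hK : IsCompact K)
    (hKΩ : K ⊆ Ω) {v : E N → ℝ} (hv : ContDiff ℝ 1 v) (hvK : ∀ x, x ∉ K → v x = 0) {ε : ℝ}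
    (hε : 0 < ε) :
    ∃ φ, IsTestFunction Ω φ ∧ ∀ x, |φ x - v x| ≤ ε ∧ ‖gradient φ x - gradient v x‖ ≤ ε := by
  have hvc : HasCompactSupport v := HasCompactSupport.intro hK hvK
  obtain ⟨δ₀, hδ₀, hδ₀Ω⟩ := hK.exists_cthickening_subset_open hΩ hKΩ
  have hdc : Continuous (fderiv ℝ v) := hv.continuous_fderiv one_ne_zero
  have huv : UniformContinuous v := hvc.uniformContinuous_of_continuous hv.continuous
  have hud : UniformContinuous (fderiv ℝ v) :=
    (hvc.fderiv (𝕜 := ℝ)).uniformContinuous_of_continuous hdc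
  obtain ⟨δ₁, hδ₁, h1⟩ := Metric.uniformContinuous_iff.1 huv ε hε
  obtain ⟨δ₂, hδ₂, h2⟩ := Metric.uniformContinuous_iff.1 hud ε hε
  set δ := min δ₀ (min δ₁ δ₂) with hδ
  have hδpos : 0 < δ := lt_min hδ₀ (lt_min hδ₁ hδ₂)
  let b : ContDiffBump (0 : E N) := ⟨δ / 2, δ, by linarith, by linarith⟩
  set φ : E N → ℝ := MeasureTheory.convolution (b.normed volume) v (ContinuousLinearMap.lsmul ℝ ℝ)
    volume with hφ
  have hloc : LocallyIntegrable (b.normed volume) (volume : Measure (E N)) :=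
    b.continuous_normed.locallyIntegrable
  have hsupp : ∀ x, x ∉ Metric.cthickening δ₀ K → φ x = 0 := by
    intro x hx
    by_contra hne
    have hx' := support_convolution_subset (ContinuousLinearMap.lsmul ℝ ℝ) (μ := volume)
      (f := b.normed volume) (g := v) (Function.mem_support.2 hne)
    obtain ⟨y, hy, z, hz, rfl⟩ := Set.mem_add.1 hx'
    rw [b.support_normed_eq, mem_ball_zero_iff] at hy
    have hzK : z ∈ K := by
      by_contra h
      exact hz (hvK z h)
    refine hx (Metric.mem_cthickening_of_dist_le _ z _ _ hzK ?_)
    rw [dist_eq_norm, add_sub_cancel_right]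
    exact hy.le.trans (min_le_left _ _)
  refine ⟨φ, ⟨?_, ?_, ?_⟩, fun x => ⟨?_, ?_⟩⟩
  · exact b.hasCompactSupport_normed.contDiff_convolution_left _ (n := ⊤) b.contDiff_normed
      hv.continuous.locallyIntegrable
  · exact HasCompactSupport.intro hK.cthickening hsupp
  · refine (closure_minimal (fun x hx => ?_) Metric.isClosed_cthickening).trans hδ₀Ω
    by_contra h
    exact hx (hsupp x h)
  · rw [← Real.dist_eq]
    refine b.dist_normed_convolution_le hv.continuous.aestronglyMeasurable fun y hy => (h1 ?_).le
    exact (Metric.mem_ball.1 hy).trans_le ((min_le_right _ _).trans (min_le_left _ _))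
  · rw [norm_gradient_sub, ← dist_eq_norm]
    have hfd := hvc.hasFDerivAt_convolution_right (ContinuousLinearMap.lsmul ℝ ℝ) hloc hv x
    have e : fderiv ℝ φ x = MeasureTheory.convolution (b.normed volume) (fderiv ℝ v)
        (ContinuousLinearMap.lsmul ℝ ℝ) volume x := by
      rw [hfd.fderiv]
      simp only [convolution_def]
      rfl
    rw [e]
    refine b.dist_normed_convolution_le hdc.aestronglyMeasurable fun y hy => (h2 ?_).le
    exact (Metric.mem_ball.1 hy).trans_le ((min_le_right _ _).trans (min_le_right _ _))

/-- Dominated convergence in `L²`. -/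
theorem tendsto_eLpNorm_two_of_dominated {α F : Type*} [MeasurableSpace α] {μ : Measure α}
    [NormedAddCommGroup F] {f : ℕ → α → F} {g : α → F} {bd : α → ℝ}
    (hf : ∀ n, AEStronglyMeasurable (f n) μ) (hg : AEStronglyMeasurable g μ)
    (hbd : MemLp bd 2 μ) (hle : ∀ n, ∀ᵐ x ∂μ, ‖f n x - g x‖ ≤ bd x)
    (hlim : ∀ᵐ x ∂μ, Tendsto (fun n => f n x) atTop (𝓝 (g x))) :
    Tendsto (fun n => eLpNorm (f n - g) 2 μ) atTop (𝓝 0) := by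
  have hfin := hbd.eLpNorm_lt_top
  simp only [eLpNorm_eq_lintegral_rpow_enorm_toReal two_ne_zero ENNReal.ofNat_ne_top,
    ENNReal.toReal_ofNat] at hfin ⊢
  have hfin' : ∫⁻ x, ‖bd x‖ₑ ^ (2 : ℝ) ∂μ ≠ ⊤ := by
    intro h
    rw [h] at hfin
    simp at hfin
  have key := tendsto_lintegral_of_dominated_convergence' (μ := μ)
    (F := fun n x => ‖(f n - g) x‖ₑ ^ (2 : ℝ)) (f := fun _ => 0) (fun x => ‖bd x‖ₑ ^ (2 : ℝ))
    (fun n => (((hf n).sub hg).enorm).pow_const _) (fun n => ?_) hfin' ?_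
  · have := key.ennrpow_const (1 / 2 : ℝ)
    simpa using this
  · filter_upwards [hle n] with x hx
    refine ENNReal.rpow_le_rpow ?_ (by norm_num)
    exact enorm_le_iff_norm_le.2 (hx.trans (le_abs_self _))
  · filter_upwards [hlim] with x hx
    have h1 : Tendsto (fun n => ‖(f n - g) x‖ₑ) atTop (𝓝 0) := by
      have := (hx.sub_const (g x)).enorm
      simpa using this
    have := h1.ennrpow_const (2 : ℝ)
    simpa using this

/-! ### Classical solutions are weak solutions -/

/-- A smooth nondecreasing function that vanishes for `t ≤ 1` and equals `t` for `t ≥ 2`. -/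
noncomputable def softTruncation (t : ℝ) : ℝ := t * Real.smoothTransition (t - 1)

theorem contDiff_softTruncation {n : ℕ} : ContDiff ℝ n softTruncation := by
  have h : ContDiff ℝ (n : ℕ∞) Real.smoothTransition := Real.smoothTransition.contDiff
  have h' : ContDiff ℝ n Real.smoothTransition := by exact_mod_cast h
  unfold softTruncation
  fun_prop

theorem softTruncation_eq_zero {t : ℝ} (h : t ≤ 1) : softTruncation t = 0 := by
  rw [softTruncation, Real.smoothTransition.zero_of_nonpos (by linarith), mul_zero]

theorem softTruncation_eq_self {t : ℝ} (h : 2 ≤ t) : softTruncation t = t := by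
  rw [softTruncation, Real.smoothTransition.one_of_one_le (by linarith), mul_one]

theorem softTruncation_nonneg {t : ℝ} : 0 ≤ softTruncation t := by
  rcases le_total t 1 with h | h
  · rw [softTruncation_eq_zero h]
  · exact mul_nonneg (by linarith) (Real.smoothTransition.nonneg _)

theorem softTruncation_le {t : ℝ} (h : 0 ≤ t) : softTruncation t ≤ t :=
  mul_le_of_le_one_right h (Real.smoothTransition.le_one _)

theorem monotone_softTruncation : Monotone softTruncation := by
  intro s t hst
  rcases le_total s 1 with h | h
  · rw [softTruncation_eq_zero h]
    exact softTruncation_nonneg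
  · exact mul_le_mul hst (Real.smoothTransition.monotone (by linarith))
      (Real.smoothTransition.nonneg _) (by linarith)

theorem deriv_softTruncation_eq_one {t : ℝ} (h : 2 < t) : deriv softTruncation t = 1 := by
  have : softTruncation =ᶠ[𝓝 t] id :=
    (lt_mem_nhds h).mono fun s hs => softTruncation_eq_self hs.le
  rw [this.deriv_eq, deriv_id]

theorem exists_deriv_softTruncation_le : ∃ C, 0 ≤ C ∧ ∀ t, |deriv softTruncation t| ≤ C := by
  have hc : Continuous (deriv softTruncation) :=
    (contDiff_softTruncation (n := 1)).continuous_deriv le_rfl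
  obtain ⟨C, hC⟩ := (isCompact_Icc (a := (0 : ℝ)) (b := 3)).exists_bound_of_continuousOn
    hc.continuousOn
  refine ⟨max C 1, by positivity, fun t => ?_⟩
  rcases lt_or_ge t 1 with h | h
  · have : softTruncation =ᶠ[𝓝 t] fun _ => 0 :=
      (gt_mem_nhds h).mono fun s hs => softTruncation_eq_zero hs.le
    rw [this.deriv_eq]
    simp
  · rcases le_or_gt t 3 with h' | h'
    · exact (hC t ⟨by linarith, h'⟩).trans (le_max_left _ _)
    · rw [deriv_softTruncation_eq_one (by linarith)]
      simp

theorem closure_B (N : ℕ) : closure (B N) = Metric.closedBall 0 1 :=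
  closure_ball 0 one_ne_zero

theorem frontier_B (N : ℕ) : frontier (B N) = Metric.sphere 0 1 :=
  frontier_ball 0 one_ne_zero

/-- The truncation `ε c(w/ε)` of a function on the ball, `c` being `softTruncation`; if `w`
is continuous up to the boundary and vanishes there, it is supported in a compact subset. -/
noncomputable def truncate {N : ℕ} (w : E N → ℝ) (ε : ℝ) : E N → ℝ :=
  (B N).indicator fun x => ε * softTruncation (w x / ε)

theorem IsC2C0.exists_isCompact_superlevel {N : ℕ} {w : E N → ℝ} (hw : IsC2C0 (B N) w) {ε : ℝ}
    (hε : 0 < ε) : ∃ K, IsCompact K ∧ K ⊆ B N ∧ ∀ x ∈ B N, x ∉ K → w x < ε := by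
  refine ⟨closure (B N) ∩ w ⁻¹' Set.Ici ε, ?_, fun x hx => ?_, fun x hx hxK => ?_⟩
  · have hcl : IsClosed (closure (B N) ∩ w ⁻¹' Set.Ici ε) :=
      hw.2.1.preimage_isClosed_of_isClosed isClosed_closure isClosed_Ici
    rw [closure_B] at hcl ⊢
    exact (isCompact_closedBall (0 : E N) 1).of_isClosed_subset hcl Set.inter_subset_left
  · by_contra h
    have h0 := hw.2.2 x ⟨hx.1, by rwa [(isOpen_B N).interior_eq]⟩
    have h1 : ε ≤ w x := hx.2
    linarith
  · by_contra h
    exact hxK ⟨subset_closure hx, not_lt.1 h⟩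

theorem truncate_eventuallyEq {N : ℕ} {w : E N → ℝ} {ε : ℝ} {x : E N} (hx : x ∈ B N) :
    truncate w ε =ᶠ[𝓝 x] fun x => ε * softTruncation (w x / ε) :=
  Filter.mem_of_superset ((isOpen_B N).mem_nhds hx) fun _ hy => Set.indicator_of_mem hy _

theorem gradient_truncate {N : ℕ} {w : E N → ℝ} (hw : IsC2C0 (B N) w) {ε : ℝ} (hε : 0 < ε)
    {x : E N} (hx : x ∈ B N) :
    gradient (truncate w ε) x = deriv softTruncation (w x / ε) • gradient w x := by
  have hd : DifferentiableAt ℝ w x :=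
    (hw.1.contDiffAt ((isOpen_B N).mem_nhds hx)).differentiableAt two_ne_zero
  have hs : HasDerivAt softTruncation (deriv softTruncation (w x / ε)) (w x / ε) :=
    ((contDiff_softTruncation (n := 1)).differentiable one_ne_zero _).hasDerivAt
  have h1 : HasFDerivAt (fun y => w y / ε) (ε⁻¹ • fderiv ℝ w x) x := by
    simpa only [div_eq_inv_mul] using hd.hasFDerivAt.const_mul ε⁻¹
  have h2 := (hs.comp_hasFDerivAt x h1).const_mul ε
  rw [(truncate_eventuallyEq hx).gradient_eq, gradient, gradient]
  have h3 : fderiv ℝ (fun x => ε * softTruncation (w x / ε)) x = _ := h2.fderiv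
  rw [h3, map_smul, map_smul, map_smul, smul_smul, smul_smul]
  congr 1
  field_simp

/-- A nonnegative function in `C² ∩ C₀` of the ball whose Laplacian is bounded is in `H¹₀`: it is
the limit of its mollified truncations in the `H¹` norm, and boundedly pointwise. -/
theorem IsC2C0.exists_isTestFunction_approx {N : ℕ} {w : E N → ℝ} (hw : IsC2C0 (B N) w)
    (h0 : ∀ x ∈ B N, 0 ≤ w x) {C : ℝ} (hΔ : ∀ x ∈ B N, |(Δ w) x| ≤ C) :
    ∃ φ : ℕ → E N → ℝ, (∀ k, IsTestFunction (B N) (φ k)) ∧ ConvergesLp (B N) 2 φ w ∧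
      ConvergesLp (B N) 2 (fun k => gradient (φ k)) (gradient w) ∧
      (∃ M, ∀ k, ∀ x ∈ B N, |φ k x| ≤ M) ∧
      ∀ x ∈ B N, Tendsto (fun k => φ k x) atTop (𝓝 (w x)) := by
  have hBo := isOpen_B N
  set ε : ℕ → ℝ := fun k => 1 / ((k : ℝ) + 1) with hεdef
  have hε : ∀ k, 0 < ε k := fun k => by positivity
  have hε0 : Tendsto ε atTop (𝓝 0) := tendsto_one_div_add_atTop_nhds_zero_nat
  obtain ⟨D, hD0, hD⟩ := exists_deriv_softTruncation_le
  obtain ⟨M, hM⟩ := (isCompact_closedBall (0 : E N) 1).exists_bound_of_continuousOn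
    (closure_B N ▸ hw.2.1)
  have hMB : ∀ x ∈ B N, |w x| ≤ M := fun x hx => hM x (Metric.ball_subset_closedBall hx)
  have hwd : ∀ x ∈ B N, ContDiffAt ℝ 2 w x := fun x hx => hw.1.contDiffAt (hBo.mem_nhds hx)
  have hgc : ContinuousOn (gradient w) (B N) :=
    (contDiffOn_gradient (m := 1) hBo hw.1 (by norm_num)).continuousOn
  have hgm : AEStronglyMeasurable (gradient w) (volume.restrict (B N)) :=
    hgc.aestronglyMeasurable (measurableSet_B N)
  have hwm : AEStronglyMeasurable w (volume.restrict (B N)) :=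
    hw.1.continuousOn.aestronglyMeasurable (measurableSet_B N)
  -- the truncations are `C¹` and supported in a compact set
  choose K hK hKB hKw using fun k => hw.exists_isCompact_superlevel (hε k)
  have hvK : ∀ k x, x ∉ K k → truncate w (ε k) x = 0 := by
    intro k x hx
    by_cases hxB : x ∈ B N
    · rw [truncate, Set.indicator_of_mem hxB, softTruncation_eq_zero, mul_zero]
      rw [div_le_one (hε k)]
      exact (hKw k x hxB hx).le
    · exact Set.indicator_of_notMem hxB _
  have hvC : ∀ k, ContDiff ℝ 1 (truncate w (ε k)) := by
    intro k
    refine contDiff_iff_contDiffAt.2 fun x => ?_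
    by_cases hx : x ∈ K k
    · refine ContDiffAt.congr_of_eventuallyEq ?_ (truncate_eventuallyEq (hKB k hx))
      have h1 : ContDiffAt ℝ 1 (fun y => w y / ε k) x :=
        ((hwd x (hKB k hx)).of_le (by norm_num)).div_const _
      exact contDiffAt_const.mul ((contDiff_softTruncation (n := 1)).contDiffAt.comp x h1)
    · refine contDiffAt_const.congr_of_eventuallyEq (f := fun _ => (0 : ℝ)) ?_
      filter_upwards [(hK k).isClosed.isOpen_compl.mem_nhds hx] with y hy using hvK k y hy
  have hvM : ∀ k, ∀ x ∈ B N, 0 ≤ truncate w (ε k) x ∧ truncate w (ε k) x ≤ w x := by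
    intro k x hx
    rw [truncate, Set.indicator_of_mem hx]
    refine ⟨mul_nonneg (hε k).le softTruncation_nonneg, ?_⟩
    calc ε k * softTruncation (w x / ε k) ≤ ε k * (w x / ε k) :=
          mul_le_mul_of_nonneg_left (softTruncation_le (div_nonneg (h0 x hx) (hε k).le)) (hε k).le
      _ = w x := mul_div_cancel₀ _ (hε k).ne'
  have hvlim : ∀ x ∈ B N, Tendsto (fun k => truncate w (ε k) x) atTop (𝓝 (w x)) := by
    intro x hx
    rcases (h0 x hx).eq_or_lt with h | h
    · refine tendsto_const_nhds.congr fun k => ?_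
      have := hvM k x hx
      linarith
    · refine tendsto_const_nhds.congr' ?_
      filter_upwards [hε0.eventually (gt_mem_nhds (half_pos h))] with k hk
      rw [truncate, Set.indicator_of_mem hx, softTruncation_eq_self,
        mul_div_cancel₀ _ (hε k).ne']
      rw [le_div_iff₀ (hε k)]
      linarith
  have hslim : ∀ x ∈ B N, Tendsto (fun k => deriv softTruncation (w x / ε k) • gradient w x) atTop
      (𝓝 (gradient w x)) := by
    intro x hx
    rcases (h0 x hx).eq_or_lt with h | h
    · have hmin : IsLocalMin w x := by
        filter_upwards [hBo.mem_nhds hx] with y hy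
        rw [← h]
        exact h0 y hy
      have : gradient w x = 0 := by simp [gradient, hmin.fderiv_eq_zero]
      simp [this]
    · refine tendsto_const_nhds.congr' ?_
      filter_upwards [hε0.eventually (gt_mem_nhds (show 0 < w x / 3 by linarith))] with k hk
      rw [deriv_softTruncation_eq_one, one_smul]
      rw [lt_div_iff₀ (hε k)]
      linarith
  have hs0 : ∀ t, 0 ≤ deriv softTruncation t := fun t => monotone_softTruncation.deriv_nonneg
  -- testing the Laplacian with a truncation bounds the energy
  have henergy : ∀ k, ∫⁻ x in B N, ‖⟪gradient (truncate w (ε k)) x, gradient w x⟫_ℝ‖ₑ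
      ≤ ENNReal.ofReal (M * C * volume.real (B N)) := by
    intro k
    have hnn : ∀ x ∈ B N, 0 ≤ ⟪gradient (truncate w (ε k)) x, gradient w x⟫_ℝ := by
      intro x hx
      rw [gradient_truncate hw (hε k) hx, real_inner_smul_left]
      exact mul_nonneg (hs0 _) real_inner_self_nonneg
    have hint : IntegrableOn (fun x => ⟪gradient (truncate w (ε k)) x, gradient w x⟫_ℝ) (B N) := by
      have hcont : ContinuousOn (fun x => ⟪gradient (truncate w (ε k)) x, gradient w x⟫_ℝ) (B N) :=
        ((contDiff_gradient (m := 0) (hvC k) (by simp)).continuous.continuousOn).inner hgc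
      have h1 := (hcont.mono (hKB k)).integrableOn_compact (μ := volume) (hK k)
      refine (h1.integrable_of_forall_notMem_eq_zero fun x hx => ?_).integrableOn
      have : truncate w (ε k) =ᶠ[𝓝 x] fun _ => 0 := by
        filter_upwards [(hK k).isClosed.isOpen_compl.mem_nhds hx] with y hy using hvK k y hy
      rw [this.gradient_eq, gradient_fun_const, inner_zero_left]
    have hgreen := setIntegral_mul_divergence hBo (hK k) (hKB k) (hvC k).contDiffOn
      (contDiffOn_gradient (m := 1) hBo hw.1 (by norm_num)) (Or.inl (hvK k))
    have hbound : ∫ x in B N, ⟪gradient (truncate w (ε k)) x, gradient w x⟫_ℝ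
        ≤ M * C * volume.real (B N) := by
      have h2 := norm_setIntegral_le_of_norm_le_const (μ := volume) (s := B N)
        (f := fun x => truncate w (ε k) x * divergence (gradient w) x) (C := M * C)
        measure_ball_lt_top fun x hx => ?_
      · rw [hgreen, norm_neg] at h2
        exact (le_abs_self _).trans h2
      · rw [← laplacian_eq_divergence_gradient (hwd x hx), norm_mul]
        have h3 := hvM k x hx
        refine mul_le_mul ?_ (hΔ x hx) (norm_nonneg _) ((abs_nonneg _).trans (hMB x hx))
        rw [Real.norm_eq_abs, abs_of_nonneg h3.1]
        exact h3.2.trans ((le_abs_self _).trans (hMB x hx))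
    rw [← ofReal_integral_norm_eq_lintegral_enorm hint]
    refine ENNReal.ofReal_le_ofReal (le_trans (le_of_eq ?_) hbound)
    refine setIntegral_congr_fun (measurableSet_B N) fun x hx => ?_
    exact abs_of_nonneg (hnn x hx)
  have hL2 : MemLp (gradient w) 2 (volume.restrict (B N)) := by
    rw [memLp_two_iff_integrable_sq_norm hgm]
    refine ⟨(hgm.norm.pow 2), ?_⟩
    have hfatou := lintegral_liminf_le' (μ := volume.restrict (B N)) (u := atTop)
      (f := fun k x => ‖⟪gradient (truncate w (ε k)) x, gradient w x⟫_ℝ‖ₑ) fun k =>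
      (((contDiff_gradient (m := 0) (hvC k) (by simp)).continuous.aestronglyMeasurable).inner
        hgm).enorm
    refine lt_of_le_of_lt (le_trans (le_of_eq ?_) hfatou) (lt_of_le_of_lt
      (liminf_le_of_le (by isBoundedDefault) fun b hb => ?_) (ENNReal.ofReal_lt_top
        (r := M * C * volume.real (B N))))
    · refine setLIntegral_congr_fun (measurableSet_B N) fun x hx => ?_
      have h1 : Tendsto (fun k => ‖⟪gradient (truncate w (ε k)) x, gradient w x⟫_ℝ‖ₑ) atTop
          (𝓝 ‖⟪gradient w x, gradient w x⟫_ℝ‖ₑ) := by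
        refine ((hslim x hx).inner tendsto_const_nhds).enorm.congr fun k => ?_
        rw [gradient_truncate hw (hε k) hx]
      simp only [h1.liminf_eq, real_inner_self_eq_norm_sq]
    · obtain ⟨k, hk⟩ := hb.exists
      exact hk.trans (henergy k)
  choose φ hφ hφv using fun k =>
    MEMS.exists_isTestFunction_approx hBo (hK k) (hKB k) (hvC k) (hvK k) (hε k)
  have hε1 : ∀ k, ε k ≤ 1 := fun k => by
    rw [hεdef]
    simp only
    rw [div_le_one (by positivity)]
    linarith [(Nat.cast_nonneg k : (0 : ℝ) ≤ k)]
  have hφM : ∀ k, ∀ x ∈ B N, |φ k x| ≤ 1 + M := by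
    intro k x hx
    have h1 := (hφv k x).1
    have h2 := hvM k x hx
    have h3 := hMB x hx
    rw [abs_le] at h1 h3 ⊢
    constructor <;> linarith [hε1 k]
  have hφlim : ∀ x ∈ B N, Tendsto (fun k => φ k x) atTop (𝓝 (w x)) := by
    intro x hx
    have h1 : Tendsto (fun k => φ k x - truncate w (ε k) x) atTop (𝓝 0) :=
      squeeze_zero_norm (fun k => (hφv k x).1) hε0
    simpa using h1.add (hvlim x hx)
  refine ⟨φ, hφ, ⟨fun k => (hφ k).memLp 2, ?_, ?_⟩,
    ⟨fun k => (hφ k).memLp_gradient 2, hL2, ?_⟩, ⟨1 + M, hφM⟩, hφlim⟩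
  · exact MemLp.of_bound hwm M (ae_B hMB)
  · refine tendsto_eLpNorm_two_of_dominated (bd := fun _ => 1 + M) (fun k => ((hφ k).memLp 2).1) hwm
      (memLp_const _) (fun k => ae_B fun x hx => ?_) (ae_B hφlim)
    have h1 := (hφv k x).1
    have h2 := hvM k x hx
    have h3 := hMB x hx
    rw [Real.norm_eq_abs, abs_le]
    rw [abs_le] at h1 h3
    constructor <;> linarith [hε1 k]
  · have hbd : MemLp (fun x => 1 + (D + 1) * ‖gradient w x‖) 2 (volume.restrict (B N)) :=
      (memLp_const (1 : ℝ)).add (hL2.norm.const_mul (D + 1))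
    refine tendsto_eLpNorm_two_of_dominated (fun k => ((hφ k).memLp_gradient 2).1) hgm hbd
      (fun k => ae_B fun x hx => ?_) (ae_B fun x hx => ?_)
    · have h1 := (hφv k x).2
      rw [gradient_truncate hw (hε k) hx] at h1
      have h2 : ‖deriv softTruncation (w x / ε k) • gradient w x‖ ≤ D * ‖gradient w x‖ := by
        rw [norm_smul]
        exact mul_le_mul_of_nonneg_right (hD _) (norm_nonneg _)
      have h3 := norm_sub_le_norm_sub_add_norm_sub (gradient (φ k) x)
        (deriv softTruncation (w x / ε k) • gradient w x) (gradient w x)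
      have h4 := norm_sub_le (deriv softTruncation (w x / ε k) • gradient w x) (gradient w x)
      linarith [hε1 k]
    · have h1 : Tendsto (fun k => gradient (φ k) x - gradient (truncate w (ε k)) x) atTop (𝓝 0) :=
        squeeze_zero_norm (fun k => (hφv k x).2) hε0
      have h2 : Tendsto (fun k => gradient (truncate w (ε k)) x) atTop (𝓝 (gradient w x)) :=
        (hslim x hx).congr fun k => (gradient_truncate hw (hε k) hx).symm
      simpa using h1.add h2

theorem IsC2C0.hasH10Gradient {N : ℕ} {w : E N → ℝ} (hw : IsC2C0 (B N) w)
    (h0 : ∀ x ∈ B N, 0 ≤ w x) {C : ℝ} (hΔ : ∀ x ∈ B N, |(Δ w) x| ≤ C) :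
    HasH10Gradient (B N) w (gradient w) := by
  obtain ⟨φ, hφ, h1, h2, -⟩ := hw.exists_isTestFunction_approx h0 hΔ
  exact ⟨φ, hφ, h1, h2⟩

theorem IsClassicalSolution.isWeakFiniteEnergySolution {N : ℕ} {lam : ℝ} {w : E N → ℝ}
    (h : IsClassicalSolution (B N) lam w) : IsWeakFiniteEnergySolution (B N) lam w := by
  obtain ⟨hw, hr, heq⟩ := h
  have hr' : ∀ x ∈ B N, 0 ≤ w x ∧ w x < 1 := fun x hx => hr x (subset_closure hx)
  have hcl : IsCompact (closure (B N)) := by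
    rw [closure_B]
    exact isCompact_closedBall 0 1
  have hc : ∀ n : ℕ, ContinuousOn (fun x => 1 / (1 - w x) ^ n) (closure (B N)) := fun n =>
    continuousOn_const.div ((continuousOn_const.sub hw.2.1).pow n) fun x hx =>
      pow_ne_zero n (by linarith [(hr x hx).2])
  have hb : ∀ n : ℕ, ∃ C, ∀ x ∈ B N, ‖1 / (1 - w x) ^ n‖ ≤ C := fun n => by
    obtain ⟨C, hC⟩ := hcl.exists_bound_of_continuousOn (hc n)
    exact ⟨C, fun x hx => hC x (subset_closure hx)⟩
  have hL1 : ∀ n : ℕ, MemLp (fun x => 1 / (1 - w x) ^ n) 1 (volume.restrict (B N)) := fun n => by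
    obtain ⟨C, hC⟩ := hb n
    exact MemLp.of_bound (((hc n).mono subset_closure).aestronglyMeasurable (measurableSet_B N)) C
      (ae_B hC)
  have hres : residual (B N) lam w =ᵐ[volume.restrict (B N)] fun _ => (0 : ℝ) := ae_B heq
  have hH : HasH10Gradient (B N) w (gradient w) := by
    obtain ⟨C, hC⟩ := hb 2
    refine hw.hasH10Gradient (fun x hx => (hr' x hx).1)
      (C := |lam / nonlocalFactor (B N) w ^ 2| * C) fun x hx => ?_
    have h1 := heq x hx
    rw [residual_eq] at h1
    rw [eq_neg_of_add_eq_zero_left h1, abs_neg, abs_mul]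
    exact mul_le_mul_of_nonneg_left (hC x hx) (abs_nonneg _)
  have hresL : MemLp (residual (B N) lam w) 2 (volume.restrict (B N)) :=
    (memLp_congr_ae hres).2 MemLp.zero'
  refine ⟨fun _ => w, fun _ => hw, ⟨fun _ => gradient w, gradient w, fun _ => hH, hH,
    fun _ _ _ => tendsto_const_nhds⟩, Eventually.of_forall fun _ => tendsto_const_nhds, fun _ => ?_,
    ?_, ⟨fun _ => hL1 2, hL1 2, by simp⟩, ?_, ⟨fun _ => hresL, MemLp.zero', ?_⟩⟩
  · exact ae_B fun x hx => (hr' x hx).2.ne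
  · exact ae_B fun x hx => (hr' x hx).2.ne
  · have h1 := hL1 1
    simp only [pow_one] at h1
    exact ⟨fun _ => h1, h1, by simp⟩
  · refine tendsto_const_nhds.congr fun _ => ?_
    refine (eLpNorm_eq_zero_of_ae_zero ?_).symm
    filter_upwards [hres] with x hx
    simp [hx]

/-! ### The radial Poisson equation -/

/-- The weighted mean `r^{-N} ∫₀^r t^{N-1} g(t) dt`, written as an integral over `[0, 1]` so that it
is continuous at `r = 0` as well. The solution of `U'' + (N-1)/r U' = g` that is regular at `0` has
`U'(r) = r * radialMean N g r`. -/
noncomputable def radialMean (N : ℕ) (g : ℝ → ℝ) (r : ℝ) : ℝ :=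
  ∫ τ in (0 : ℝ)..1, τ ^ (N - 1) * g (r * τ)

/-- The solution of `U'' + (N-1)/r U' = g` with `U(0) = c` and `U'(0) = 0`. -/
noncomputable def radialPrimitive (N : ℕ) (g : ℝ → ℝ) (c r : ℝ) : ℝ :=
  c + ∫ s in (0 : ℝ)..r, s * radialMean N g s

theorem continuous_radialMean {N : ℕ} {g : ℝ → ℝ} (hg : Continuous g) :
    Continuous (radialMean N g) := by
  unfold radialMean
  exact intervalIntegral.continuous_parametric_intervalIntegral_of_continuous' (by fun_prop) _ _

theorem pow_mul_radialMean {N : ℕ} (hN : 1 ≤ N) (g : ℝ → ℝ) (r : ℝ) :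
    r ^ N * radialMean N g r = ∫ t in (0 : ℝ)..r, t ^ (N - 1) * g t := by
  have h := intervalIntegral.smul_integral_comp_mul_left (a := 0) (b := 1)
    (fun t => t ^ (N - 1) * g t) r
  simp only [mul_zero, mul_one, smul_eq_mul] at h
  rw [← h, radialMean]
  simp_rw [mul_pow, mul_assoc]
  rw [intervalIntegral.integral_const_mul, ← mul_assoc, ← pow_succ', Nat.sub_add_cancel hN]

theorem radialMean_zero {N : ℕ} (hN : 1 ≤ N) (g : ℝ → ℝ) : N * radialMean N g 0 = g 0 := by
  simp only [radialMean, zero_mul, intervalIntegral.integral_mul_const, integral_pow]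
  rw [Nat.sub_add_cancel hN]
  have : (N : ℝ) ≠ 0 := by positivity
  have h2 : ((N - 1 : ℕ) : ℝ) + 1 = N := by exact_mod_cast Nat.sub_add_cancel hN
  rw [h2, one_pow, zero_pow (by omega)]
  field_simp
  ring

theorem hasDerivAt_radialMean {N : ℕ} (hN : 1 ≤ N) {g : ℝ → ℝ} (hg : Continuous g) {r : ℝ}
    (hr : r ≠ 0) : HasDerivAt (radialMean N g) ((g r - N * radialMean N g r) / r) r := by
  have h1 : HasDerivAt (fun r => ∫ t in (0 : ℝ)..r, t ^ (N - 1) * g t) (r ^ (N - 1) * g r) r :=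
    (Continuous.integral_hasStrictDerivAt (by fun_prop) 0 r).hasDerivAt
  have h2 := h1.div (hasDerivAt_pow N r) (pow_ne_zero N hr)
  have h3 : radialMean N g =ᶠ[𝓝 r] fun r => (∫ t in (0 : ℝ)..r, t ^ (N - 1) * g t) / r ^ N := by
    filter_upwards [isOpen_ne.mem_nhds hr] with s hs
    rw [← pow_mul_radialMean hN, mul_div_cancel_left₀ _ (pow_ne_zero N hs)]
  refine (h2.congr_of_eventuallyEq h3).congr_deriv ?_
  rw [← pow_mul_radialMean hN]
  obtain ⟨n, rfl⟩ : ∃ n, N = n + 1 := ⟨N - 1, by omega⟩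
  simp only [Nat.add_sub_cancel]
  field_simp
  ring

theorem hasDerivAt_radialPrimitive {N : ℕ} {g : ℝ → ℝ} (hg : Continuous g) (c r : ℝ) :
    HasDerivAt (radialPrimitive N g c) (r * radialMean N g r) r :=
  ((continuous_id.mul (continuous_radialMean hg)).integral_hasStrictDerivAt 0
    r).hasDerivAt.const_add c

theorem hasFDerivAt_norm_of_ne_zero {N : ℕ} {x : E N} (hx : x ≠ 0) :
    HasFDerivAt (fun y : E N => ‖y‖) (‖x‖⁻¹ • innerSL ℝ x) x := by
  have h1 : HasFDerivAt (fun y : E N => ‖y‖ ^ 2) (2 • innerSL ℝ x) x :=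
    (hasStrictFDerivAt_norm_sq x).hasFDerivAt
  have h2 := h1.sqrt (by positivity)
  simp only [Real.sqrt_sq (norm_nonneg _)] at h2
  refine h2.congr_fderiv ?_
  ext v
  simp
  field_simp

/-- The Jacobian of the field `radialMean N g ‖x‖ • x`. -/
noncomputable def radialJacobian (N : ℕ) (g : ℝ → ℝ) (x : E N) : E N →L[ℝ] E N :=
  radialMean N g ‖x‖ • ContinuousLinearMap.id ℝ (E N) +
    (innerSL ℝ x).smulRight (((g ‖x‖ - N * radialMean N g ‖x‖) / ‖x‖ ^ 2) • x)

theorem hasFDerivAt_radialField {N : ℕ} (hN : 1 ≤ N) {g : ℝ → ℝ} (hg : Continuous g) (x : E N) :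
    HasFDerivAt (fun y : E N => radialMean N g ‖y‖ • y) (radialJacobian N g x) x := by
  have hA := continuous_radialMean (N := N) hg
  rcases eq_or_ne x 0 with rfl | hx
  · have h0 : radialJacobian N g 0 = radialMean N g 0 • ContinuousLinearMap.id ℝ (E N) := by
      ext v
      simp [radialJacobian]
    rw [h0, hasFDerivAt_iff_isLittleO_nhds_zero]
    have h1 : (fun y : E N => radialMean N g ‖y‖ - radialMean N g 0) =o[𝓝 0] fun _ => (1 : ℝ) := by
      rw [Asymptotics.isLittleO_one_iff]
      have : Continuous fun y : E N => radialMean N g ‖y‖ - radialMean N g 0 := by fun_prop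
      simpa using this.tendsto 0
    have h2 := h1.smul_isBigO (Asymptotics.isBigO_refl (fun y : E N => y) (𝓝 0))
    refine (h2.congr_left fun y => ?_).trans_isBigO ?_
    · simp [sub_smul]
    · simpa using Asymptotics.isBigO_refl (fun y : E N => y) (𝓝 0)
  · have h1 := (hasDerivAt_radialMean hN hg (norm_ne_zero_iff.2 hx)).comp_hasFDerivAt x
      (hasFDerivAt_norm_of_ne_zero hx)
    refine (h1.smul (hasFDerivAt_id x)).congr_fderiv ?_
    have hn := norm_ne_zero_iff.2 hx
    ext v
    simp [radialJacobian, smul_smul]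
    field_simp
    simp

theorem continuous_radialJacobian {N : ℕ} (hN : 1 ≤ N) {g : ℝ → ℝ} (hg : Continuous g) :
    Continuous (radialJacobian N g) := by
  have hA := continuous_radialMean (N := N) hg
  unfold radialJacobian
  refine Continuous.add (by fun_prop) (continuous_iff_continuousAt.2 fun x => ?_)
  rcases eq_or_ne x 0 with rfl | hx
  · have hlim : Tendsto (fun x : E N => |g ‖x‖ - N * radialMean N g ‖x‖|) (𝓝 0) (𝓝 0) := by
      have hc : Continuous fun x : E N => |g ‖x‖ - N * radialMean N g ‖x‖| := by fun_prop
      have := hc.tendsto 0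
      simpa [radialMean_zero hN] using this
    rw [ContinuousAt]
    simp only [smul_zero, ContinuousLinearMap.smulRight_zero]
    refine squeeze_zero_norm (fun x => ?_) hlim
    rw [ContinuousLinearMap.norm_smulRight_apply, innerSL_apply_norm, norm_smul, norm_div,
      norm_pow, norm_norm, Real.norm_eq_abs]
    rcases eq_or_ne x 0 with rfl | hx
    · simp
    · have hn := norm_ne_zero_iff.2 hx
      apply le_of_eq
      field_simp
  · have hn : ‖x‖ ^ 2 ≠ 0 := pow_ne_zero 2 (norm_ne_zero_iff.2 hx)
    have c1 : Continuous fun y : E N => g ‖y‖ - N * radialMean N g ‖y‖ := by fun_prop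
    have c2 : Continuous fun y : E N => ‖y‖ ^ 2 := by fun_prop
    have h1 : ContinuousAt (fun y : E N => ((g ‖y‖ - N * radialMean N g ‖y‖) / ‖y‖ ^ 2) • y) x :=
      (c1.continuousAt.div c2.continuousAt hn).smul continuousAt_id
    have h2 : ContinuousAt (fun y : E N => innerSL ℝ y) x := (innerSL ℝ).continuous.continuousAt
    exact ((continuousAt_const (y := ContinuousLinearMap.smulRightL ℝ (E N) (E N))).clm_apply
      h2).clm_apply h1

theorem contDiff_radialField {N : ℕ} (hN : 1 ≤ N) {g : ℝ → ℝ} (hg : Continuous g) :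
    ContDiff ℝ 1 (fun y : E N => radialMean N g ‖y‖ • y) := by
  rw [contDiff_one_iff_fderiv]
  refine ⟨fun x => (hasFDerivAt_radialField hN hg x).differentiableAt, ?_⟩
  exact (continuous_radialJacobian hN hg).congr fun x =>
    (hasFDerivAt_radialField hN hg x).fderiv.symm

theorem divergence_radialField {N : ℕ} (hN : 1 ≤ N) {g : ℝ → ℝ} (hg : Continuous g) (x : E N) :
    divergence (fun y : E N => radialMean N g ‖y‖ • y) x = g ‖x‖ := by
  unfold divergence
  rw [(hasFDerivAt_radialField hN hg x).fderiv]
  have h : ∀ i, (radialJacobian N g x (EuclideanSpace.single i 1)) i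
      = radialMean N g ‖x‖ + (g ‖x‖ - N * radialMean N g ‖x‖) / ‖x‖ ^ 2 * x i ^ 2 := by
    intro i
    simp [radialJacobian, EuclideanSpace.inner_single_right]
    ring
  simp_rw [h]
  rw [Finset.sum_add_distrib, ← Finset.mul_sum, ← EuclideanSpace.real_norm_sq_eq]
  simp only [Finset.sum_const, Finset.card_univ, Fintype.card_fin, nsmul_eq_mul]
  rcases eq_or_ne x 0 with rfl | hx
  · simp [radialMean_zero hN]
  · have hn := norm_ne_zero_iff.2 hx
    field_simp
    ring

theorem hasGradientAt_radialPrimitive {N : ℕ} {g : ℝ → ℝ} (hg : Continuous g) (c : ℝ) (x : E N) :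
    HasGradientAt (fun y : E N => radialPrimitive N g c ‖y‖) (radialMean N g ‖x‖ • x) x := by
  rw [hasGradientAt_iff_hasFDerivAt]
  rcases eq_or_ne x 0 with rfl | hx
  · have h := hasDerivAt_iff_isLittleO_nhds_zero.1
      (hasDerivAt_radialPrimitive (N := N) hg c 0)
    rw [hasFDerivAt_iff_isLittleO_nhds_zero]
    have h2 := h.comp_tendsto (tendsto_norm_zero (E := E N))
    refine (h2.congr_left fun y => ?_).trans_isBigO ?_
    · simp
    · exact (Asymptotics.isBigO_refl (fun y : E N => y) (𝓝 0)).norm_left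
  · refine ((hasDerivAt_radialPrimitive hg c ‖x‖).comp_hasFDerivAt x
      (hasFDerivAt_norm_of_ne_zero hx)).congr_fderiv ?_
    have hn := norm_ne_zero_iff.2 hx
    ext v
    simp
    field_simp

/-- The radial solution of the Poisson equation with a continuous radial right-hand side is of
class `C²`, also at the origin. -/
theorem contDiff_radialPrimitive {N : ℕ} (hN : 1 ≤ N) {g : ℝ → ℝ} (hg : Continuous g) (c : ℝ) :
    ContDiff ℝ 2 (fun y : E N => radialPrimitive N g c ‖y‖) := by
  have h2 : (2 : WithTop ℕ∞) = 1 + 1 := by norm_num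
  rw [h2, contDiff_succ_iff_fderiv]
  refine ⟨fun x => (hasGradientAt_radialPrimitive hg c x).differentiableAt, by simp, ?_⟩
  have : fderiv ℝ (fun y : E N => radialPrimitive N g c ‖y‖)
      = fun x => InnerProductSpace.toDual ℝ (E N) (radialMean N g ‖x‖ • x) := by
    ext1 x
    exact (hasGradientAt_radialPrimitive hg c x).hasFDerivAt.fderiv
  rw [this]
  exact (InnerProductSpace.toDual ℝ (E N)).contDiff.comp (contDiff_radialField hN hg)

theorem laplacian_radialPrimitive {N : ℕ} (hN : 1 ≤ N) {g : ℝ → ℝ} (hg : Continuous g) (c : ℝ)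
    (x : E N) : (Δ (fun y : E N => radialPrimitive N g c ‖y‖)) x = g ‖x‖ := by
  rw [laplacian_eq_divergence_gradient (contDiff_radialPrimitive hN hg c).contDiffAt,
    gradient_eq fun x => hasGradientAt_radialPrimitive hg c x, divergence_radialField hN hg]

/-! ### The weak equation tested with radial functions -/

theorem radialMean_nonneg {N : ℕ} {g : ℝ → ℝ} (hg : ∀ r, 0 ≤ g r) (r : ℝ) :
    0 ≤ radialMean N g r :=
  intervalIntegral.integral_nonneg zero_le_one fun _ hτ =>
    mul_nonneg (pow_nonneg hτ.1 _) (hg _)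

theorem radialMean_neg {N : ℕ} (g : ℝ → ℝ) (r : ℝ) :
    radialMean N (fun r => - g r) r = - radialMean N g r := by
  simp [radialMean]

theorem radialPrimitive_neg {N : ℕ} (g : ℝ → ℝ) (c r : ℝ) :
    radialPrimitive N (fun r => - g r) c r = c - (radialPrimitive N g 0 r) := by
  simp [radialPrimitive, radialMean_neg, sub_eq_add_neg]

theorem radialPrimitive_mono {N : ℕ} {g : ℝ → ℝ} (hg : Continuous g) (h0 : ∀ r, 0 ≤ g r) (c : ℝ) :
    MonotoneOn (radialPrimitive N g c) (Set.Ici 0) := by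
  refine monotoneOn_of_deriv_nonneg (convex_Ici 0)
    (fun r _ => (hasDerivAt_radialPrimitive hg c r).continuousAt.continuousWithinAt)
    (fun r _ => (hasDerivAt_radialPrimitive hg c r).differentiableAt.differentiableWithinAt)
    fun r hr => ?_
  rw [interior_Ici] at hr
  rw [(hasDerivAt_radialPrimitive hg c r).deriv]
  exact mul_nonneg (le_of_lt hr) (radialMean_nonneg h0 r)

/-- The radial Poisson problem with zero boundary values, for the right-hand side `-g`. -/
theorem isC2C0_radialPrimitive {N : ℕ} (hN : 1 ≤ N) {g : ℝ → ℝ} (hg : Continuous g) :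
    IsC2C0 (B N) (fun x : E N => radialPrimitive N g 0 1 - radialPrimitive N g 0 ‖x‖) := by
  have hC : ContDiff ℝ 2 (fun x : E N => radialPrimitive N g 0 1 - radialPrimitive N g 0 ‖x‖) :=
    contDiff_const.sub (contDiff_radialPrimitive hN hg 0)
  refine ⟨hC.contDiffOn, hC.continuous.continuousOn, fun x hx => ?_⟩
  rw [frontier_B, mem_sphere_zero_iff_norm] at hx
  simp [hx]

theorem laplacian_const_sub_radialPrimitive {N : ℕ} (hN : 1 ≤ N) {g : ℝ → ℝ} (hg : Continuous g)
    (c : ℝ) (x : E N) : (Δ (fun x : E N => c - radialPrimitive N g 0 ‖x‖)) x = - g ‖x‖ := by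
  have := laplacian_radialPrimitive hN (hg.neg) c x
  simp only [Pi.neg_def, radialPrimitive_neg] at this
  exact this

/-- The weak equation tested with the radial solution `v` of `-Δv = g`, for a radial `g ≥ 0`. It
contains the boundary condition, as `v` is not assumed to vanish near the boundary. -/
theorem integral_mul_radial_eq {N : ℕ} (hN : 1 ≤ N) {w f : E N → ℝ} {G : E N → E N} {μ : ℝ}
    (hG : HasH10Gradient (B N) w G) (hf : Integrable f (volume.restrict (B N)))
    (heq : ∀ φ, IsTestFunction (B N) φ →
      ∫ x in B N, ⟪G x, gradient φ x⟫_ℝ = μ * ∫ x in B N, φ x * f x)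
    {g : ℝ → ℝ} (hg : Continuous g) (h0 : ∀ r, 0 ≤ g r) :
    ∫ x in B N, w x * g ‖x‖ =
      μ * ∫ x in B N, (radialPrimitive N g 0 1 - radialPrimitive N g 0 ‖x‖) * f x := by
  set v : E N → ℝ := fun x => radialPrimitive N g 0 1 - radialPrimitive N g 0 ‖x‖ with hv
  have hvC := isC2C0_radialPrimitive hN hg
  obtain ⟨C, hC⟩ := (isCompact_Icc (a := (0 : ℝ)) (b := 1)).exists_bound_of_continuousOn
    hg.continuousOn
  obtain ⟨φ, hφ, h1, h2, ⟨M, hM⟩, hlim⟩ := hvC.exists_isTestFunction_approx (C := C)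
    (fun x hx => sub_nonneg.2 (radialPrimitive_mono hg h0 0 (norm_nonneg x)
      (Set.mem_Ici.2 zero_le_one) (mem_ball_zero_iff.1 hx).le))
    (fun x hx => by
      rw [laplacian_const_sub_radialPrimitive hN hg, abs_neg]
      exact hC _ ⟨norm_nonneg x, (mem_ball_zero_iff.1 hx).le⟩)
  have hgrad : ∀ x, gradient v x = - (radialMean N g ‖x‖ • x) := by
    have h := gradient_eq fun x : E N =>
      hasGradientAt_radialPrimitive hg.neg (radialPrimitive N g 0 1) x
    simp only [Pi.neg_def, radialPrimitive_neg, radialMean_neg, neg_smul] at h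
    exact congrFun h
  have l1 : Tendsto (fun k => ∫ x in B N, ⟪G x, gradient (φ k) x⟫_ℝ) atTop
      (𝓝 (∫ x in B N, ⟪G x, gradient v x⟫_ℝ)) := by
    have := h2.tendsto_integral_inner hG.memLp.2
    simpa only [real_inner_comm] using this
  have l2 : Tendsto (fun k => μ * ∫ x in B N, φ k x * f x) atTop
      (𝓝 (μ * ∫ x in B N, v x * f x)) := by
    refine Tendsto.const_mul μ ?_
    refine tendsto_integral_of_dominated_convergence (fun x => M * |f x|)
      (fun k => ((hφ k).memLp 1).1.mul hf.1) (hf.abs.const_mul M) (fun k => ae_B fun x hx => ?_)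
      (ae_B fun x hx => (hlim x hx).mul_const _)
    rw [norm_mul]
    exact mul_le_mul_of_nonneg_right (hM k x hx) (abs_nonneg _)
  rw [← tendsto_nhds_unique l1 (l2.congr fun k => (heq _ (hφ k)).symm)]
  simp_rw [hgrad, inner_neg_right, integral_neg]
  rw [hG.integral_inner (contDiff_radialField hN hg), neg_neg]
  simp_rw [divergence_radialField hN hg]

/-- Integration in polar coordinates over the unit ball. -/
theorem setIntegral_B_radial {N : ℕ} (hN : 1 ≤ N) (h : ℝ → ℝ) :
    ∫ x in B N, h ‖x‖ = N * volume.real (B N) * ∫ r in Set.Ioo (0 : ℝ) 1, r ^ (N - 1) * h r := by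
  have : Nonempty (Fin N) := ⟨⟨0, hN⟩⟩
  have e := integral_fun_norm_addHaar (volume : Measure (E N)) ((Set.Iio (1 : ℝ)).indicator h)
  have e1 : ∀ x : E N, (Set.Iio (1 : ℝ)).indicator h ‖x‖ = (B N).indicator (fun x => h ‖x‖) x := by
    intro x
    simp [Set.indicator, B]
  have e2 : ∀ r : ℝ, r ^ (N - 1) • (Set.Iio (1 : ℝ)).indicator h r
      = (Set.Iio (1 : ℝ)).indicator (fun r => r ^ (N - 1) * h r) r := by
    intro r
    by_cases hr : r ∈ Set.Iio (1 : ℝ) <;> simp [Set.indicator, hr]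
  simp_rw [e1] at e
  rw [integral_indicator (measurableSet_B N), finrank_euclideanSpace_fin] at e
  simp_rw [e2] at e
  rw [setIntegral_indicator measurableSet_Iio, Set.Ioi_inter_Iio] at e
  rw [e, nsmul_eq_mul, smul_eq_mul, mul_assoc]
  rfl

theorem integrableOn_B_radial {N : ℕ} (hN : 1 ≤ N) (h : ℝ → ℝ) :
    IntegrableOn (fun x : E N => h ‖x‖) (B N) ↔
      IntegrableOn (fun r => r ^ (N - 1) * h r) (Set.Ioo 0 1) := by
  have : Nonempty (Fin N) := ⟨⟨0, hN⟩⟩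
  have e := integrableOn_fun_norm_addHaar (μ := (volume : Measure (E N))) (f := h) (r := 1)
  rw [finrank_euclideanSpace_fin] at e
  exact e

theorem volume_B_pos {N : ℕ} : 0 < volume.real (B N) :=
  ENNReal.toReal_pos (Metric.measure_ball_pos _ _ one_pos).ne' measure_ball_lt_top.ne

/-- The profile `W` of a radial function `x ↦ W ‖x‖`, read off on a coordinate axis. -/
noncomputable def profile {N : ℕ} (hN : 1 ≤ N) (w : E N → ℝ) (r : ℝ) : ℝ :=
  w (EuclideanSpace.single ⟨0, hN⟩ r)

theorem RadiallyDecreasingOn.eq_profile {N : ℕ} (hN : 1 ≤ N) {w : E N → ℝ}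
    (h : RadiallyDecreasingOn (B N) w) {x : E N} (hx : x ∈ B N) : w x = profile hN w ‖x‖ := by
  have hn : ‖(EuclideanSpace.single ⟨0, hN⟩ ‖x‖ : E N)‖ = ‖x‖ := by simp
  have hy : (EuclideanSpace.single ⟨0, hN⟩ ‖x‖ : E N) ∈ B N := by
    rw [B, mem_ball_zero_iff, hn]
    exact mem_ball_zero_iff.1 hx
  exact le_antisymm (h _ hy _ hx hn.le) (h _ hx _ hy hn.ge)

theorem RadiallyDecreasingOn.antitoneOn_profile {N : ℕ} (hN : 1 ≤ N) {w : E N → ℝ}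
    (h : RadiallyDecreasingOn (B N) w) : AntitoneOn (profile hN w) (Set.Ico 0 1) := by
  intro r hr s hs hrs
  refine h _ ?_ _ ?_ ?_
  · simpa [B, abs_of_nonneg hr.1] using hr.2
  · simpa [B, abs_of_nonneg hs.1] using hs.2
  · simpa [abs_of_nonneg hr.1, abs_of_nonneg hs.1] using hrs

/-! ### The radial equation integrated twice -/

/-- `∫₀^r F`, the mass of a radial density; `F` stands for `t^{N-1} f(t)`. -/
noncomputable def mass (F : ℝ → ℝ) (r : ℝ) : ℝ := ∫ t in (0 : ℝ)..r, F t

/-- `∫_r^1 s^{1-N} ∫₀^s F`, the radial potential with zero boundary value of the density `F`. -/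
noncomputable def potential (N : ℕ) (F : ℝ → ℝ) (r : ℝ) : ℝ :=
  ∫ s in r..(1 : ℝ), mass F s / s ^ (N - 1)

theorem continuous_mass {F : ℝ → ℝ} (hF : Integrable F) : Continuous (mass F) :=
  intervalIntegral.continuous_primitive (fun _ _ => hF.intervalIntegrable) 0

/-- `potential N F` with the weight `s^{1-N}` frozen for `s ≤ δ`, which removes the singularity. -/
noncomputable def regPotential (N : ℕ) (F : ℝ → ℝ) (δ r : ℝ) : ℝ :=
  ∫ s in r..(1 : ℝ), mass F s / max s δ ^ (N - 1)

theorem continuous_regDensity {N : ℕ} {F : ℝ → ℝ} (hF : Integrable F) {δ : ℝ} (hδ : 0 < δ) :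
    Continuous fun s => mass F s / max s δ ^ (N - 1) :=
  (continuous_mass hF).div (by fun_prop) fun s => pow_ne_zero _ (lt_max_of_lt_right hδ).ne'

theorem hasDerivAt_regPotential {N : ℕ} {F : ℝ → ℝ} (hF : Integrable F) {δ : ℝ} (hδ : 0 < δ)
    (r : ℝ) : HasDerivAt (regPotential N F δ) (-(mass F r / max r δ ^ (N - 1))) r := by
  have hc := continuous_regDensity (N := N) hF hδ
  exact intervalIntegral.integral_hasDerivAt_left (hc.intervalIntegrable _ _)
    (hc.stronglyMeasurableAtFilter _ _) hc.continuousAt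

theorem potential_eq_regPotential {N : ℕ} {F : ℝ → ℝ} {δ r : ℝ} (hr : δ ≤ r) (hδ : δ ≤ 1) :
    potential N F r = regPotential N F δ r := by
  refine intervalIntegral.integral_congr fun s hs => ?_
  have : δ ≤ s := (le_min hr hδ).trans hs.1
  simp only [max_eq_left this]

theorem hasDerivAt_potential {N : ℕ} {F : ℝ → ℝ} (hF : Integrable F) {r : ℝ} (hr : 0 < r) :
    HasDerivAt (potential N F) (-(mass F r / r ^ (N - 1))) r := by
  have hδ : 0 < min (r / 2) 1 := by positivity
  have hδr : min (r / 2) 1 < r := (min_le_left _ _).trans_lt (half_lt_self hr)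
  have h := hasDerivAt_regPotential (N := N) hF hδ r
  rw [max_eq_left hδr.le] at h
  refine h.congr_of_eventuallyEq ?_
  filter_upwards [lt_mem_nhds hδr] with s hs
  exact potential_eq_regPotential hs.le (min_le_right _ _)

/-- Fubini: the pairing of a density with `∫_r^1 k` is the pairing of its mass with `k`. -/
theorem integral_mul_primitive {F k : ℝ → ℝ} (hF : Integrable F) (hk : Continuous k) :
    ∫ r in Set.Ioo (0 : ℝ) 1, (∫ s in r..(1 : ℝ), k s) * F r =
      ∫ s in Set.Ioo (0 : ℝ) 1, k s * mass F s := by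
  set ν := (volume : Measure ℝ).restrict (Set.Ioo 0 1) with hν
  have hkν : Integrable k ν :=
    (hk.integrableOn_Icc (a := 0) (b := 1)).mono_set Set.Ioo_subset_Icc_self
  have hset : MeasurableSet {p : ℝ × ℝ | p.1 < p.2} :=
    measurableSet_lt measurable_fst measurable_snd
  have hint : Integrable (Function.uncurry fun r s => (Set.Ioi r).indicator k s * F r)
      (ν.prod ν) := by
    have h1 : Integrable (fun p : ℝ × ℝ => F p.1 * k p.2) (ν.prod ν) :=
      (hF.restrict (s := Set.Ioo 0 1)).mul_prod hkν
    refine (h1.indicator hset).congr (Eventually.of_forall fun p => ?_)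
    by_cases hp : p.1 < p.2
    · simp [Set.indicator, Function.uncurry_def, hp, mul_comm]
    · simp [Set.indicator, Function.uncurry_def, hp]
  have hswap := integral_integral_swap hint
  have e1 : ∫ r in Set.Ioo (0 : ℝ) 1, (∫ s in r..(1 : ℝ), k s) * F r
      = ∫ r, ∫ s, (Set.Ioi r).indicator k s * F r ∂ν ∂ν := by
    refine setIntegral_congr_fun measurableSet_Ioo fun r hr => ?_
    rw [integral_mul_const, integral_indicator measurableSet_Ioi, hν,
      Measure.restrict_restrict measurableSet_Ioi, intervalIntegral.integral_of_le hr.2.le,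
      integral_Ioc_eq_integral_Ioo]
    congr 3
    ext s
    simp only [Set.mem_Ioo, Set.mem_inter_iff, Set.mem_Ioi]
    constructor
    · rintro ⟨h1, h2⟩
      exact ⟨h1, hr.1.trans h1, h2⟩
    · rintro ⟨h1, -, h2⟩
      exact ⟨h1, h2⟩
  rw [e1, hswap]
  refine setIntegral_congr_fun measurableSet_Ioo fun s hs => ?_
  have e2 : ∀ r, (Set.Ioi r).indicator k s * F r = k s * (Set.Iio s).indicator F r := by
    intro r
    by_cases hrs : r < s <;> simp [Set.indicator, hrs]
  simp only [e2]
  rw [integral_const_mul, integral_indicator measurableSet_Iio, hν,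
    Measure.restrict_restrict measurableSet_Iio, mass, intervalIntegral.integral_of_le hs.1.le,
    integral_Ioc_eq_integral_Ioo]
  congr 3
  ext r
  simp only [Set.mem_Ioo, Set.mem_inter_iff, Set.mem_Iio]
  constructor
  · rintro ⟨h1, h2, -⟩
    exact ⟨h2, h1⟩
  · rintro ⟨h1, h2⟩
    exact ⟨h2, h1, h2.trans hs.2⟩

/-- The pairing of a density with the radial solution of the Poisson problem for `g` is the pairing
of `g` with the potential of the density. -/
theorem integral_radialPrimitive_mul {N : ℕ} (hN : 1 ≤ N) {F g : ℝ → ℝ} (hF : Integrable F)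
    (hg : Continuous g) {δ : ℝ} (hδ : 0 < δ) (hδ1 : δ ≤ 1) (hgδ : ∀ r ≤ δ, g r = 0) :
    ∫ r in Set.Ioo (0 : ℝ) 1, (radialPrimitive N g 0 1 - radialPrimitive N g 0 r) * F r =
      ∫ r in Set.Ioo (0 : ℝ) 1, r ^ (N - 1) * (potential N F r * g r) := by
  have hk : Continuous fun s => s * radialMean N g s :=
    continuous_id.mul (continuous_radialMean hg)
  have e1 : ∀ r, radialPrimitive N g 0 1 - radialPrimitive N g 0 r
      = ∫ s in r..(1 : ℝ), s * radialMean N g s := by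
    intro r
    simp only [radialPrimitive, zero_add]
    exact intervalIntegral.integral_interval_sub_left (hk.intervalIntegrable _ _)
      (hk.intervalIntegrable _ _)
  simp_rw [e1]
  rw [integral_mul_primitive hF hk]
  -- the mass of `g`, which vanishes on `[0, δ]`, so that the singular weight may be frozen there
  set T : ℝ → ℝ := fun s => ∫ t in (0 : ℝ)..s, t ^ (N - 1) * g t with hT
  have hTd : ∀ s, HasDerivAt T (s ^ (N - 1) * g s) s := fun s =>
    (Continuous.integral_hasStrictDerivAt (by fun_prop) 0 s).hasDerivAt
  have hT0 : ∀ s ≤ δ, 0 ≤ s → T s = 0 := by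
    intro s hs h0
    refine intervalIntegral.integral_zero_ae (Eventually.of_forall fun t ht => ?_)
    rw [Set.uIoc_of_le h0] at ht
    rw [hgδ t (ht.2.trans hs), mul_zero]
  have hparts := intervalIntegral.integral_mul_deriv_eq_deriv_mul (a := 0) (b := 1)
    (fun s _ => hTd s) (fun s _ => hasDerivAt_regPotential (N := N) hF hδ s)
    ((by fun_prop : Continuous fun s => s ^ (N - 1) * g s).intervalIntegrable _ _)
    ((continuous_regDensity hF hδ).neg.intervalIntegrable _ _)
  have hend : regPotential N F δ 1 = 0 := by simp [regPotential]
  rw [hend, hT0 0 hδ.le le_rfl] at hparts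
  simp only [mul_zero, zero_mul, sub_zero, zero_sub, mul_neg, intervalIntegral.integral_neg,
    neg_inj] at hparts
  rw [intervalIntegral.integral_of_le zero_le_one, intervalIntegral.integral_of_le zero_le_one,
    integral_Ioc_eq_integral_Ioo, integral_Ioc_eq_integral_Ioo] at hparts
  calc ∫ s in Set.Ioo (0 : ℝ) 1, s * radialMean N g s * mass F s
      = ∫ s in Set.Ioo (0 : ℝ) 1, T s * (mass F s / max s δ ^ (N - 1)) := by
        refine setIntegral_congr_fun measurableSet_Ioo fun s hs => ?_
        have hTs : s ^ N * radialMean N g s = T s := pow_mul_radialMean hN g s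
        have hs0 : s ≠ 0 := hs.1.ne'
        have hpow : s ^ N = s ^ (N - 1) * s := by
          rw [← pow_succ, Nat.sub_add_cancel hN]
        rcases le_total s δ with h | h
        · have h0 : radialMean N g s = 0 := by
            have := hTs
            rw [hT0 s h hs.1.le] at this
            exact (mul_eq_zero.1 this).resolve_left (pow_ne_zero N hs0)
          simp [h0, hT0 s h hs.1.le]
        · simp only [max_eq_left h]
          rw [← hTs, hpow]
          field_simp
    _ = ∫ s in Set.Ioo (0 : ℝ) 1, s ^ (N - 1) * g s * regPotential N F δ s := hparts
    _ = _ := by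
        refine setIntegral_congr_fun measurableSet_Ioo fun s hs => ?_
        rcases le_total s δ with h | h
        · simp [hgδ s h]
        · simp only [potential_eq_regPotential h hδ1]
          ring

/-- A function that is antitone on an open interval and a.e. equal there to a continuous function is
equal to it. -/
theorem eq_of_antitoneOn_of_ae_eq {a b : ℝ} {f h : ℝ → ℝ} (hf : AntitoneOn f (Set.Ioo a b))
    (hh : ContinuousOn h (Set.Ioo a b)) (hae : ∀ᵐ r, r ∈ Set.Ioo a b → f r = h r) :
    ∀ r ∈ Set.Ioo a b, f r = h r := by
  have hdense : ∀ c d, a ≤ c → c < d → d ≤ b → ∃ s ∈ Set.Ioo c d, f s = h s := by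
    intro c d hac hcd hdb
    by_contra! hno
    have h1 : volume (Set.Ioo c d) = 0 := by
      refine measure_mono_null (fun s hs => ?_) hae
      exact fun hmem => hno s hs (hmem ⟨hac.trans_lt hs.1, hs.2.trans_le hdb⟩)
    rw [Real.volume_Ioo, ENNReal.ofReal_eq_zero] at h1
    linarith
  intro r hr
  have hc := hh.continuousAt (isOpen_Ioo.mem_nhds hr)
  refine le_antisymm (le_of_forall_pos_le_add fun ε hε => ?_)
    (le_of_forall_pos_le_add fun ε hε => ?_)
  · obtain ⟨l, u, hlu, hsub⟩ := mem_nhds_iff_exists_Ioo_subset.1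
      (hc.eventually (gt_mem_nhds (lt_add_of_pos_right (h r) hε)))
    obtain ⟨s, hs, hfs⟩ := hdense (max a l) r (le_max_left _ _) (max_lt hr.1 hlu.1) hr.2.le
    have h1 := hsub ⟨(le_max_right a l).trans_lt hs.1, hs.2.trans hlu.2⟩
    have h2 := hf ⟨(le_max_left a l).trans_lt hs.1, hs.2.trans hr.2⟩ hr hs.2.le
    have h3 : h s < h r + ε := h1
    linarith
  · obtain ⟨l, u, hlu, hsub⟩ := mem_nhds_iff_exists_Ioo_subset.1
      (hc.eventually (lt_mem_nhds (sub_lt_self (h r) hε)))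
    obtain ⟨s, hs, hfs⟩ := hdense r (min b u) hr.1.le (lt_min hr.2 hlu.2) (min_le_left _ _)
    have h1 := hsub ⟨hlu.1.trans hs.1, hs.2.trans_le (min_le_right _ _)⟩
    have h2 := hf hr ⟨hr.1.trans hs.1, hs.2.trans_le (min_le_left _ _)⟩ hs.1.le
    have h3 : h r - ε < h s := h1
    linarith

/-- The weak form of the radial equation, with its boundary condition, integrated twice. -/
theorem eq_potential_of_weak {N : ℕ} (hN : 1 ≤ N) {W F : ℝ → ℝ} {μ : ℝ} (hF : Integrable F)
    (hW : AntitoneOn W (Set.Ioo 0 1))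
    (hWi : IntegrableOn (fun r => r ^ (N - 1) * W r) (Set.Ioo 0 1))
    (h : ∀ g : ℝ → ℝ, Continuous g → (∀ r, 0 ≤ g r) →
      ∫ r in Set.Ioo (0 : ℝ) 1, r ^ (N - 1) * (W r * g r) =
        μ * ∫ r in Set.Ioo (0 : ℝ) 1,
          (radialPrimitive N g 0 1 - radialPrimitive N g 0 r) * F r) :
    ∀ r ∈ Set.Ioo (0 : ℝ) 1, W r = μ * potential N F r := by
  have hPc : ContinuousOn (potential N F) (Set.Ioo 0 1) := fun r hr =>
    (hasDerivAt_potential hF hr.1).continuousAt.continuousWithinAt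
  refine eq_of_antitoneOn_of_ae_eq hW (continuousOn_const.mul hPc) ?_
  set D : ℝ → ℝ := fun r => r ^ (N - 1) * W r - μ * (r ^ (N - 1) * potential N F r) with hD
  suffices hDae : ∀ᵐ r, r ∈ Set.Ioo (0 : ℝ) 1 → D r = 0 by
    filter_upwards [hDae] with r hr hmem
    have h1 := hr hmem
    rw [hD] at h1
    have h2 : r ^ (N - 1) * (W r - μ * potential N F r) = 0 := by
      rw [← h1]
      ring
    exact sub_eq_zero.1 ((mul_eq_zero.1 h2).resolve_left (pow_ne_zero _ hmem.1.ne'))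
  -- nonnegative continuous functions vanishing near `0`
  have key : ∀ g : ℝ → ℝ, Continuous g → (∀ r, 0 ≤ g r) → ∀ δ, 0 < δ → δ ≤ 1 →
      (∀ r ≤ δ, g r = 0) → IntegrableOn (fun r => g r * D r) (Set.Ioo 0 1) ∧
        ∫ r in Set.Ioo (0 : ℝ) 1, g r * D r = 0 := by
    intro g hg h0 δ hδ hδ1 hgδ
    obtain ⟨C, hC⟩ := (isCompact_Icc (a := (0 : ℝ)) (b := 1)).exists_bound_of_continuousOn
      hg.continuousOn
    have i1 : IntegrableOn (fun r => r ^ (N - 1) * (W r * g r)) (Set.Ioo 0 1) := by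
      refine (hWi.bdd_mul (c := C) hg.aestronglyMeasurable ((ae_restrict_iff' measurableSet_Ioo).2
        (Eventually.of_forall fun r hr => hC r (Set.Ioo_subset_Icc_self hr)))).congr
        (Eventually.of_forall fun r => ?_)
      simp only
      ring
    have i2 : IntegrableOn (fun r => r ^ (N - 1) * (potential N F r * g r)) (Set.Ioo 0 1) := by
      have hRc : Continuous (regPotential N F δ) := continuous_iff_continuousAt.2 fun r =>
        (hasDerivAt_regPotential hF hδ r).continuousAt
      have hc : Continuous fun r => r ^ (N - 1) * (regPotential N F δ r * g r) := by fun_prop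
      refine ((hc.integrableOn_Icc (a := 0) (b := 1)).mono_set Set.Ioo_subset_Icc_self).congr_fun
        (fun r hr => ?_) measurableSet_Ioo
      rcases le_total r δ with hr' | hr'
      · simp [hgδ r hr']
      · simp only [potential_eq_regPotential hr' hδ1]
    have e : ∀ r, g r * D r
        = r ^ (N - 1) * (W r * g r) - μ * (r ^ (N - 1) * (potential N F r * g r)) := by
      intro r
      rw [hD]
      ring
    simp_rw [e]
    refine ⟨i1.sub (i2.const_mul μ), ?_⟩
    rw [integral_sub i1 (i2.const_mul μ), integral_const_mul, h g hg h0,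
      integral_radialPrimitive_mul hN hF hg hδ hδ1 hgδ, sub_self]
  refine isOpen_Ioo.ae_eq_zero_of_integral_contDiff_smul_eq_zero ?_ fun φ hφ hφc hφs => ?_
  · refine hWi.locallyIntegrableOn.sub (ContinuousOn.locallyIntegrableOn ?_ measurableSet_Ioo)
    exact continuousOn_const.mul ((continuous_pow (N - 1)).continuousOn.mul hPc)
  obtain ⟨δ, hδ, hδ1, hφδ⟩ : ∃ δ, 0 < δ ∧ δ ≤ 1 ∧ ∀ r ≤ δ, φ r = 0 := by
    rcases (tsupport φ).eq_empty_or_nonempty with hemp | hne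
    · refine ⟨1, one_pos, le_rfl, fun r _ => image_eq_zero_of_notMem_tsupport ?_⟩
      simp [hemp]
    · obtain ⟨m, hm, hmin⟩ := IsCompact.exists_isLeast hφc hne
      have hm01 := hφs hm
      refine ⟨m / 2, half_pos hm01.1, by linarith [hm01.2], fun r hr => ?_⟩
      refine image_eq_zero_of_notMem_tsupport fun hmem => ?_
      linarith [hmin hmem, hm01.1]
  obtain ⟨i1, z1⟩ := key (fun r => max (φ r) 0) (hφ.continuous.max continuous_const)
    (fun r => le_max_right _ _) δ hδ hδ1 (fun r hr => by simp [hφδ r hr])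
  obtain ⟨i2, z2⟩ := key (fun r => max (-φ r) 0) (hφ.continuous.neg.max continuous_const)
    (fun r => le_max_right _ _) δ hδ hδ1 (fun r hr => by simp [hφδ r hr])
  rw [← setIntegral_eq_integral_of_forall_compl_eq_zero (s := Set.Ioo 0 1)]
  · have e : ∀ r, φ r • D r = max (φ r) 0 * D r - max (-φ r) 0 * D r := by
      intro r
      rcases le_total 0 (φ r) with hr | hr
      · simp [hr]
      · simp [hr]
    simp_rw [e]
    rw [integral_sub i1 i2, z1, z2, sub_zero]
  · intro r hr
    rw [image_eq_zero_of_notMem_tsupport fun hm => hr (hφs hm), zero_smul]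

/-! ### The gap `1 - w` of a weak solution -/

/-- A density that dominates a multiple of `1 / (r - a)` to the right of `a` is not integrable. -/
theorem not_integrable_of_sub_inv_le {F : ℝ → ℝ} {a b c : ℝ} (hab : a < b) (hc : 0 < c)
    (h : ∀ r ∈ Set.Ioo a b, c * (r - a)⁻¹ ≤ F r) : ¬ Integrable F := by
  intro hF
  have h1 : IntegrableOn (fun r => (r - a)⁻¹) (Set.Ioo a b) := by
    refine Integrable.mono' ((hF.const_mul c⁻¹).restrict (s := Set.Ioo a b)) (by fun_prop) ?_
    refine (ae_restrict_iff' measurableSet_Ioo).2 (Eventually.of_forall fun r hr => ?_)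
    rw [Real.norm_eq_abs, abs_of_nonneg (inv_nonneg.2 (sub_nonneg.2 hr.1.le)), inv_mul_eq_div,
      le_div_iff₀ hc, mul_comm]
    exact h r hr
  have h2 : IntervalIntegrable (fun r => (r - a)⁻¹) volume a b := by
    rwa [intervalIntegrable_iff_integrableOn_Ioo_of_le hab.le]
  rcases intervalIntegrable_sub_inv_iff.1 h2 with h | h
  · exact hab.ne h
  · exact h Set.left_mem_uIcc

theorem mass_nonneg {F : ℝ → ℝ} (hF : ∀ r, 0 ≤ F r) {r : ℝ} (hr : 0 ≤ r) : 0 ≤ mass F r :=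
  intervalIntegral.integral_nonneg hr fun s _ => hF s

theorem antitoneOn_potential {N : ℕ} {F : ℝ → ℝ} (hF : Integrable F) (h0 : ∀ r, 0 ≤ F r) :
    AntitoneOn (potential N F) (Set.Ioi 0) := by
  refine antitoneOn_of_deriv_nonpos (convex_Ioi 0)
    (fun r hr => (hasDerivAt_potential hF hr).continuousAt.continuousWithinAt)
    (fun r hr => ?_) fun r hr => ?_
  · rw [interior_Ioi] at hr
    exact (hasDerivAt_potential hF hr).differentiableAt.differentiableWithinAt
  · rw [interior_Ioi] at hr
    rw [(hasDerivAt_potential hF hr).deriv]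
    exact neg_nonpos.2 (div_nonneg (mass_nonneg h0 (le_of_lt hr)) (pow_nonneg (le_of_lt hr) _))

theorem potential_one (N : ℕ) (F : ℝ → ℝ) : potential N F 1 = 0 := by
  simp [potential]

/-- The gap `V = 1 - w` of a radial solution as a function of `‖x‖`, in terms of the density
`F(r) = r^{N-1} / V(r)²` and of the coefficient `μ` of the equation. -/
noncomputable def gap (N : ℕ) (F : ℝ → ℝ) (μ r : ℝ) : ℝ := 1 - μ * potential N F r

theorem hasDerivAt_gap {N : ℕ} {F : ℝ → ℝ} (hF : Integrable F) (μ : ℝ) {r : ℝ} (hr : 0 < r) :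
    HasDerivAt (gap N F μ) (μ * (mass F r / r ^ (N - 1))) r := by
  refine (((hasDerivAt_potential (N := N) hF hr).const_mul μ).const_sub 1).congr_deriv ?_
  ring

theorem monotoneOn_gap {N : ℕ} {F : ℝ → ℝ} (hF : Integrable F) (h0 : ∀ r, 0 ≤ F r) {μ : ℝ}
    (hμ : 0 ≤ μ) : MonotoneOn (gap N F μ) (Set.Ioi 0) := fun _ hr _ hs hrs =>
  sub_le_sub_left (mul_le_mul_of_nonneg_left (antitoneOn_potential hF h0 hr hs hrs) hμ) 1

theorem gap_one (N : ℕ) (F : ℝ → ℝ) (μ : ℝ) : gap N F μ 1 = 1 := by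
  simp [gap, potential_one]

theorem continuousOn_gap {N : ℕ} {F : ℝ → ℝ} (hF : Integrable F) (μ : ℝ) :
    ContinuousOn (gap N F μ) (Set.Ioi 0) := fun _ hr =>
  (hasDerivAt_gap hF μ hr).continuousAt.continuousWithinAt

/-- The gap is positive away from the origin: it is Lipschitz there, so that near a zero `F` would
not be integrable. -/
theorem gap_pos {N : ℕ} {F : ℝ → ℝ} (hF : Integrable F) (h0 : ∀ r, 0 ≤ F r) {μ : ℝ}
    (hμ : 0 ≤ μ) (heq : ∀ r ∈ Set.Ioo (0 : ℝ) 1, F r = r ^ (N - 1) * (1 / gap N F μ r ^ 2)) {r : ℝ}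
    (hr : 0 < r) : 0 < gap N F μ r := by
  by_contra! hle
  have hmono := monotoneOn_gap (N := N) hF h0 hμ
  have hr1 : r < 1 := by
    by_contra! h
    have := hmono (Set.mem_Ioi.2 one_pos) hr h
    rw [gap_one] at this
    linarith
  have hcont : ContinuousOn (gap N F μ) (Set.Icc r 1) :=
    (continuousOn_gap hF μ).mono fun s hs => hr.trans_le hs.1
  -- the last zero of the gap
  obtain ⟨a, ⟨har, ha0⟩, hmax⟩ : ∃ a, IsGreatest (Set.Icc r 1 ∩ gap N F μ ⁻¹' {0}) a := by
    refine IsCompact.exists_isGreatest ?_ ?_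
    · exact isCompact_Icc.of_isClosed_subset
        (hcont.preimage_isClosed_of_isClosed isClosed_Icc isClosed_singleton)
        Set.inter_subset_left
    · have := intermediate_value_Icc hr1.le hcont ⟨hle, by rw [gap_one]; exact zero_le_one⟩
      obtain ⟨s, hs, hs0⟩ := this
      exact ⟨s, hs, hs0⟩
  have ha0' : gap N F μ a = 0 := ha0
  have hapos : 0 < a := hr.trans_le har.1
  have ha1 : a < 1 := by
    refine lt_of_le_of_ne har.2 fun h => ?_
    rw [h, gap_one] at ha0'
    exact one_ne_zero ha0'
  have hpos : ∀ s ∈ Set.Ioo a 1, 0 < gap N F μ s := by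
    intro s hs
    refine lt_of_le_of_ne ?_ fun h => ?_
    · rw [← ha0']
      exact hmono hapos (hapos.trans hs.1) hs.1.le
    · exact (hmax ⟨⟨har.1.trans hs.1.le, hs.2.le⟩, h.symm⟩).not_gt hs.1
  obtain ⟨L, hL⟩ := (isCompact_Icc (a := a) (b := 1)).exists_bound_of_continuousOn
    (f := fun s => μ * (mass F s / s ^ (N - 1)))
    (continuousOn_const.mul ((continuous_mass hF).continuousOn.div (by fun_prop)
      fun s hs => pow_ne_zero _ (hapos.trans_le hs.1).ne'))
  have hL0 : 0 ≤ L := (norm_nonneg _).trans (hL a ⟨le_rfl, ha1.le⟩)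
  have hlip : ∀ s ∈ Set.Ioo a 1, gap N F μ s ≤ (L + 1) * (s - a) := by
    intro s hs
    have h1 := (convex_Icc a 1).norm_image_sub_le_of_norm_hasDerivWithin_le
      (fun t ht => (hasDerivAt_gap (N := N) hF μ (hapos.trans_le ht.1)).hasDerivWithinAt) hL
      ⟨le_rfl, ha1.le⟩ (Set.Ioo_subset_Icc_self hs)
    rw [ha0', sub_zero, Real.norm_eq_abs, Real.norm_eq_abs,
      abs_of_pos (sub_pos.2 hs.1)] at h1
    have h2 : 0 < s - a := sub_pos.2 hs.1
    linarith [le_abs_self (gap N F μ s)]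
  refine not_integrable_of_sub_inv_le (c := a ^ (N - 1) * (1 / (L + 1) ^ 2)) ha1
    (by positivity) (fun s hs => ?_) hF
  have hs0 : 0 < s - a := sub_pos.2 hs.1
  rw [heq s ⟨hapos.trans hs.1, hs.2⟩, mul_assoc]
  refine mul_le_mul (pow_le_pow_left₀ hapos.le hs.1.le _) ?_ (by positivity)
    (pow_nonneg (hapos.trans hs.1).le _)
  rw [← one_div, one_div_mul_one_div]
  refine one_div_le_one_div_of_le (pow_pos (hpos s hs) 2) ?_
  calc gap N F μ s ^ 2 ≤ ((L + 1) * (s - a)) ^ 2 := pow_le_pow_left₀ (hpos s hs).le (hlip s hs) 2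
    _ = (L + 1) ^ 2 * (s - a) * (s - a) := by ring
    _ ≤ (L + 1) ^ 2 * (s - a) * 1 :=
        mul_le_mul_of_nonneg_left (by linarith [hs.2]) (by positivity)
    _ = (L + 1) ^ 2 * (s - a) := mul_one _

theorem measure_singleton_zero {N : ℕ} (hN : 1 ≤ N) : (volume : Measure (E N)) {0} = 0 := by
  have : Nonempty (Fin N) := ⟨⟨0, hN⟩⟩
  exact measure_singleton 0

theorem ae_B_ne_zero {N : ℕ} (hN : 1 ≤ N) {p : E N → Prop} (h : ∀ x ∈ B N, x ≠ 0 → p x) :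
    ∀ᵐ x ∂(volume.restrict (B N)), p x := by
  refine (ae_restrict_iff' (measurableSet_B N)).2 ?_
  have h0 : ∀ᵐ x ∂(volume : Measure (E N)), x ≠ 0 := by
    rw [ae_iff]
    simpa using measure_singleton_zero hN
  filter_upwards [h0] with x hx hxB using h x hxB hx

/-- A weak radially decreasing solution satisfies the radial equation, integrated twice. -/
theorem IsWeakFiniteEnergySolution.exists_gap {N : ℕ} (hN : 1 ≤ N) {lam : ℝ} (hlam : 0 < lam)
    {w : E N → ℝ} (h : IsWeakFiniteEnergySolution (B N) lam w)
    (hr : RadiallyDecreasingOn (B N) w) :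
    ∃ (μ : ℝ) (F : ℝ → ℝ), 0 < μ ∧ Integrable F ∧ (∀ r, 0 ≤ F r) ∧ (∀ r > 0, 0 < gap N F μ r) ∧
      (∀ r ∈ Set.Ioo (0 : ℝ) 1, F r = r ^ (N - 1) * (1 / gap N F μ r ^ 2)) ∧
      (∀ x ∈ B N, x ≠ 0 → w x = 1 - gap N F μ ‖x‖) ∧ lam = μ * nonlocalFactor (B N) w ^ 2 := by
  obtain ⟨μ, G, hμ, hG, hμK, hweak⟩ := h.weak_equation hlam
  have hf : Integrable (fun x => 1 / (1 - w x) ^ 2) (volume.restrict (B N)) := by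
    obtain ⟨u, -, -, -, -, -, h2, -⟩ := h
    exact memLp_one_iff_integrable.1 h2.2.1
  set W := profile hN w with hW
  have hwW : ∀ x ∈ B N, w x = W ‖x‖ := fun x hx => hr.eq_profile hN hx
  have hwW' : ∀ᵐ x ∂(volume.restrict (B N)), w x = W ‖x‖ := ae_B hwW
  set F : ℝ → ℝ := (Set.Ioo 0 1).indicator fun r => r ^ (N - 1) * (1 / (1 - W r) ^ 2) with hFdef
  have hFi : Integrable F := by
    rw [hFdef, integrable_indicator_iff measurableSet_Ioo]
    refine (integrableOn_B_radial hN fun r => 1 / (1 - W r) ^ 2).1 (hf.congr ?_)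
    filter_upwards [hwW'] with x hx
    rw [hx]
  have hF0 : ∀ r, 0 ≤ F r := fun r => Set.indicator_nonneg (fun s hs => by
    have := hs.1.le
    positivity) r
  have hWi : IntegrableOn (fun r => r ^ (N - 1) * W r) (Set.Ioo 0 1) := by
    refine (integrableOn_B_radial hN W).1 (((hG.memLp.1.integrable one_le_two)).congr ?_)
    filter_upwards [hwW'] with x hx
    rw [hx]
  have hpot : ∀ r ∈ Set.Ioo (0 : ℝ) 1, W r = μ * potential N F r := by
    refine eq_potential_of_weak hN hFi
      ((hr.antitoneOn_profile hN).mono Set.Ioo_subset_Ico_self) hWi fun g hg h0 => ?_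
    have e := integral_mul_radial_eq hN hG hf hweak hg h0
    have e1 : ∫ x in B N, w x * g ‖x‖ = ∫ x in B N, W ‖x‖ * g ‖x‖ := by
      refine integral_congr_ae ?_
      filter_upwards [hwW'] with x hx
      rw [hx]
    have e2 : ∫ x in B N, (radialPrimitive N g 0 1 - radialPrimitive N g 0 ‖x‖)
          * (1 / (1 - w x) ^ 2)
        = ∫ x in B N, (radialPrimitive N g 0 1 - radialPrimitive N g 0 ‖x‖)
          * (1 / (1 - W ‖x‖) ^ 2) := by
      refine integral_congr_ae ?_
      filter_upwards [hwW'] with x hx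
      rw [hx]
    rw [e1, e2, setIntegral_B_radial hN fun r => W r * g r, setIntegral_B_radial hN fun r =>
      (radialPrimitive N g 0 1 - radialPrimitive N g 0 r) * (1 / (1 - W r) ^ 2)] at e
    have hκ : (N : ℝ) * volume.real (B N) ≠ 0 :=
      mul_ne_zero (by positivity) volume_B_pos.ne'
    rw [mul_left_comm] at e
    rw [mul_left_cancel₀ hκ e]
    congr 1
    refine setIntegral_congr_fun measurableSet_Ioo fun r hr => ?_
    simp only [hFdef, Set.indicator_of_mem hr]
    ring
  have hgap : ∀ r ∈ Set.Ioo (0 : ℝ) 1, 1 - W r = gap N F μ r := fun r hr => by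
    rw [hpot r hr, gap]
  have hFeq : ∀ r ∈ Set.Ioo (0 : ℝ) 1, F r = r ^ (N - 1) * (1 / gap N F μ r ^ 2) := fun r hr => by
    rw [← hgap r hr]
    exact Set.indicator_of_mem hr _
  have hpos : ∀ r > 0, 0 < gap N F μ r := fun r hr => gap_pos hFi hF0 hμ hFeq hr
  have hw : ∀ x ∈ B N, x ≠ 0 → w x = 1 - gap N F μ ‖x‖ := by
    intro x hx hx0
    rw [hwW x hx, ← hgap _ ⟨norm_pos_iff.2 hx0, mem_ball_zero_iff.1 hx⟩]
    ring
  have hK : 0 < nonlocalFactor (B N) w := by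
    have : 0 ≤ ∫ x in B N, 1 / (1 - w x) := by
      refine integral_nonneg_of_ae (ae_B_ne_zero hN fun x hx hx0 => ?_)
      have h1 := hpos ‖x‖ (norm_pos_iff.2 hx0)
      simp only [Pi.zero_apply, hw x hx hx0, sub_sub_cancel]
      positivity
    unfold nonlocalFactor
    linarith
  have hμ' := hμK hK.ne'
  refine ⟨μ, F, ?_, hFi, hF0, hpos, hFeq, hw, ?_⟩
  · rw [hμ']
    positivity
  · rw [hμ']
    field_simp

/-! ### Criteria for classical solutions -/

/-- A continuous solution of the radial integral equation is a classical solution: the regularity at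
the origin is that of the radial Poisson equation. -/
theorem mem_classicalSpectrum_of_radialPrimitive {N : ℕ} (hN : 1 ≤ N) {g : ℝ → ℝ}
    (hg : Continuous g) (h0 : ∀ r, 0 ≤ g r) {lam μ : ℝ} (hlam : 0 < lam)
    (hlt : ∀ r ∈ Set.Icc (0 : ℝ) 1, radialPrimitive N g 0 1 - radialPrimitive N g 0 r < 1)
    (heq : ∀ r ∈ Set.Ico (0 : ℝ) 1,
      g r = μ / (1 - (radialPrimitive N g 0 1 - radialPrimitive N g 0 r)) ^ 2)
    (hK : lam = μ * nonlocalFactor (B N)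
      (fun x => radialPrimitive N g 0 1 - radialPrimitive N g 0 ‖x‖) ^ 2) :
    lam ∈ classicalSpectrum N := by
  set w : E N → ℝ := fun x => radialPrimitive N g 0 1 - radialPrimitive N g 0 ‖x‖ with hw
  have hmono := radialPrimitive_mono (N := N) hg h0 0
  refine ⟨hlam, w, ⟨isC2C0_radialPrimitive hN hg, fun x hx => ?_, fun x hx => ?_⟩,
    fun x hx y hy hxy => ?_⟩
  · rw [closure_B, mem_closedBall_zero_iff] at hx
    exact ⟨sub_nonneg.2 (hmono (norm_nonneg x) (Set.mem_Ici.2 zero_le_one) hx),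
      hlt _ ⟨norm_nonneg x, hx⟩⟩
  · have hx' : ‖x‖ ∈ Set.Ico (0 : ℝ) 1 := ⟨norm_nonneg x, mem_ball_zero_iff.1 hx⟩
    have h1 : (Δ w) x = - g ‖x‖ := laplacian_const_sub_radialPrimitive hN hg _ x
    have hK0 : nonlocalFactor (B N) w ≠ 0 := by
      intro h
      rw [h] at hK
      simp only [ne_eq, OfNat.ofNat_ne_zero, not_false_eq_true, zero_pow, mul_zero] at hK
      exact hlam.ne' hK
    rw [residual_eq, h1, heq _ hx', hK, mul_div_cancel_right₀ _ (pow_ne_zero 2 hK0)]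
    simp only [hw]
    ring
  · exact sub_le_sub_left (hmono (norm_nonneg x) (norm_nonneg y) hxy) _

theorem radialPrimitive_const_mul {N : ℕ} (g : ℝ → ℝ) (c r : ℝ) :
    radialPrimitive N (fun s => c * g s) 0 r = c * radialPrimitive N g 0 r := by
  have h : ∀ s, radialMean N (fun s => c * g s) s = c * radialMean N g s := by
    intro s
    simp only [radialMean]
    rw [← intervalIntegral.integral_const_mul]
    refine intervalIntegral.integral_congr fun τ _ => ?_
    ring
  simp only [radialPrimitive, h, zero_add]
  rw [← intervalIntegral.integral_const_mul]
  refine intervalIntegral.integral_congr fun s _ => ?_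
  ring

/-- If the gap stays away from zero, it extends continuously to the origin and the solution is
classical. -/
theorem mem_classicalSpectrum_of_gap_ge {N : ℕ} (hN : 1 ≤ N) {lam μ δ : ℝ} {F : ℝ → ℝ}
    {w : E N → ℝ} (hlam : 0 < lam) (hμ : 0 < μ) (hF : Integrable F) (h0 : ∀ r, 0 ≤ F r)
    (heq : ∀ r ∈ Set.Ioo (0 : ℝ) 1, F r = r ^ (N - 1) * (1 / gap N F μ r ^ 2))
    (hw : ∀ x ∈ B N, x ≠ 0 → w x = 1 - gap N F μ ‖x‖)
    (hK : lam = μ * nonlocalFactor (B N) w ^ 2) (hδ : 0 < δ) (hge : ∀ r > 0, δ ≤ gap N F μ r) :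
    lam ∈ classicalSpectrum N := by
  have hmono := monotoneOn_gap (N := N) hF h0 hμ.le
  -- the limit of the gap at the origin and the continuous extension of the right-hand side
  obtain ⟨V₀, hV₀⟩ : ∃ V₀, Tendsto (gap N F μ) (𝓝[>] 0) (𝓝 V₀) :=
    ⟨_, hmono.tendsto_nhdsGT ⟨δ, by rintro _ ⟨r, hr, rfl⟩; exact hge r hr⟩⟩
  have hV₀δ : δ ≤ V₀ := ge_of_tendsto hV₀ (eventually_mem_nhdsWithin.mono hge)
  set V : ℝ → ℝ := fun r => if r ≤ 0 then V₀ else gap N F μ r with hV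
  have hVpos : ∀ r > 0, V r = gap N F μ r := fun r hr => if_neg (not_le.2 hr)
  have hVge : ∀ r, δ ≤ V r := fun r => by
    rcases le_or_gt r 0 with h | h
    · simpa [hV, h] using hV₀δ
    · rw [hVpos r h]
      exact hge r h
  have hVc : Continuous V := by
    refine continuous_iff_continuousAt.2 fun r => ?_
    rcases lt_trichotomy r 0 with h | h | h
    · refine continuousAt_const.congr (f := fun _ => V₀) ?_
      filter_upwards [gt_mem_nhds h] with s hs
      exact (if_pos (le_of_lt hs)).symm
    · subst h
      have e0 : V 0 = V₀ := if_pos le_rfl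
      refine continuousAt_iff_continuous_left_right.2
        ⟨?_, continuousWithinAt_Ioi_iff_Ici.1 ?_⟩
      · rw [ContinuousWithinAt, e0]
        refine tendsto_const_nhds.congr' ?_
        filter_upwards [self_mem_nhdsWithin] with s hs
        exact (if_pos hs).symm
      · rw [ContinuousWithinAt, e0]
        refine hV₀.congr' ?_
        filter_upwards [self_mem_nhdsWithin] with s hs
        exact (hVpos s hs).symm
    · refine ((hasDerivAt_gap (N := N) hF μ h).continuousAt).congr ?_
      filter_upwards [lt_mem_nhds h] with s hs
      exact (hVpos s hs).symm
  set g : ℝ → ℝ := fun r => 1 / V r ^ 2 with hgdef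
  have hg : Continuous g :=
    continuous_const.div (hVc.pow 2) fun r => pow_ne_zero 2 (hδ.trans_le (hVge r)).ne'
  have hg0 : ∀ r, 0 ≤ g r := fun r => by
    simp only [hgdef]
    positivity
  have hmass : ∀ s ∈ Set.Ioo (0 : ℝ) 1, mass F s / s ^ (N - 1) = s * radialMean N g s := by
    intro s hs
    have h1 : mass F s = s ^ N * radialMean N g s := by
      rw [pow_mul_radialMean hN, mass, intervalIntegral.integral_of_le hs.1.le,
        intervalIntegral.integral_of_le hs.1.le]
      refine setIntegral_congr_fun measurableSet_Ioc fun t ht => ?_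
      simp only [hgdef]
      rw [heq t ⟨ht.1, ht.2.trans_lt hs.2⟩, hVpos t ht.1]
    have hpow : s ^ N = s ^ (N - 1) * s := by rw [← pow_succ, Nat.sub_add_cancel hN]
    have hs0 := hs.1.ne'
    rw [h1, hpow]
    field_simp
  have hk : Continuous fun s => s * radialMean N g s :=
    continuous_id.mul (continuous_radialMean hg)
  have hpot : ∀ r ∈ Set.Ioc (0 : ℝ) 1,
      potential N F r = radialPrimitive N g 0 1 - radialPrimitive N g 0 r := by
    intro r hr
    simp only [radialPrimitive, zero_add]
    rw [intervalIntegral.integral_interval_sub_left (hk.intervalIntegrable _ _)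
      (hk.intervalIntegrable _ _), potential, intervalIntegral.integral_of_le hr.2,
      intervalIntegral.integral_of_le hr.2, integral_Ioc_eq_integral_Ioo,
      integral_Ioc_eq_integral_Ioo]
    exact setIntegral_congr_fun measurableSet_Ioo fun s hs => hmass s ⟨hr.1.trans hs.1, hs.2⟩
  have hU : Continuous (radialPrimitive N g 0) := continuous_iff_continuousAt.2 fun r =>
    (hasDerivAt_radialPrimitive hg 0 r).continuousAt
  have hVU : ∀ r ∈ Set.Icc (0 : ℝ) 1,
      1 - μ * (radialPrimitive N g 0 1 - radialPrimitive N g 0 r) = V r := by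
    intro r hr
    rcases hr.1.eq_or_lt with h | h
    · subst h
      refine tendsto_nhds_unique (l := 𝓝[>] (0 : ℝ))
        (f := fun r => 1 - μ * (radialPrimitive N g 0 1 - radialPrimitive N g 0 r)) ?_
        (hVc.continuousAt.tendsto.mono_left nhdsWithin_le_nhds |>.congr' ?_)
      · exact ((by fun_prop : Continuous fun r =>
          1 - μ * (radialPrimitive N g 0 1 - radialPrimitive N g 0 r)).tendsto 0).mono_left
          nhdsWithin_le_nhds
      · filter_upwards [Ioo_mem_nhdsGT (zero_lt_one' ℝ)] with s hs
        rw [hVpos s hs.1, gap, hpot s ⟨hs.1, hs.2.le⟩]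
    · rw [hVpos r h, gap, hpot r ⟨h, hr.2⟩]
  refine mem_classicalSpectrum_of_radialPrimitive hN (g := fun r => μ * g r) (μ := μ)
    (continuous_const.mul hg) (fun r => mul_nonneg hμ.le (hg0 r)) hlam ?_ ?_ ?_
  · intro r hr
    simp only [radialPrimitive_const_mul, ← mul_sub]
    have := hVU r hr
    linarith [hVge r]
  · intro r hr
    simp only [radialPrimitive_const_mul, ← mul_sub]
    rw [hVU r ⟨hr.1, hr.2.le⟩]
    simp only [hgdef]
    ring
  · rw [hK]
    congr 2
    unfold nonlocalFactor
    congr 1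
    refine integral_congr_ae (ae_B_ne_zero hN fun x hx hx0 => ?_)
    have h1 := norm_pos_iff.2 hx0
    have h2 := mem_ball_zero_iff.1 hx
    simp only [radialPrimitive_const_mul, ← mul_sub]
    rw [hVU _ ⟨h1.le, h2.le⟩, hw x hx hx0, hVpos _ h1, sub_sub_cancel]

/-! ### A damped oscillator and its Lyapunov function -/

/-- A Lyapunov function of the damped oscillator `v'' + a v' + b v = b v₀³ / v²` at the equilibrium
`v₀`, as a function of the position `v` and the velocity `q`. The cross term `q (v - v₀)` makes its
decay exponential. -/
noncomputable def energy (a b v₀ v q : ℝ) : ℝ :=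
  q ^ 2 / 2 + a / 2 * (q * (v - v₀)) + a ^ 2 / 4 * (v - v₀) ^ 2 +
    (b / 2 * (v ^ 2 - v₀ ^ 2) + b * v₀ ^ 3 / v - b * v₀ ^ 2)

theorem le_energy {a b v₀ v : ℝ} (hb : 0 < b) (hv₀ : 0 < v₀) (hv : 0 < v) (q : ℝ) :
    b / 2 * (v - v₀) ^ 2 ≤ energy a b v₀ v q := by
  have h : energy a b v₀ v q = b / 2 * (v - v₀) ^ 2 +
      ((q + a / 2 * (v - v₀)) ^ 2 / 4 + q ^ 2 / 4 + a / 4 * (q * (v - v₀)) +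
        3 * a ^ 2 / 16 * (v - v₀) ^ 2 + b * v₀ * (v - v₀) ^ 2 / v) := by
    unfold energy
    field_simp
    ring
  have h1 : q ^ 2 / 4 + a / 4 * (q * (v - v₀)) + 3 * a ^ 2 / 16 * (v - v₀) ^ 2 =
      (q / 2 + a / 4 * (v - v₀)) ^ 2 + (a * (v - v₀)) ^ 2 / 8 := by ring
  have h2 : 0 ≤ b * v₀ * (v - v₀) ^ 2 / v := by positivity
  rw [h]
  nlinarith [sq_nonneg (q + a / 2 * (v - v₀)), sq_nonneg (q / 2 + a / 4 * (v - v₀)),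
    sq_nonneg (a * (v - v₀))]

/-- The dissipation of the energy controls the energy: the restoring force `b v - b v₀³ / v²` is
monotone in `v`, with slope at least `b`. -/
theorem energy_le {a b v₀ v : ℝ} (hb : 0 < b) (hv₀ : 0 < v₀) (hv : 0 < v) (q : ℝ) :
    energy a b v₀ v q ≤
      (1 + a ^ 2 / (2 * b)) * (q ^ 2 + (v - v₀) * (b * v - b * v₀ ^ 3 / v ^ 2)) := by
  set W := v - v₀ with hW
  have e1 : W * (b * v - b * v₀ ^ 3 / v ^ 2) =
      b * W ^ 2 + b * W ^ 2 * (v * v₀ + v₀ ^ 2) / v ^ 2 := by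
    rw [hW]
    field_simp
    ring
  have e2 : energy a b v₀ v q = q ^ 2 / 2 + a / 2 * (q * W) + a ^ 2 / 4 * W ^ 2 +
      (W * (b * v - b * v₀ ^ 3 / v ^ 2) - b * W ^ 2 * (v ^ 2 + 2 * v₀ ^ 2) / (2 * v ^ 2)) := by
    unfold energy
    rw [hW]
    field_simp
    ring
  have h1 : 0 ≤ b * W ^ 2 * (v * v₀ + v₀ ^ 2) / v ^ 2 := by positivity
  have h2 : 0 ≤ b * W ^ 2 * (v ^ 2 + 2 * v₀ ^ 2) / (2 * v ^ 2) := by positivity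
  have h3 : b * W ^ 2 ≤ W * (b * v - b * v₀ ^ 3 / v ^ 2) := by linarith
  have h4 : a ^ 2 / (2 * b) * (b * W ^ 2) ≤
      a ^ 2 / (2 * b) * (W * (b * v - b * v₀ ^ 3 / v ^ 2)) :=
    mul_le_mul_of_nonneg_left h3 (by positivity)
  have h5 : a ^ 2 / (2 * b) * (b * W ^ 2) = a ^ 2 / 2 * W ^ 2 := by
    field_simp
  have h6 : 0 ≤ a ^ 2 / (2 * b) * q ^ 2 := by positivity
  rw [e2]
  nlinarith [sq_nonneg (q / 2 - a / 2 * W)]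

theorem hasDerivAt_energy {a b v₀ : ℝ} {v q : ℝ → ℝ} {t : ℝ} (hv : 0 < v t)
    (h1 : HasDerivAt v (q t) t)
    (h2 : HasDerivAt q (-a * q t - b * v t + b * v₀ ^ 3 / v t ^ 2) t) :
    HasDerivAt (fun t => energy a b v₀ (v t) (q t))
      (-(a / 2) * (q t ^ 2 + (v t - v₀) * (b * v t - b * v₀ ^ 3 / v t ^ 2))) t := by
  have hW := h1.sub_const v₀
  have h := ((((h2.pow 2).div_const 2).add ((h2.mul hW).const_mul (a / 2))).add
    ((hW.pow 2).const_mul (a ^ 2 / 4))).add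
    (((((h1.pow 2).sub_const (v₀ ^ 2)).const_mul (b / 2)).add
      ((h1.inv hv.ne').const_mul (b * v₀ ^ 3))).sub_const (b * v₀ ^ 2))
  refine (h.congr_deriv ?_).congr_of_eventuallyEq (Eventually.of_forall fun s => ?_)
  · field_simp
    ring
  · simp [energy, div_eq_mul_inv]

/-- The energy decays exponentially. -/
theorem antitoneOn_exp_mul_energy {a b v₀ : ℝ} {v q : ℝ → ℝ} {s : Set ℝ} (ha : 0 < a) (hb : 0 < b)
    (hv₀ : 0 < v₀) (hs : Convex ℝ s) (hv : ∀ t ∈ s, 0 < v t) (h1 : ∀ t ∈ s, HasDerivAt v (q t) t)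
    (h2 : ∀ t ∈ s, HasDerivAt q (-a * q t - b * v t + b * v₀ ^ 3 / v t ^ 2) t) :
    AntitoneOn (fun t => Real.exp (a / 2 / (1 + a ^ 2 / (2 * b)) * t) *
      energy a b v₀ (v t) (q t)) s := by
  set c := a / 2 / (1 + a ^ 2 / (2 * b)) with hc
  have hd : ∀ t ∈ s, HasDerivAt (fun t => Real.exp (c * t) * energy a b v₀ (v t) (q t))
      (Real.exp (c * t) * (c * 1) * energy a b v₀ (v t) (q t) + Real.exp (c * t) *
        (-(a / 2) * (q t ^ 2 + (v t - v₀) * (b * v t - b * v₀ ^ 3 / v t ^ 2)))) t :=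
    fun t ht => (((hasDerivAt_id t).const_mul c).exp).mul
      (hasDerivAt_energy (hv t ht) (h1 t ht) (h2 t ht))
  refine antitoneOn_of_hasDerivWithinAt_nonpos hs
    (fun t ht => (hd t ht).continuousAt.continuousWithinAt)
    (fun t ht => (hd t (interior_subset ht)).hasDerivWithinAt) fun t ht => ?_
  have h := mul_le_mul_of_nonneg_left
    (energy_le (a := a) hb hv₀ (hv t (interior_subset ht)) (q t)) (by positivity : 0 ≤ c)
  have hc1 : c * (1 + a ^ 2 / (2 * b)) = a / 2 := div_mul_cancel₀ _ (by positivity)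
  rw [← mul_assoc, hc1] at h
  nlinarith [mul_le_mul_of_nonneg_left h (Real.exp_pos (c * t)).le]

/-- The only solution with bounded energy on a negative half-line is the equilibrium. -/
theorem eq_of_energy_bounded {a b v₀ M : ℝ} {v q : ℝ → ℝ} (ha : 0 < a) (hb : 0 < b) (hv₀ : 0 < v₀)
    (hv : ∀ t < 0, 0 < v t) (h1 : ∀ t < 0, HasDerivAt v (q t) t)
    (h2 : ∀ t < 0, HasDerivAt q (-a * q t - b * v t + b * v₀ ^ 3 / v t ^ 2) t)
    (hM : ∀ t < 0, energy a b v₀ (v t) (q t) ≤ M) {t : ℝ} (ht : t < 0) : v t = v₀ := by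
  have hanti := antitoneOn_exp_mul_energy ha hb hv₀ (convex_Iio 0) hv h1 h2
  set c := a / 2 / (1 + a ^ 2 / (2 * b)) with hc
  have hc0 : 0 < c := by positivity
  have hlim : Tendsto (fun s => Real.exp (c * s) * M) atBot (𝓝 (0 * M)) :=
    (Real.tendsto_exp_atBot.comp (tendsto_id.const_mul_atBot hc0)).mul_const M
  have h3 : Real.exp (c * t) * energy a b v₀ (v t) (q t) ≤ 0 * M := by
    refine ge_of_tendsto hlim ?_
    filter_upwards [eventually_le_atBot t] with s hs
    exact (hanti (Set.mem_Iio.2 (hs.trans_lt ht)) ht hs).trans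
      (mul_le_mul_of_nonneg_left (hM s (hs.trans_lt ht)) (Real.exp_pos _).le)
  have h4 : energy a b v₀ (v t) (q t) ≤ 0 := by
    by_contra! h
    have := mul_pos (Real.exp_pos (c * t)) h
    linarith
  have h5 := le_energy (a := a) hb hv₀ (hv t ht) (q t)
  have h6 : (v t - v₀) ^ 2 = 0 := le_antisymm (by nlinarith) (sq_nonneg _)
  exact sub_eq_zero.1 (pow_eq_zero_iff two_ne_zero |>.1 h6)

/-- Every global solution converges to the equilibrium. -/
theorem tendsto_equilibrium {a b v₀ : ℝ} {v q : ℝ → ℝ} (ha : 0 < a) (hb : 0 < b) (hv₀ : 0 < v₀)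
    (hv : ∀ t, 0 < v t) (h1 : ∀ t, HasDerivAt v (q t) t)
    (h2 : ∀ t, HasDerivAt q (-a * q t - b * v t + b * v₀ ^ 3 / v t ^ 2) t) :
    Tendsto v atTop (𝓝 v₀) := by
  have hanti := antitoneOn_exp_mul_energy ha hb hv₀ convex_univ (fun t _ => hv t)
    (fun t _ => h1 t) (fun t _ => h2 t)
  set c := a / 2 / (1 + a ^ 2 / (2 * b)) with hc
  have hc0 : 0 < c := by positivity
  set A := energy a b v₀ (v 0) (q 0) with hA
  have hlim : Tendsto (fun t => Real.sqrt (2 / b * (Real.exp (-(c * t)) * A))) atTop (𝓝 0) := by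
    have h := ((Real.tendsto_exp_neg_atTop_nhds_zero.comp
      (tendsto_id.const_mul_atTop hc0)).mul_const A).const_mul (2 / b)
    have h' := (Real.continuous_sqrt.tendsto _).comp h
    simpa [Function.comp_def] using h'
  refine tendsto_iff_norm_sub_tendsto_zero.2
    (squeeze_zero' (Eventually.of_forall fun _ => norm_nonneg _) ?_ hlim)
  filter_upwards [eventually_ge_atTop 0] with t ht
  have h3 : Real.exp (c * t) * energy a b v₀ (v t) (q t) ≤ A := by
    simpa using hanti (Set.mem_univ 0) (Set.mem_univ t) ht
  have h4 : energy a b v₀ (v t) (q t) ≤ Real.exp (-(c * t)) * A := by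
    have h := mul_le_mul_of_nonneg_left h3 (Real.exp_pos (-(c * t))).le
    rwa [← mul_assoc, ← Real.exp_add, neg_add_cancel, Real.exp_zero, one_mul] at h
  have h5 := (le_energy (a := a) hb hv₀ (hv t) (q t)).trans h4
  refine Real.le_sqrt_of_sq_le ?_
  rw [Real.norm_eq_abs, sq_abs]
  have h6 := mul_le_mul_of_nonneg_left h5 (by positivity : 0 ≤ 2 / b)
  rwa [← mul_assoc, show 2 / b * (b / 2) = 1 by field_simp, one_mul] at h6

/-! ### The Emden–Fowler variables -/

/-- The Emden–Fowler variable `v(t) = r^{-2/3} V(r)`, `r = e^t`, in which the radial equation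
becomes autonomous. -/
noncomputable def emdenPosition (V : ℝ → ℝ) (t : ℝ) : ℝ :=
  V (Real.exp t) / Real.exp (t / 3) ^ 2

/-- The velocity `v'(t)` of the Emden–Fowler variable, written with `P = V'`. -/
noncomputable def emdenVelocity (V P : ℝ → ℝ) (t : ℝ) : ℝ :=
  Real.exp (t / 3) * P (Real.exp t) - 2 / 3 * emdenPosition V t

theorem exp_eq_cube (t : ℝ) : Real.exp t = Real.exp (t / 3) ^ 3 := by
  rw [← Real.exp_nat_mul]
  congr 1
  push_cast
  ring

theorem hasDerivAt_exp_third (t : ℝ) :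
    HasDerivAt (fun t => Real.exp (t / 3)) (Real.exp (t / 3) / 3) t :=
  (((hasDerivAt_id t).div_const 3).exp).congr_deriv (by simp only [id]; ring)

theorem hasDerivAt_emdenPosition {V P : ℝ → ℝ} {t : ℝ}
    (hV : HasDerivAt V (P (Real.exp t)) (Real.exp t)) :
    HasDerivAt (emdenPosition V) (emdenVelocity V P t) t := by
  have hx : Real.exp (t / 3) ≠ 0 := (Real.exp_pos _).ne'
  have h := (hV.comp t (Real.hasDerivAt_exp t)).div ((hasDerivAt_exp_third t).pow 2)
    (pow_ne_zero 2 hx)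
  refine h.congr_deriv ?_
  simp only [emdenVelocity, emdenPosition, Function.comp_apply, Pi.pow_apply]
  rw [exp_eq_cube t]
  field_simp
  ring

theorem hasDerivAt_emdenVelocity {V P : ℝ → ℝ} {t μ n : ℝ} (hV0 : 0 < V (Real.exp t))
    (hV : HasDerivAt V (P (Real.exp t)) (Real.exp t))
    (hP : HasDerivAt P (μ / V (Real.exp t) ^ 2 - (n - 1) * P (Real.exp t) / Real.exp t)
      (Real.exp t)) :
    HasDerivAt (emdenVelocity V P) (-(n - 2 / 3) * emdenVelocity V P t -
      2 / 3 * (n - 4 / 3) * emdenPosition V t + μ / emdenPosition V t ^ 2) t := by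
  have hx : Real.exp (t / 3) ≠ 0 := (Real.exp_pos _).ne'
  have h := ((hasDerivAt_exp_third t).mul (hP.comp t (Real.hasDerivAt_exp t))).sub
    ((hasDerivAt_emdenPosition hV).const_mul (2 / 3))
  refine h.congr_deriv ?_
  simp only [emdenVelocity, emdenPosition, Function.comp_apply]
  have hV0' := hV0.ne'
  rw [exp_eq_cube t] at hV0' ⊢
  field_simp
  ring

theorem emdenPosition_pos {V : ℝ → ℝ} {t : ℝ} (h : 0 < V (Real.exp t)) : 0 < emdenPosition V t := by
  unfold emdenPosition
  positivity

/-- A lower bound of order `r ^ (2 / 3)` for the solutions of `P = V' ≥ 2 κ r / (3 V ^ 2)`. -/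
theorem mul_sq_le_cube {V P : ℝ → ℝ} {κ R : ℝ} (hV : ∀ r ∈ Set.Ioo 0 R, HasDerivAt V (P r) r)
    (hpos : ∀ r ∈ Set.Ioo 0 R, 0 < V r)
    (hP : ∀ r ∈ Set.Ioo 0 R, 2 / 3 * κ * r ≤ V r ^ 2 * P r) {r : ℝ} (hr : r ∈ Set.Ioo 0 R) :
    κ * r ^ 2 ≤ V r ^ 3 := by
  have hd : ∀ r ∈ Set.Ioo 0 R, HasDerivAt (fun r => V r ^ 3 - κ * r ^ 2)
      (3 * V r ^ 2 * P r - κ * (2 * r)) r := fun r hr =>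
    (((hV r hr).pow 3).sub (((hasDerivAt_id r).pow 2).const_mul κ)).congr_deriv (by simp)
  have hmono : MonotoneOn (fun r => V r ^ 3 - κ * r ^ 2) (Set.Ioo 0 R) :=
    monotoneOn_of_hasDerivWithinAt_nonneg (convex_Ioo 0 R)
      (fun t ht => (hd t ht).continuousAt.continuousWithinAt)
      (fun t ht => (hd t (interior_subset ht)).hasDerivWithinAt) fun t ht => by
        have := hP t (interior_subset ht)
        linarith
  have hlim : Tendsto (fun s : ℝ => -(κ * s ^ 2)) (𝓝[>] 0) (𝓝 (-(κ * 0 ^ 2))) :=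
    ((by fun_prop : Continuous fun s : ℝ => -(κ * s ^ 2)).tendsto 0).mono_left nhdsWithin_le_nhds
  have h := le_of_tendsto hlim (b := V r ^ 3 - κ * r ^ 2) (by
    filter_upwards [Ioo_mem_nhdsGT hr.1] with s hs
    have hs' : s ∈ Set.Ioo 0 R := ⟨hs.1, hs.2.trans hr.2⟩
    have h1 := hmono hs' hr hs.2.le
    have h2 : 0 < V s ^ 3 := pow_pos (hpos s hs') 3
    simp only at h1
    linarith)
  simp only [ne_eq, OfNat.ofNat_ne_zero, not_false_eq_true, zero_pow, mul_zero, neg_zero] at h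
  linarith

section Gap

variable {N : ℕ} {F : ℝ → ℝ} {μ : ℝ}

theorem hasDerivAt_mass_of_gap (hF : Integrable F) (hpos : ∀ r > 0, 0 < gap N F μ r)
    (heq : ∀ r ∈ Set.Ioo (0 : ℝ) 1, F r = r ^ (N - 1) * (1 / gap N F μ r ^ 2)) {r : ℝ}
    (hr : r ∈ Set.Ioo (0 : ℝ) 1) : HasDerivAt (mass F) (F r) r := by
  have hc : ContinuousAt F r := by
    have h : ContinuousAt (fun r => r ^ (N - 1) * (1 / gap N F μ r ^ 2)) r :=
      (continuousAt_id.pow _).mul (continuousAt_const.div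
        ((hasDerivAt_gap hF μ hr.1).continuousAt.pow 2) (pow_ne_zero 2 (hpos r hr.1).ne'))
    refine h.congr ?_
    filter_upwards [Ioo_mem_nhds hr.1 hr.2] with s hs
    exact (heq s hs).symm
  exact intervalIntegral.integral_hasDerivAt_right hF.intervalIntegrable
    (hF.aestronglyMeasurable.stronglyMeasurableAtFilter) hc

/-- The radial equation `P' = μ / V² - (N - 1) P / r` for the slope `P` of the gap `V`. -/
theorem hasDerivAt_slope (hF : Integrable F) (hN : 1 ≤ N)
    (hpos : ∀ r > 0, 0 < gap N F μ r)
    (heq : ∀ r ∈ Set.Ioo (0 : ℝ) 1, F r = r ^ (N - 1) * (1 / gap N F μ r ^ 2)) {r : ℝ}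
    (hr : r ∈ Set.Ioo (0 : ℝ) 1) :
    HasDerivAt (fun r => μ * (mass F r / r ^ (N - 1)))
      (μ / gap N F μ r ^ 2 - ((N : ℝ) - 1) * (μ * (mass F r / r ^ (N - 1))) / r) r := by
  have hr0 := hr.1.ne'
  have hV := (hpos r hr.1).ne'
  have h := (((hasDerivAt_mass_of_gap hF hpos heq hr).div (hasDerivAt_pow (N - 1) r)
    (pow_ne_zero _ hr0))).const_mul μ
  refine h.congr_deriv ?_
  rw [heq r hr]
  obtain ⟨n, rfl⟩ : ∃ n, N = n + 1 := ⟨N - 1, by omega⟩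
  rcases n with _ | n
  · simp
    field_simp
  · simp only [Nat.add_sub_cancel, Nat.cast_add, Nat.cast_one]
    field_simp
    ring

/-- As the gap is nondecreasing, the density `1 / gap ^ 2` on the ball of radius `r` is at least its
value at the radius `r`. -/
theorem mul_le_sq_mul_slope (hF : Integrable F) (h0 : ∀ r, 0 ≤ F r) (hN : 1 ≤ N) (hμ : 0 < μ)
    (hpos : ∀ r > 0, 0 < gap N F μ r)
    (heq : ∀ r ∈ Set.Ioo (0 : ℝ) 1, F r = r ^ (N - 1) * (1 / gap N F μ r ^ 2)) {r : ℝ}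
    (hr : r ∈ Set.Ioo (0 : ℝ) 1) :
    μ * r / N ≤ gap N F μ r ^ 2 * (μ * (mass F r / r ^ (N - 1))) := by
  have hmono := monotoneOn_gap (N := N) hF h0 hμ.le
  have hN0 : (0 : ℝ) < N := by exact_mod_cast hN
  have h1 : ∫ t in (0 : ℝ)..r, t ^ (N - 1) * (1 / gap N F μ r ^ 2) ≤ mass F r := by
    refine intervalIntegral.integral_mono_on_of_le_Ioo hr.1.le
      (Continuous.intervalIntegrable (by fun_prop) _ _) hF.intervalIntegrable fun t ht => ?_
    rw [heq t ⟨ht.1, ht.2.trans hr.2⟩]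
    have h2 := hpos t ht.1
    have h3 := hmono ht.1 hr.1 ht.2.le
    have ht0 := ht.1.le
    gcongr
  rw [intervalIntegral.integral_mul_const, integral_pow, Nat.sub_add_cancel hN,
    Nat.cast_sub hN, Nat.cast_one, sub_add_cancel, zero_pow (by omega), sub_zero] at h1
  have h2 := hpos r hr.1
  have hr0 := hr.1
  have hp : r ^ N = r ^ (N - 1) * r := by rw [← pow_succ, Nat.sub_add_cancel hN]
  calc μ * r / N = gap N F μ r ^ 2 * (μ * (r ^ N / N * (1 / gap N F μ r ^ 2) / r ^ (N - 1))) := by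
        rw [hp]
        field_simp
    _ ≤ _ := by gcongr

theorem mul_sq_le_gap_cube (hF : Integrable F) (h0 : ∀ r, 0 ≤ F r) (hN : 1 ≤ N) (hμ : 0 < μ)
    (hpos : ∀ r > 0, 0 < gap N F μ r)
    (heq : ∀ r ∈ Set.Ioo (0 : ℝ) 1, F r = r ^ (N - 1) * (1 / gap N F μ r ^ 2)) {r : ℝ}
    (hr : r ∈ Set.Ioo (0 : ℝ) 1) : 3 / 2 * (μ / N) * r ^ 2 ≤ gap N F μ r ^ 3 := by
  refine mul_sq_le_cube (P := fun r => μ * (mass F r / r ^ (N - 1))) (R := 1)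
    (fun r hr => hasDerivAt_gap hF μ hr.1) (fun r hr => hpos r hr.1) (fun r hr => ?_) hr
  refine le_trans (le_of_eq ?_) (mul_le_sq_mul_slope hF h0 hN hμ hpos heq hr)
  ring

end Gap

/-! ### Solutions that touch the singular value at the origin -/

theorem le_of_hasDerivAt_le {V P G G' : ℝ → ℝ} {R : ℝ}
    (hV : ∀ r ∈ Set.Ioo 0 R, HasDerivAt V (P r) r) (hG : ∀ r ∈ Set.Ioo 0 R, HasDerivAt G (G' r) r)
    (hle : ∀ r ∈ Set.Ioo 0 R, P r ≤ G' r) (hV0 : Tendsto V (𝓝[>] 0) (𝓝 0))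
    (hG0 : Tendsto G (𝓝[>] 0) (𝓝 0)) {r : ℝ} (hr : r ∈ Set.Ioo 0 R) : V r ≤ G r := by
  have hanti : AntitoneOn (fun r => V r - G r) (Set.Ioo 0 R) :=
    antitoneOn_of_hasDerivWithinAt_nonpos (convex_Ioo 0 R)
      (fun t ht => ((hV t ht).sub (hG t ht)).continuousAt.continuousWithinAt)
      (fun t ht => ((hV t (interior_subset ht)).sub (hG t (interior_subset ht))).hasDerivWithinAt)
      fun t ht => sub_nonpos.2 (hle t (interior_subset ht))
  have h := ge_of_tendsto (hV0.sub hG0) (b := V r - G r) (by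
    filter_upwards [Ioo_mem_nhdsGT hr.1] with s hs
    exact hanti ⟨hs.1, hs.2.trans hr.2⟩ hr hs.2.le)
  linarith

theorem cube_rpow {r : ℝ} (hr : 0 ≤ r) : (r ^ (2 / 3 : ℝ)) ^ 3 = r ^ 2 := by
  rw [← Real.rpow_natCast, ← Real.rpow_mul hr, ← Real.rpow_natCast]
  norm_num

theorem mul_rpow_le_of_cube {κ r x : ℝ} (hκ : 0 ≤ κ) (hr : 0 ≤ r) (hx : 0 ≤ x)
    (h : κ * r ^ 2 ≤ x ^ 3) : κ ^ (1 / 3 : ℝ) * r ^ (2 / 3 : ℝ) ≤ x := by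
  refine (pow_le_pow_iff_left₀ (by positivity) hx (three_ne_zero)).1 ?_
  rw [mul_pow, cube_rpow hr, ← Real.rpow_natCast, ← Real.rpow_mul hκ]
  norm_num
  exact h

theorem exp_third_sq (t : ℝ) : Real.exp (t / 3) ^ 2 = Real.exp t ^ (2 / 3 : ℝ) := by
  rw [← Real.exp_mul, ← Real.exp_nat_mul]
  congr 1
  push_cast
  ring

section Gap

variable {N : ℕ} {F : ℝ → ℝ} {μ : ℝ}

/-- In dimension one a gap vanishing at the origin is at most linear there, which is too small for
the density `1 / gap ^ 2` to be integrable. -/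
theorem two_le_of_tendsto_gap (hF : Integrable F) (h0 : ∀ r, 0 ≤ F r) (hN : 1 ≤ N) (hμ : 0 < μ)
    (hpos : ∀ r > 0, 0 < gap N F μ r)
    (heq : ∀ r ∈ Set.Ioo (0 : ℝ) 1, F r = r ^ (N - 1) * (1 / gap N F μ r ^ 2))
    (hlim : Tendsto (gap N F μ) (𝓝[>] 0) (𝓝 0)) : 2 ≤ N := by
  by_contra hN2
  obtain rfl : N = 1 := by omega
  set M : ℝ := ∫ t, F t with hM
  have hmass : ∀ r > 0, mass F r ≤ M := fun r hr => by
    rw [mass, intervalIntegral.integral_of_le hr.le]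
    exact setIntegral_le_integral hF (Eventually.of_forall h0)
  have hle : ∀ r ∈ Set.Ioo (0 : ℝ) 1, gap 1 F μ r ≤ μ * M * r := by
    intro r hr
    refine le_of_hasDerivAt_le (G' := fun _ => μ * M) (R := 1)
      (fun r hr => hasDerivAt_gap hF μ hr.1)
      (fun r _ => by simpa using (hasDerivAt_id r).const_mul (μ * M)) (fun r hr => ?_) hlim ?_ hr
    · simpa using mul_le_mul_of_nonneg_left (hmass r hr.1) hμ.le
    · have h := ((by fun_prop : Continuous fun r : ℝ => μ * M * r).tendsto 0).mono_left
        (nhdsWithin_le_nhds (s := Set.Ioi 0))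
      simpa using h
  have hD : 0 < μ * M := by
    have h1 := hle (1 / 2) (by norm_num)
    have h2 := hpos (1 / 2) (by norm_num)
    linarith
  refine not_integrable_of_sub_inv_le (F := F) (zero_lt_one' ℝ)
    (c := 1 / (μ * M) ^ 2) (by positivity) (fun r hr => ?_) hF
  rw [heq r hr, sub_zero, Nat.sub_self, pow_zero, one_mul]
  have h1 := hle r hr
  have h2 := hpos r hr.1
  have hr0 := hr.1
  calc 1 / (μ * M) ^ 2 * r⁻¹ = r / (μ * M * r) ^ 2 := by field_simp
    _ ≤ 1 / (μ * M * r) ^ 2 := by gcongr; exact hr.2.le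
    _ ≤ 1 / gap 1 F μ r ^ 2 := by gcongr

/-- A gap vanishing at the origin is the explicit power solution: its growth is exactly of order
`r ^ (2 / 3)`, so that the energy of the Emden–Fowler variable stays bounded as `t → -∞`. -/
theorem eq_rpow_of_tendsto_gap (hF : Integrable F) (h0 : ∀ r, 0 ≤ F r) (hN : 2 ≤ N) (hμ : 0 < μ)
    (hpos : ∀ r > 0, 0 < gap N F μ r)
    (heq : ∀ r ∈ Set.Ioo (0 : ℝ) 1, F r = r ^ (N - 1) * (1 / gap N F μ r ^ 2))
    (hlim : Tendsto (gap N F μ) (𝓝[>] 0) (𝓝 0)) :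
    μ = 2 / 3 * ((N : ℝ) - 4 / 3) ∧ ∀ r ∈ Set.Ioo (0 : ℝ) 1, gap N F μ r = r ^ (2 / 3 : ℝ) := by
  have hN1 : 1 ≤ N := by omega
  have hN2 : (2 : ℝ) ≤ N := by exact_mod_cast hN
  set d : ℝ := (3 / 2 * (μ / N)) ^ (1 / 3 : ℝ) with hd
  have hd0 : 0 < d := by positivity
  have hlow : ∀ r ∈ Set.Ioo (0 : ℝ) 1, d * r ^ (2 / 3 : ℝ) ≤ gap N F μ r := fun r hr =>
    mul_rpow_le_of_cube (by positivity) hr.1.le (hpos r hr.1).le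
      (mul_sq_le_gap_cube hF h0 hN1 hμ hpos heq hr)
  set C : ℝ := μ / (d ^ 2 * (N - 4 / 3)) with hC
  have hb0 : (0 : ℝ) < N - 4 / 3 := by linarith
  have hC0 : 0 < C := by positivity
  have hmass : ∀ r ∈ Set.Ioo (0 : ℝ) 1,
      mass F r ≤ 1 / d ^ 2 * (r ^ ((N : ℝ) - 4 / 3) / (N - 4 / 3)) := by
    intro r hr
    have hint : ∫ t in (0 : ℝ)..r, 1 / d ^ 2 * t ^ ((N : ℝ) - 7 / 3) =
        1 / d ^ 2 * (r ^ ((N : ℝ) - 4 / 3) / (N - 4 / 3)) := by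
      rw [intervalIntegral.integral_const_mul, integral_rpow (Or.inl (by linarith)),
        show (N : ℝ) - 7 / 3 + 1 = N - 4 / 3 by ring, Real.zero_rpow hb0.ne', sub_zero]
    rw [← hint]
    refine intervalIntegral.integral_mono_on_of_le_Ioo hr.1.le hF.intervalIntegrable
      ((intervalIntegral.intervalIntegrable_rpow' (by linarith)).const_mul _) fun t ht => ?_
    have ht1 : t ∈ Set.Ioo (0 : ℝ) 1 := ⟨ht.1, ht.2.trans hr.2⟩
    have ht0 := ht.1
    have h1 := hlow t ht1
    rw [heq t ht1]
    calc t ^ (N - 1) * (1 / gap N F μ t ^ 2) ≤ t ^ (N - 1) * (1 / (d * t ^ (2 / 3 : ℝ)) ^ 2) := by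
          gcongr
      _ = 1 / d ^ 2 * t ^ ((N : ℝ) - 7 / 3) := by
          rw [mul_pow, ← Real.rpow_natCast (t ^ (2 / 3 : ℝ)), ← Real.rpow_mul ht0.le,
            ← Real.rpow_natCast t, Nat.cast_sub hN1,
            show (N : ℝ) - 7 / 3 = (N - (1 : ℕ)) - 2 / 3 * (2 : ℕ) by push_cast; ring,
            Real.rpow_sub ht0 _ (2 / 3 * ((2 : ℕ) : ℝ))]
          field_simp
  set P : ℝ → ℝ := fun r => μ * (mass F r / r ^ (N - 1)) with hP
  have hP0 : ∀ r ∈ Set.Ioo (0 : ℝ) 1, 0 ≤ P r := fun r hr =>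
    mul_nonneg hμ.le (div_nonneg (mass_nonneg h0 hr.1.le) (pow_nonneg hr.1.le _))
  have hPle : ∀ r ∈ Set.Ioo (0 : ℝ) 1, P r ≤ C * r ^ (-(1 / 3) : ℝ) := by
    intro r hr
    have hr0 := hr.1
    have h1 := hmass r hr
    calc P r ≤ μ * (1 / d ^ 2 * (r ^ ((N : ℝ) - 4 / 3) / (N - 4 / 3)) / r ^ (N - 1)) := by
          simp only [hP]
          gcongr
      _ = C * r ^ (-(1 / 3) : ℝ) := by
          rw [show (N : ℝ) - 4 / 3 = (N - (1 : ℕ)) + (-(1 / 3)) by push_cast; ring,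
            Real.rpow_add hr0, ← Nat.cast_sub hN1, Real.rpow_natCast, hC,
            show (N : ℝ) - 4 / 3 = (N - 1 : ℕ) + (-(1 / 3)) by
              rw [Nat.cast_sub hN1]; push_cast; ring]
          field_simp
  have hhigh : ∀ r ∈ Set.Ioo (0 : ℝ) 1, gap N F μ r ≤ 3 / 2 * C * r ^ (2 / 3 : ℝ) := by
    intro r hr
    refine le_of_hasDerivAt_le (P := P) (G := fun r => 3 / 2 * C * r ^ (2 / 3 : ℝ))
      (G' := fun r => C * r ^ (-(1 / 3) : ℝ)) (R := 1)
      (fun r hr => hasDerivAt_gap hF μ hr.1) (fun r hr => ?_) hPle hlim ?_ hr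
    · refine ((Real.hasDerivAt_rpow_const (p := 2 / 3) (Or.inl hr.1.ne')).const_mul
        (3 / 2 * C)).congr_deriv ?_
      norm_num
      ring
    · have h := (((Real.continuous_rpow_const (by norm_num : (0 : ℝ) ≤ 2 / 3)).const_mul
        (3 / 2 * C)).tendsto 0).mono_left (nhdsWithin_le_nhds (s := Set.Ioi 0))
      simpa using h
  have hexp : ∀ t < 0, Real.exp t ∈ Set.Ioo (0 : ℝ) 1 := fun t ht =>
    ⟨Real.exp_pos t, Real.exp_lt_one_iff.2 ht⟩
  set b : ℝ := 2 / 3 * ((N : ℝ) - 4 / 3) with hb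
  have hbpos : 0 < b := by positivity
  set v₀ : ℝ := (μ / b) ^ (1 / 3 : ℝ) with hv₀
  have hv₀pos : 0 < v₀ := by positivity
  have hμb : b * v₀ ^ 3 = μ := by
    rw [hv₀, ← Real.rpow_natCast, ← Real.rpow_mul (by positivity)]
    norm_num
    field_simp
  set V := gap N F μ with hV
  have hvmem : ∀ t < 0, emdenPosition V t ∈ Set.Icc d (3 / 2 * C) := by
    intro t ht
    have h1 := hlow _ (hexp t ht)
    have h2 := hhigh _ (hexp t ht)
    rw [← exp_third_sq] at h1 h2
    exact ⟨(le_div_iff₀ (by positivity)).2 h1, (div_le_iff₀ (by positivity)).2 h2⟩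
  have hqmem : ∀ t < 0, emdenVelocity V P t ∈ Set.Icc (-C) C := by
    intro t ht
    have h1 := hvmem t ht
    have h2 := mul_le_mul_of_nonneg_left (hPle _ (hexp t ht)) (Real.exp_pos (t / 3)).le
    have h3 := mul_nonneg (Real.exp_pos (t / 3)).le (hP0 _ (hexp t ht))
    have h4 : Real.exp (t / 3) * (C * Real.exp t ^ (-(1 / 3) : ℝ)) = C := by
      rw [← Real.exp_mul, mul_left_comm, ← Real.exp_add]
      ring_nf
      simp
    rw [h4] at h2
    unfold emdenVelocity
    constructor <;> linarith [h1.1, h1.2]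
  -- positions and velocities stay in a compact set, on which the energy is continuous
  obtain ⟨M, hM⟩ := ((isCompact_Icc (a := d) (b := 3 / 2 * C)).prod
    (isCompact_Icc (a := -C) (b := C))).exists_bound_of_continuousOn
    (f := fun p => energy ((N : ℝ) - 2 / 3) b v₀ p.1 p.2) (by
      unfold energy
      have h : ContinuousOn (fun p : ℝ × ℝ => b * v₀ ^ 3 / p.1)
          (Set.Icc d (3 / 2 * C) ×ˢ Set.Icc (-C) C) :=
        continuousOn_const.div continuousOn_fst fun p hp => (hd0.trans_le hp.1.1).ne'
      fun_prop)
  have hv : ∀ t < 0, emdenPosition V t = v₀ := fun t ht =>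
    eq_of_energy_bounded (a := (N : ℝ) - 2 / 3) (by linarith) hbpos hv₀pos
      (fun t _ => emdenPosition_pos (hpos _ (Real.exp_pos t)))
      (fun t _ => hasDerivAt_emdenPosition (hasDerivAt_gap hF μ (Real.exp_pos t)))
      (fun t ht => by
        rw [hμb]
        exact hasDerivAt_emdenVelocity (hpos _ (Real.exp_pos t))
          (hasDerivAt_gap hF μ (Real.exp_pos t)) (hasDerivAt_slope hF hN1 hpos heq (hexp t ht)))
      (fun t ht => (le_abs_self _).trans (hM (_, _) ⟨hvmem t ht, hqmem t ht⟩)) ht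
  have hVeq : ∀ r ∈ Set.Ioo (0 : ℝ) 1, V r = v₀ * r ^ (2 / 3 : ℝ) := by
    intro r hr
    have h := hv (Real.log r) (Real.log_neg hr.1 hr.2)
    rw [emdenPosition, exp_third_sq, Real.exp_log hr.1,
      div_eq_iff (Real.rpow_pos_of_pos hr.1 _).ne'] at h
    exact h
  -- the boundary condition `V(1) = 1` determines the constant
  have hv₀1 : v₀ = 1 := by
    have h1 : Tendsto V (𝓝[<] 1) (𝓝 1) := by
      have h := ((hasDerivAt_gap hF μ one_pos (N := N)).continuousAt.tendsto).mono_left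
        (nhdsWithin_le_nhds (s := Set.Iio 1))
      rwa [gap_one] at h
    have h2 : Tendsto (fun r : ℝ => v₀ * r ^ (2 / 3 : ℝ)) (𝓝[<] 1) (𝓝 v₀) := by
      have h := (((Real.continuous_rpow_const (by norm_num : (0 : ℝ) ≤ 2 / 3)).const_mul
        v₀).tendsto 1).mono_left (nhdsWithin_le_nhds (s := Set.Iio 1))
      simpa using h
    refine tendsto_nhds_unique h2 (h1.congr' ?_)
    filter_upwards [Ioo_mem_nhdsLT (zero_lt_one' ℝ)] with r hr
    exact hVeq r hr
  refine ⟨by rw [← hμb, hv₀1]; ring, fun r hr => by rw [hVeq r hr, hv₀1, one_mul]⟩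

end Gap

/-! ### Existence of a global regular solution -/

open scoped BoundedContinuousFunction

/-- The nonlinearity `1 / V ^ 2`, cut off below `V = 1` and written in terms of the weighted unknown
`y(r) = e^{-2|r|} V(r)`. -/
noncomputable def weightedDensity (y : ℝ → ℝ) (r : ℝ) : ℝ :=
  1 / max (Real.exp (2 * |r|) * y r) 1 ^ 2

theorem continuous_weightedDensity {y : ℝ → ℝ} (hy : Continuous y) :
    Continuous (weightedDensity y) := by
  unfold weightedDensity
  refine continuous_const.div (by fun_prop) fun r => ?_
  have := le_max_right (Real.exp (2 * |r|) * y r) 1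
  positivity

theorem weightedDensity_nonneg (y : ℝ → ℝ) (r : ℝ) : 0 ≤ weightedDensity y r := by
  unfold weightedDensity
  positivity

theorem weightedDensity_le_one (y : ℝ → ℝ) (r : ℝ) : weightedDensity y r ≤ 1 := by
  have := le_max_right (Real.exp (2 * |r|) * y r) 1
  exact (div_le_one (by positivity)).2 (one_le_pow₀ this)

/-- The cut-off nonlinearity is Lipschitz with constant `2`. -/
theorem abs_inv_sq_max_sub_le (x y : ℝ) :
    |1 / max x 1 ^ 2 - 1 / max y 1 ^ 2| ≤ 2 * |x - y| := by
  have ha := le_max_right x 1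
  have hb := le_max_right y 1
  have hab := abs_max_sub_max_le_abs x y 1
  set a := max x 1
  set b := max y 1
  have ha0 : 0 < a := by linarith
  have hb0 : 0 < b := by linarith
  have e : 1 / a ^ 2 - 1 / b ^ 2 = -(a - b) * (1 / (a * b ^ 2) + 1 / (a ^ 2 * b)) := by
    field_simp
    ring
  have h1 : 1 / (a * b ^ 2) ≤ 1 := (div_le_one (by positivity)).2
    (one_le_mul_of_one_le_of_one_le ha (one_le_pow₀ hb))
  have h2 : 1 / (a ^ 2 * b) ≤ 1 := (div_le_one (by positivity)).2
    (one_le_mul_of_one_le_of_one_le (one_le_pow₀ ha) hb)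
  have h3 : 0 ≤ 1 / (a * b ^ 2) + 1 / (a ^ 2 * b) := by positivity
  rw [e, abs_mul, abs_neg, abs_of_nonneg h3]
  nlinarith [abs_nonneg (a - b)]

theorem integral_exp_two_mul (r : ℝ) :
    ∫ s in (0 : ℝ)..r, Real.exp (2 * s) = (Real.exp (2 * r) - 1) / 2 := by
  have h : ∀ s ∈ Set.uIcc (0 : ℝ) r,
      HasDerivAt (fun s => Real.exp (2 * s) / 2) (Real.exp (2 * s)) s := fun s _ =>
    ((((hasDerivAt_id s).const_mul 2).exp).div_const 2).congr_deriv (by simp)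
  rw [intervalIntegral.integral_eq_sub_of_hasDerivAt h
    ((by fun_prop : Continuous fun s => Real.exp (2 * s)).intervalIntegrable _ _)]
  simp
  ring

theorem mul_integral_exp_two_mul (s : ℝ) :
    s * ∫ τ in (0 : ℝ)..1, 2 * Real.exp (2 * (s * τ)) = Real.exp (2 * s) - 1 := by
  have h : ∀ τ ∈ Set.uIcc (0 : ℝ) 1,
      HasDerivAt (fun τ => Real.exp (2 * (s * τ))) (s * (2 * Real.exp (2 * (s * τ)))) τ :=
    fun τ _ => (((((hasDerivAt_id τ).const_mul s).const_mul 2).exp)).congr_deriv (by simp; ring)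
  rw [← intervalIntegral.integral_const_mul, intervalIntegral.integral_eq_sub_of_hasDerivAt h
    ((by fun_prop : Continuous fun τ => s * (2 * Real.exp (2 * (s * τ)))).intervalIntegrable _ _)]
  simp

/-- If a density is controlled by the weight, so is its radial primitive, with half the constant. -/
theorem abs_radialPrimitive_sub_le {N : ℕ} {g h : ℝ → ℝ} (hg : Continuous g) (hh : Continuous h)
    {D : ℝ} (hD : 0 ≤ D) (hgh : ∀ r ≥ 0, |g r - h r| ≤ 2 * Real.exp (2 * r) * D) (c : ℝ) {r : ℝ}
    (hr : 0 ≤ r) :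
    |radialPrimitive N g c r - radialPrimitive N h c r| ≤ Real.exp (2 * r) * (D / 2) := by
  have hmean : ∀ s ≥ 0, |s * radialMean N g s - s * radialMean N h s| ≤ Real.exp (2 * s) * D := by
    intro s hs
    have hi : ∀ {k : ℝ → ℝ}, Continuous k →
        IntervalIntegrable (fun τ => τ ^ (N - 1) * k (s * τ)) volume 0 1 := fun hk =>
      (by fun_prop : Continuous fun τ => τ ^ (N - 1) * _).intervalIntegrable _ _
    have h1 : |radialMean N g s - radialMean N h s| ≤
        ∫ τ in (0 : ℝ)..1, 2 * Real.exp (2 * (s * τ)) * D := by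
      rw [radialMean, radialMean, ← intervalIntegral.integral_sub (hi hg) (hi hh),
        ← Real.norm_eq_abs]
      refine intervalIntegral.norm_integral_le_of_norm_le zero_le_one
        (ae_of_all _ fun τ hτ => ?_)
        ((by fun_prop : Continuous fun τ => 2 * Real.exp (2 * (s * τ)) * D).intervalIntegrable _ _)
      rw [← mul_sub, norm_mul, Real.norm_eq_abs, Real.norm_eq_abs,
        abs_of_nonneg (pow_nonneg hτ.1.le _)]
      exact (mul_le_of_le_one_left (abs_nonneg _) (pow_le_one₀ hτ.1.le hτ.2)).trans
        (hgh _ (mul_nonneg hs hτ.1.le))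
    rw [← mul_sub, abs_mul, abs_of_nonneg hs]
    refine (mul_le_mul_of_nonneg_left h1 hs).trans ?_
    rw [intervalIntegral.integral_mul_const, ← mul_assoc, mul_integral_exp_two_mul]
    exact mul_le_mul_of_nonneg_right (by linarith) hD
  have hk : ∀ {k : ℝ → ℝ}, Continuous k →
      IntervalIntegrable (fun s => s * radialMean N k s) volume 0 r := fun hk =>
    (continuous_id.mul (continuous_radialMean hk)).intervalIntegrable _ _
  rw [radialPrimitive, radialPrimitive, add_sub_add_left_eq_sub,
    ← intervalIntegral.integral_sub (hk hg) (hk hh), ← Real.norm_eq_abs]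
  refine (intervalIntegral.norm_integral_le_of_norm_le hr
    (ae_of_all _ fun s hs => hmean s hs.1.le)
    ((by fun_prop : Continuous fun s => Real.exp (2 * s) * D).intervalIntegrable _ _)).trans ?_
  rw [intervalIntegral.integral_mul_const, integral_exp_two_mul]
  nlinarith

theorem continuous_radialPrimitive {N : ℕ} {g : ℝ → ℝ} (hg : Continuous g) (c : ℝ) :
    Continuous (radialPrimitive N g c) := continuous_iff_continuousAt.2 fun r =>
  (hasDerivAt_radialPrimitive hg c r).continuousAt

theorem radialPrimitive_zero_density (N : ℕ) (c r : ℝ) :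
    radialPrimitive N (fun _ => 0) c r = c := by
  simp [radialPrimitive, radialMean]

/-- The fixed-point map of the initial value problem in the weighted unknown. -/
noncomputable def weightedPicard (N : ℕ) (y : ℝ →ᵇ ℝ) : ℝ →ᵇ ℝ :=
  BoundedContinuousFunction.ofNormedAddCommGroup
    (fun r => Real.exp (-(2 * |r|)) * radialPrimitive N (weightedDensity y) 1 |r|)
    ((by fun_prop : Continuous fun r : ℝ => Real.exp (-(2 * |r|))).mul
      ((continuous_radialPrimitive (continuous_weightedDensity y.continuous) 1).comp
        continuous_abs))
    (3 / 2) fun r => by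
      have h := abs_radialPrimitive_sub_le (N := N) (continuous_weightedDensity y.continuous)
        (continuous_const (y := (0 : ℝ))) zero_le_one (fun s hs => by
          rw [sub_zero, abs_of_nonneg (weightedDensity_nonneg _ _)]
          have h1 : 1 ≤ Real.exp (2 * s) := Real.one_le_exp (by positivity)
          linarith [weightedDensity_le_one y s]) 1 (abs_nonneg r)
      rw [radialPrimitive_zero_density] at h
      have h1 : 1 ≤ Real.exp (2 * |r|) := Real.one_le_exp (by positivity)
      have h2 : |radialPrimitive N (weightedDensity y) 1 (|r|)| ≤ Real.exp (2 * |r|) * (3 / 2) := by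
        rw [abs_le] at h ⊢
        constructor <;> linarith [h.1, h.2]
      rw [norm_mul, Real.norm_eq_abs, Real.norm_eq_abs, Real.abs_exp]
      refine (mul_le_mul_of_nonneg_left h2 (Real.exp_pos _).le).trans (le_of_eq ?_)
      rw [← mul_assoc, ← Real.exp_add, neg_add_cancel, Real.exp_zero, one_mul]

theorem contractingWith_weightedPicard (N : ℕ) :
    ContractingWith (1 / 2 : NNReal) (weightedPicard N) := by
  refine ⟨NNReal.coe_lt_coe.1 (by norm_num), LipschitzWith.of_dist_le_mul fun y z => ?_⟩
  refine (BoundedContinuousFunction.dist_le (by positivity)).2 fun r => ?_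
  have h := abs_radialPrimitive_sub_le (N := N) (continuous_weightedDensity y.continuous)
    (continuous_weightedDensity z.continuous) (dist_nonneg (x := y) (y := z)) (fun s hs => by
      refine (abs_inv_sq_max_sub_le _ _).trans ?_
      rw [← mul_sub, abs_mul, Real.abs_exp, abs_of_nonneg hs, mul_assoc]
      have h1 : |y s - z s| ≤ dist y z := y.dist_coe_le_dist (g := z) s
      gcongr) 1 (abs_nonneg r)
  change |Real.exp (-(2 * |r|)) * _ - Real.exp (-(2 * |r|)) * _| ≤ _
  rw [← mul_sub, abs_mul, Real.abs_exp]
  refine (mul_le_mul_of_nonneg_left h (Real.exp_pos _).le).trans (le_of_eq ?_)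
  rw [← mul_assoc, ← Real.exp_add, neg_add_cancel, Real.exp_zero, one_mul]
  push_cast
  ring

/-- The global solution of `ΔV = 1 / V ^ 2`, `V(0) = 1`. -/
theorem exists_regular_solution (N : ℕ) : ∃ V : ℝ → ℝ, Continuous V ∧ (∀ r, 1 ≤ V r) ∧
    ∀ r ≥ 0, V r = radialPrimitive N (fun s => 1 / V s ^ 2) 1 r := by
  set y := ContractingWith.fixedPoint _ (contractingWith_weightedPicard N) with hy
  have hfix : weightedPicard N y = y := (contractingWith_weightedPicard N).fixedPoint_isFixedPt
  set V : ℝ → ℝ := fun r => Real.exp (2 * |r|) * y r with hV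
  have hVr : ∀ r, V r = radialPrimitive N (weightedDensity y) 1 |r| := by
    intro r
    have h : y r = Real.exp (-(2 * |r|)) * radialPrimitive N (weightedDensity y) 1 |r| :=
      (DFunLike.congr_fun hfix r).symm
    simp only [hV]
    rw [h, ← mul_assoc, ← Real.exp_add, add_neg_cancel, Real.exp_zero, one_mul]
  have hV1 : ∀ r, 1 ≤ V r := by
    intro r
    have h := radialPrimitive_mono (N := N) (continuous_weightedDensity y.continuous)
      (weightedDensity_nonneg y) 1 (Set.mem_Ici.2 le_rfl) (Set.mem_Ici.2 (abs_nonneg r))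
      (abs_nonneg r)
    rw [hVr r]
    simpa [radialPrimitive] using h
  have hg : weightedDensity y = fun s => 1 / V s ^ 2 := by
    funext s
    rw [weightedDensity, max_eq_left (hV1 s)]
  refine ⟨V, by fun_prop, hV1, fun r hr => ?_⟩
  rw [hVr r, hg, abs_of_nonneg hr]

/-! ### Rescaled regular solutions and the two suprema -/

section Regular

variable {N : ℕ} {V : ℝ → ℝ}

theorem hasDerivAt_regular (hVc : Continuous V) (hV1 : ∀ r, 1 ≤ V r)
    (hV : ∀ r ≥ 0, V r = radialPrimitive N (fun s => 1 / V s ^ 2) 1 r) {r : ℝ} (hr : 0 < r) :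
    HasDerivAt V (r * radialMean N (fun s => 1 / V s ^ 2) r) r := by
  have hg : Continuous fun s => 1 / V s ^ 2 := continuous_const.div (hVc.pow 2) fun s =>
    pow_ne_zero 2 (zero_lt_one.trans_le (hV1 s)).ne'
  refine (hasDerivAt_radialPrimitive hg 1 r).congr_of_eventuallyEq ?_
  filter_upwards [lt_mem_nhds hr] with s hs
  exact hV s hs.le

theorem hasDerivAt_regular_slope (hN : 1 ≤ N) (hVc : Continuous V) (hV1 : ∀ r, 1 ≤ V r)
    {r : ℝ} (hr : 0 < r) :
    HasDerivAt (fun r => r * radialMean N (fun s => 1 / V s ^ 2) r) (1 / V r ^ 2 -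
      ((N : ℝ) - 1) * (r * radialMean N (fun s => 1 / V s ^ 2) r) / r) r := by
  have hg : Continuous fun s => 1 / V s ^ 2 := continuous_const.div (hVc.pow 2) fun s =>
    pow_ne_zero 2 (zero_lt_one.trans_le (hV1 s)).ne'
  refine ((hasDerivAt_id r).mul (hasDerivAt_radialMean hN hg hr.ne')).congr_deriv ?_
  simp only [id]
  field_simp
  ring

/-- The regular solution lies above a multiple of the singular power solution. -/
theorem mul_rpow_le_regular (hN : 1 ≤ N) (hVc : Continuous V) (hV1 : ∀ r, 1 ≤ V r)
    (hV : ∀ r ≥ 0, V r = radialPrimitive N (fun s => 1 / V s ^ 2) 1 r) {r : ℝ} (hr : 0 < r) :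
    (3 / 2 * (1 / N)) ^ (1 / 3 : ℝ) * r ^ (2 / 3 : ℝ) ≤ V r := by
  have hV0 : ∀ r, 0 < V r := fun r => zero_lt_one.trans_le (hV1 r)
  have hg : Continuous fun s => 1 / V s ^ 2 := continuous_const.div (hVc.pow 2) fun s =>
    pow_ne_zero 2 (hV0 s).ne'
  have hmono : MonotoneOn V (Set.Ici 0) := by
    refine (radialPrimitive_mono (N := N) hg (fun s => by have := hV0 s; positivity) 1).congr
      fun s hs => (hV s hs).symm
  have hmean : ∀ s > 0, 1 / V s ^ 2 / N ≤ radialMean N (fun s => 1 / V s ^ 2) s := by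
    intro s hs
    have h1 : ∫ τ in (0 : ℝ)..1, τ ^ (N - 1) * (1 / V s ^ 2) = 1 / V s ^ 2 / N := by
      rw [intervalIntegral.integral_mul_const, integral_pow, Nat.sub_add_cancel hN,
        Nat.cast_sub hN]
      rw [one_pow, zero_pow (by omega)]
      push_cast
      ring
    rw [← h1]
    refine intervalIntegral.integral_mono_on zero_le_one
      ((by fun_prop : Continuous fun τ : ℝ => τ ^ (N - 1) * (1 / V s ^ 2)).intervalIntegrable _ _)
      (Continuous.intervalIntegrable ((continuous_pow (N - 1)).mul
        (hg.comp (continuous_const.mul continuous_id))) _ _) fun τ hτ => ?_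
    have h2 := hmono (Set.mem_Ici.2 (mul_nonneg hs.le hτ.1)) (Set.mem_Ici.2 hs.le)
      (mul_le_of_le_one_right hs.le hτ.2)
    have h3 := hV0 (s * τ)
    have h4 := hτ.1
    simp only
    gcongr
  refine mul_rpow_le_of_cube (by positivity) hr.le (hV0 r).le
    (mul_sq_le_cube (R := r + 1) (fun r hr => hasDerivAt_regular hVc hV1 hV hr.1)
      (fun r _ => hV0 r) (fun s hs => ?_) ⟨hr, lt_add_one r⟩)
  have h1 := hmean s hs.1
  have h2 := hV0 s
  have h3 := hs.1
  calc 2 / 3 * (3 / 2 * (1 / (N : ℝ))) * s = V s ^ 2 * (s * (1 / V s ^ 2 / N)) := by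
        field_simp
    _ ≤ _ := by gcongr

/-- The regular solution is asymptotic to the singular power solution. -/
theorem tendsto_regular_div_rpow (hN : 2 ≤ N) (hVc : Continuous V) (hV1 : ∀ r, 1 ≤ V r)
    (hV : ∀ r ≥ 0, V r = radialPrimitive N (fun s => 1 / V s ^ 2) 1 r) :
    ∃ v₀ > 0, 2 / 3 * ((N : ℝ) - 4 / 3) * v₀ ^ 3 = 1 ∧
      Tendsto (fun r => V r / r ^ (2 / 3 : ℝ)) atTop (𝓝 v₀) := by
  have hN1 : 1 ≤ N := by omega
  have hN2 : (2 : ℝ) ≤ N := by exact_mod_cast hN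
  have hb0 : (0 : ℝ) < N - 4 / 3 := by linarith
  set b : ℝ := 2 / 3 * ((N : ℝ) - 4 / 3) with hb
  have hbpos : 0 < b := by positivity
  set v₀ : ℝ := (1 / b) ^ (1 / 3 : ℝ) with hv₀
  have hv₀pos : 0 < v₀ := by positivity
  have hμb : b * v₀ ^ 3 = 1 := by
    rw [hv₀, ← Real.rpow_natCast, ← Real.rpow_mul (by positivity)]
    norm_num
    field_simp
  have hV0 : ∀ r, 0 < V r := fun r => zero_lt_one.trans_le (hV1 r)
  refine ⟨v₀, hv₀pos, hμb, ?_⟩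
  have h := tendsto_equilibrium (a := (N : ℝ) - 2 / 3) (by linarith) hbpos hv₀pos
    (fun t => emdenPosition_pos (hV0 (Real.exp t)))
    (fun t => hasDerivAt_emdenPosition (hasDerivAt_regular hVc hV1 hV (Real.exp_pos t)))
    (fun t => by
      rw [hμb]
      exact hasDerivAt_emdenVelocity (hV0 _) (hasDerivAt_regular hVc hV1 hV (Real.exp_pos t))
        (hasDerivAt_regular_slope hN1 hVc hV1 (Real.exp_pos t)))
  refine (h.comp Real.tendsto_log_atTop).congr' ?_
  filter_upwards [eventually_gt_atTop 0] with r hr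
  rw [Function.comp_apply, emdenPosition, exp_third_sq, Real.exp_log hr]

/-- The scaling of the radial Poisson equation. -/
theorem radialPrimitive_comp_mul (g : ℝ → ℝ) (β r : ℝ) :
    β ^ 2 * radialPrimitive N (fun s => g (β * s)) 0 r = radialPrimitive N g 0 (β * r) := by
  have h := intervalIntegral.smul_integral_comp_mul_left (a := 0) (b := r)
    (fun s => s * radialMean N g s) β
  simp only [mul_zero, smul_eq_mul] at h
  simp only [radialPrimitive, zero_add]
  rw [← h, pow_two, mul_assoc]
  congr 1
  rw [← intervalIntegral.integral_const_mul]
  refine intervalIntegral.integral_congr fun s _ => ?_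
  simp only [radialMean, mul_assoc]

/-- The rescaled regular solutions `w(x) = 1 - V(β ‖x‖) / V(β)` are classical solutions. -/
theorem mem_classicalSpectrum_of_regular (hN : 1 ≤ N) (hVc : Continuous V) (hV1 : ∀ r, 1 ≤ V r)
    (hV : ∀ r ≥ 0, V r = radialPrimitive N (fun s => 1 / V s ^ 2) 1 r) {β : ℝ} (hβ : 0 < β) :
    β ^ 2 / V β ^ 3 * nonlocalFactor (B N) (fun x => 1 - V (β * ‖x‖) / V β) ^ 2 ∈
      classicalSpectrum N := by
  have hV0 : ∀ r, 0 < V r := fun r => zero_lt_one.trans_le (hV1 r)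
  set g : ℝ → ℝ := fun s => 1 / V s ^ 2 with hgdef
  have hg : Continuous g := continuous_const.div (hVc.pow 2) fun s => pow_ne_zero 2 (hV0 s).ne'
  have hVβ := hV0 β
  have hK : 0 < nonlocalFactor (B N) (fun x => 1 - V (β * ‖x‖) / V β) := by
    unfold nonlocalFactor
    have : 0 ≤ ∫ x in B N, 1 / (1 - (1 - V (β * ‖x‖) / V β)) := integral_nonneg fun x => by
      rw [sub_sub_cancel]
      have := hV0 (β * ‖x‖)
      positivity
    linarith
  have hU : ∀ r ≥ 0, radialPrimitive N (fun s => β ^ 2 / V β * g (β * s)) 0 r =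
      (V (β * r) - 1) / V β := by
    intro r hr
    rw [hV (β * r) (mul_nonneg hβ.le hr), radialPrimitive_const_mul, div_mul_eq_mul_div,
      radialPrimitive_comp_mul]
    simp only [radialPrimitive, zero_add, add_sub_cancel_left]
  have hw : ∀ r ≥ 0, radialPrimitive N (fun s => β ^ 2 / V β * g (β * s)) 0 1 -
      radialPrimitive N (fun s => β ^ 2 / V β * g (β * s)) 0 r = 1 - V (β * r) / V β := by
    intro r hr
    rw [hU r hr, hU 1 zero_le_one, mul_one]
    field_simp
    ring
  refine mem_classicalSpectrum_of_radialPrimitive hN (g := fun s => β ^ 2 / V β * g (β * s))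
    (μ := β ^ 2 / V β ^ 3) (continuous_const.mul (hg.comp (continuous_const.mul continuous_id)))
    (fun r => ?_) (by positivity) (fun r hr => ?_) (fun r hr => ?_) ?_
  · have := hV0 (β * r)
    simp only [hgdef]
    positivity
  · rw [hw r hr.1]
    have := div_pos (hV0 (β * r)) hVβ
    linarith
  · rw [hw r hr.1, sub_sub_cancel]
    have := hV0 (β * r)
    simp only [hgdef]
    field_simp
  · congr 2
    refine congrArg _ (funext fun x => ?_)
    exact (hw _ (norm_nonneg x)).symm

end Regular

/-- The parameter of the singular power solution is a limit of parameters of classical solutions. -/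
theorem le_lamStar_of_rpow {N : ℕ} (hN : 2 ≤ N) {w : E N → ℝ}
    (hw : ∀ x ∈ B N, x ≠ 0 → w x = 1 - ‖x‖ ^ (2 / 3 : ℝ))
    (hint : IntegrableOn (fun x => 1 / (1 - w x)) (B N)) :
    ((2 / 3 * ((N : ℝ) - 4 / 3) * nonlocalFactor (B N) w ^ 2 : ℝ) : EReal) ≤ lamStar N := by
  have hN1 : 1 ≤ N := by omega
  obtain ⟨V, hVc, hV1, hV⟩ := exists_regular_solution N
  have hV0 : ∀ r, 0 < V r := fun r => zero_lt_one.trans_le (hV1 r)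
  obtain ⟨v₀, hv₀, hμb, hlim⟩ := tendsto_regular_div_rpow hN hVc hV1 hV
  set d : ℝ := (3 / 2 * (1 / N)) ^ (1 / 3 : ℝ) with hd
  have hd0 : 0 < d := by positivity
  have hmul : ∀ {s : ℝ}, 0 < s → Tendsto (fun n : ℕ => V (n * s) / (n * s) ^ (2 / 3 : ℝ)) atTop
      (𝓝 v₀) := fun hs =>
    hlim.comp (tendsto_natCast_atTop_atTop.atTop_mul_const hs)
  have hlim1 : Tendsto (fun n : ℕ => V n / (n : ℝ) ^ (2 / 3 : ℝ)) atTop (𝓝 v₀) :=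
    hlim.comp tendsto_natCast_atTop_atTop
  have hμ : Tendsto (fun n : ℕ => (n : ℝ) ^ 2 / V n ^ 3) atTop (𝓝 (2 / 3 * ((N : ℝ) - 4 / 3))) := by
    have h := (hlim1.pow 3).inv₀ (pow_ne_zero 3 hv₀.ne')
    rw [← eq_inv_of_mul_eq_one_left hμb] at h
    refine h.congr fun n => ?_
    rw [div_pow, cube_rpow n.cast_nonneg, inv_div]
  obtain ⟨C, hC⟩ : ∃ C, ∀ᶠ n : ℕ in atTop, V n / (n : ℝ) ^ (2 / 3 : ℝ) ≤ C :=
    ⟨v₀ + 1, hlim1.eventually (Iic_mem_nhds (lt_add_one v₀))⟩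
  have hK : Tendsto (fun n : ℕ => nonlocalFactor (B N) (fun x => 1 - V (n * ‖x‖) / V n)) atTop
      (𝓝 (nonlocalFactor (B N) w)) := by
    unfold nonlocalFactor
    refine Tendsto.const_add 1 (tendsto_integral_filter_of_dominated_convergence
      (fun x => C / d * (1 / (1 - w x))) ?_ ?_ (hint.const_mul _) ?_)
    · refine Eventually.of_forall fun n => Continuous.aestronglyMeasurable ?_
      simp only [sub_sub_cancel]
      exact continuous_const.div ((hVc.comp (by fun_prop)).div_const _) fun x =>
        (div_pos (hV0 _) (hV0 _)).ne'
    · filter_upwards [hC, eventually_gt_atTop 0] with n hn hn0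
      refine ae_B_ne_zero hN1 fun x hx hx0 => ?_
      have hx1 := norm_pos_iff.2 hx0
      have hn1 : (0 : ℝ) < n := by exact_mod_cast hn0
      have h1 := mul_rpow_le_regular hN1 hVc hV1 hV (mul_pos hn1 hx1)
      have h2 := hV0 (n * ‖x‖)
      have h3 := hV0 n
      have h4 : V n ≤ C * (n : ℝ) ^ (2 / 3 : ℝ) := (div_le_iff₀ (by positivity)).1 hn
      have h5 := h3.le.trans h4
      rw [sub_sub_cancel, hw x hx hx0, sub_sub_cancel, one_div_div, Real.norm_eq_abs,
        abs_of_pos (by positivity)]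
      rw [Real.mul_rpow hn1.le hx1.le] at h1
      calc V n / V (n * ‖x‖) ≤ C * (n : ℝ) ^ (2 / 3 : ℝ) /
            (d * ((n : ℝ) ^ (2 / 3 : ℝ) * ‖x‖ ^ (2 / 3 : ℝ))) := by gcongr
        _ = C / d * (1 / ‖x‖ ^ (2 / 3 : ℝ)) := by field_simp
    · refine ae_B_ne_zero hN1 fun x hx hx0 => ?_
      have hx1 := norm_pos_iff.2 hx0
      have h := (hlim1.div (hmul hx1) hv₀.ne').mul_const (1 / ‖x‖ ^ (2 / 3 : ℝ))
      rw [div_self hv₀.ne', one_mul] at h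
      rw [hw x hx hx0, sub_sub_cancel]
      refine h.congr' ?_
      filter_upwards [eventually_gt_atTop 0] with n hn0
      have hn1 : (0 : ℝ) < n := by exact_mod_cast hn0
      have h2 := hV0 (n * ‖x‖)
      simp only [Pi.div_apply]
      rw [sub_sub_cancel, Real.mul_rpow hn1.le hx1.le]
      field_simp
  refine le_of_tendsto ((continuous_coe_real_ereal.tendsto _).comp (hμ.mul (hK.pow 2))) ?_
  filter_upwards [eventually_gt_atTop 0] with n hn
  exact le_sSup (Set.mem_image_of_mem _
    (mem_classicalSpectrum_of_regular hN1 hVc hV1 hV (by exact_mod_cast hn)))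

/-- A weak solution is classical if its gap stays away from zero, and the singular power solution
otherwise. -/
theorem lamHat_le_lamStar {N : ℕ} (hN : 1 ≤ N) : lamHat N ≤ lamStar N := by
  refine sSup_le ?_
  rintro _ ⟨lam, ⟨hlam, w, hweak, hrad⟩, rfl⟩
  obtain ⟨μ, F, hμ, hF, h0, hpos, heq, hw, hlamK⟩ := hweak.exists_gap hN hlam hrad
  have hmono := monotoneOn_gap (N := N) hF h0 hμ.le
  by_cases hδ : ∃ δ > 0, ∀ r > 0, δ ≤ gap N F μ r
  · obtain ⟨δ, hδ, hge⟩ := hδ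
    exact le_sSup (Set.mem_image_of_mem _
      (mem_classicalSpectrum_of_gap_ge hN hlam hμ hF h0 heq hw hlamK hδ hge))
  · push Not at hδ
    have hlim : Tendsto (gap N F μ) (𝓝[>] 0) (𝓝 0) := by
      refine tendsto_order.2 ⟨fun a ha => ?_, fun a ha => ?_⟩
      · filter_upwards [self_mem_nhdsWithin] with r hr
        exact ha.trans (hpos r hr)
      · obtain ⟨r, hr, hra⟩ := hδ a ha
        filter_upwards [Ioo_mem_nhdsGT hr] with s hs
        exact (hmono hs.1 hr hs.2.le).trans_lt hra
    have hN2 := two_le_of_tendsto_gap hF h0 hN hμ hpos heq hlim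
    obtain ⟨hμb, hgap⟩ := eq_rpow_of_tendsto_gap hF h0 hN2 hμ hpos heq hlim
    obtain ⟨u, -, -, -, -, -, -, hL1, -⟩ := hweak
    change (lam : EReal) ≤ _
    rw [hlamK, hμb]
    refine le_lamStar_of_rpow hN2 (fun x hx hx0 => ?_) (memLp_one_iff_integrable.1 hL1.2.1)
    rw [hw x hx hx0, hgap _ ⟨norm_pos_iff.2 hx0, mem_ball_zero_iff.1 hx⟩]

theorem lamStar_le_lamHat {N : ℕ} : lamStar N ≤ lamHat N := by
  refine sSup_le_sSup (Set.image_mono ?_)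
  rintro lam ⟨hlam, w, hw, hrad⟩
  exact ⟨hlam, w, hw.isWeakFiniteEnergySolution, hrad⟩

end MEMS

theorem proposition2p2 (N : ℕ) (hN : 1 ≤ N) : MEMS.lamStar N = MEMS.lamHat N :=
  le_antisymm MEMS.lamStar_le_lamHat (MEMS.lamHat_le_lamStar hN)
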